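/- Theorem (Killing 2-tensors of the Wils metric). Let $U\subset\mathbb{R}^4$ be a nonempty connected open set, with coordinates $(x^1,x^2,x^3,x^4)$, on which $x^1\neq0$. Let $J=\{x^3 : x\in U\}$ and let $f:J\to\mathbb{R}$ be a $C^\infty$ function that is not identically zero. Consider on $U$ the Wils metric $$g = 2x^1dx^3dx^4 -2x^4dx^1dx^3 +\bigl(f(x^3)\,x^1((x^1)^2+(x^2)^2)-(x^4)^2\bigr)(dx^3)^2-(dx^1)^2-(dx^2)^2,$$ and let $H(x,p)=\tfrac12 g^{ij}(x)p_ip_j$ on $T^*U$. A Killing $d$-tensor is a $C^\infty$ symmetric tensor field $a^{i_1\cdots i_d}$ on $U$ such that $I=a^{i_1\cdots i_d}(x)p_{i_1}\cdots p_{i_d}$ satisfies $\{H,I\}=0$; such an $I$ is called a (linear for $d=1$, quadratic for $d=2$) integral. A Killing vector is a $C^\infty$ vector field $X$ on $U$ with $L_Xg=0$. (1) The metric $g$ has a Killing 2-tensor whose quadratic integral is not a constant multiple of $H$ if and only if it has a Killing vector that is not identically zero. (2) This happens if and only if there are a sign $\varepsilon\in\{1,-1\}$ and real constants $c_0,c_1,c_2$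 such that, for all $u\in J$, $c_0+c_1u+c_2u^2\neq0$ and $$f(u)=\varepsilon\,(c_0+c_1u+c_2u^2)^{-2}.$$ (3) For every such representation of $f$, the vector field $$X=(c_0+c_1x^3+c_2(x^3)^2)\,\partial_{x^3}-(2c_2x^1+c_1x^4+2c_2x^3x^4)\,\partial_{x^4}$$ is a Killing vector, $I_1=\langle X,p\rangle$ is a linear integral, and the quadratic integrals of $g$ are exactly the functions $k_1I_1^2+k_2H$ with constants $k_1,k_2\in\mathbb{R}$. -/

import Mathlib

open scoped ContDiff Matrix

noncomputable section

namespace KillingWils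

/-- The `i`-th partial derivative of a function on coordinate space. -/
def partialDeriv {n : ℕ} (i : Fin n) (F : (Fin n → ℝ) → ℝ) (x : Fin n → ℝ) : ℝ :=
  fderiv ℝ F x (Pi.single i 1)

/-- The Poisson bracket
`{F, G} = ∑ i, (∂F/∂pᵢ ∂G/∂xⁱ - ∂F/∂xⁱ ∂G/∂pᵢ)` of two functions `F(x, p)`, `G(x, p)`
on the cotangent bundle of coordinate space. -/
def poissonBracket {n : ℕ} (F G : (Fin n → ℝ) → (Fin n → ℝ) → ℝ)
    (x p : Fin n → ℝ) : ℝ :=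
  ∑ i, (partialDeriv i (fun q => F x q) p * partialDeriv i (fun y => G y p) x
    - partialDeriv i (fun y => F y p) x * partialDeriv i (fun q => G x q) p)

/-- The energy function `H(x, p) = ½ gⁱʲ(x) pᵢ pⱼ` of a metric with matrix `g x = (gᵢⱼ(x))`. -/
def hamiltonian {n : ℕ} (g : (Fin n → ℝ) → Matrix (Fin n) (Fin n) ℝ)
    (x p : Fin n → ℝ) : ℝ :=
  (1 / 2) * (p ⬝ᵥ ((g x)⁻¹ *ᵥ p))

/-- The function `a^{i₁⋯i_d}(x) p_{i₁}⋯p_{i_d}` attached to a contravariant `d`-tensor field;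
the components are indexed by maps `s : Fin d → Fin n`. -/
def momentumPolynomial {n d : ℕ} (a : (Fin n → ℝ) → (Fin d → Fin n) → ℝ)
    (x p : Fin n → ℝ) : ℝ :=
  ∑ s : Fin d → Fin n, a x s * ∏ k, p (s k)

/-- A Killing `d`-tensor of the metric `g` on `U`: a smooth symmetric contravariant `d`-tensor
field whose momentum polynomial Poisson commutes with the energy function. -/
def IsKillingTensor {n : ℕ} (g : (Fin n → ℝ) → Matrix (Fin n) (Fin n) ℝ)
    (U : Set (Fin n → ℝ)) (d : ℕ) (a : (Fin n → ℝ) → (Fin d → Fin n) → ℝ) : Prop :=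
  ContDiffOn ℝ ∞ a U ∧
  (∀ x ∈ U, ∀ (σ : Equiv.Perm (Fin d)) (s : Fin d → Fin n), a x (s ∘ σ) = a x s) ∧
  ∀ x ∈ U, ∀ p, poissonBracket (hamiltonian g) (momentumPolynomial a) x p = 0

/-- An integral of the geodesic flow over `U` that is a homogeneous polynomial of degree `d`
in the momenta, i.e. the momentum polynomial of a Killing `d`-tensor. -/
def IsPolynomialIntegral {n : ℕ} (g : (Fin n → ℝ) → Matrix (Fin n) (Fin n) ℝ)
    (U : Set (Fin n → ℝ)) (d : ℕ) (I : (Fin n → ℝ) → (Fin n → ℝ) → ℝ) : Prop :=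
  ∃ a : (Fin n → ℝ) → (Fin d → Fin n) → ℝ, IsKillingTensor g U d a ∧
    ∀ x ∈ U, ∀ p, I x p = momentumPolynomial a x p

/-- A Killing vector field on `U`: a smooth vector field `X` with `L_X g = 0`, that is
`Xᵏ ∂ₖ gᵢⱼ + gₖⱼ ∂ᵢ Xᵏ + gᵢₖ ∂ⱼ Xᵏ = 0`. -/
def IsKillingVector {n : ℕ} (g : (Fin n → ℝ) → Matrix (Fin n) (Fin n) ℝ)
    (U : Set (Fin n → ℝ)) (X : (Fin n → ℝ) → (Fin n → ℝ)) : Prop :=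
  ContDiffOn ℝ ∞ X U ∧
  ∀ x ∈ U, ∀ i j, ∑ k, (X x k * partialDeriv k (fun y => g y i j) x
    + g x k j * partialDeriv i (fun y => X y k) x
    + g x i k * partialDeriv j (fun y => X y k) x) = 0

/-- The function `⟨X, p⟩ = Xⁱ(x) pᵢ`, linear in the momenta. -/
def linearIntegral {n : ℕ} (X : (Fin n → ℝ) → (Fin n → ℝ)) (x p : Fin n → ℝ) : ℝ :=
  ∑ i, X x i * p i

/-- The Wils metric with functional parameter `f`, in the coordinates
`x¹ = x 0, x² = x 1, x³ = x 2, x⁴ = x 3`; see `wilsMetric_lineElement`. -/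
def wilsMetric (f : ℝ → ℝ) (x : Fin 4 → ℝ) : Matrix (Fin 4) (Fin 4) ℝ :=
  !![-1, 0, -x 3, 0;
     0, -1, 0, 0;
     -x 3, 0, f (x 2) * x 0 * (x 0 ^ 2 + x 1 ^ 2) - x 3 ^ 2, x 0;
     0, 0, x 0, 0]

/-- The line element
`2x¹dx³dx⁴ - 2x⁴dx¹dx³ + (f(x³)x¹((x¹)² + (x²)²) - (x⁴)²)(dx³)² - (dx¹)² - (dx²)²`. -/
theorem wilsMetric_lineElement (f : ℝ → ℝ) (x v : Fin 4 → ℝ) :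
    v ⬝ᵥ (wilsMetric f x *ᵥ v) =
      2 * x 0 * v 2 * v 3 - 2 * x 3 * v 0 * v 2
        + (f (x 2) * x 0 * (x 0 ^ 2 + x 1 ^ 2) - x 3 ^ 2) * v 2 ^ 2 - v 0 ^ 2 - v 1 ^ 2 := by
  simp [wilsMetric, Matrix.mulVec, dotProduct, Fin.sum_univ_four]
  ring

/-- `f = ε (c₀ + c₁u + c₂u²)⁻²` on `J`, with a sign `ε = ±1`. -/
def HasWilsForm (f : ℝ → ℝ) (J : Set ℝ) (ε c₀ c₁ c₂ : ℝ) : Prop :=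
  (ε = 1 ∨ ε = -1) ∧
  ∀ u ∈ J, c₀ + c₁ * u + c₂ * u ^ 2 ≠ 0 ∧ f u = ε / (c₀ + c₁ * u + c₂ * u ^ 2) ^ 2

/-- The vector field
`(c₀ + c₁x³ + c₂(x³)²) ∂_{x³} - (2c₂x¹ + c₁x⁴ + 2c₂x³x⁴) ∂_{x⁴}`. -/
def wilsVector (c₀ c₁ c₂ : ℝ) (x : Fin 4 → ℝ) : Fin 4 → ℝ :=
  ![0, 0, c₀ + c₁ * x 2 + c₂ * x 2 ^ 2,
    -(2 * c₂ * x 0 + c₁ * x 3 + 2 * c₂ * x 2 * x 3)]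

end KillingWils

end

/-! One direction is direct. Write Q = c₀ + c₁u + c₂u². Differentiating f Q² = ε gives f' Q + 2 f Q'
= 0, and this is the only nontrivial component of the Killing equation for the vector field attached
to Q. The square of a linear integral is a quadratic integral. It is not a multiple of H unless the
vector vanishes, because H is definite on the (p₀, p₁)-plane while a square of a linear form has
rank at most one.

The content is the determination of all quadratic integrals. Write (x, y, u, v) for the coordinates
and set v = x s. In the coordinates (x, y, u, s), with canonical momenta A, B, C, E, the Hamiltonian
loses its AE term: 2H = -A² - B² + (2CE + (s² - f(u)(x² + y²)/x) E²)/x². Where f ≠ 0, the twenty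
Killing equations for the ten components (`KillingSystem`) can be solved by cross-differentiation
alone. This uses only commuting derivations and the invertibility of x, of f and of nonzero
integers, so it is carried out in an abstract differential algebra. The integrability conditions for
`ce` make `cc` a function of u. Those for `ae` and `be` make `aa`, `ab`, `bb` independent of s.
Those for `ee`, together with the E³-equation, kill `ac`, `bc`, `ab`, `ae`, `be`, and leave `aa =
bb` constant and f·`cc` constant.

With f P² = ε = ±1 this reads `cc` = kP² with k constant and k P''' = 0, and the integral is k (P
p_u - (P' v + P'' x) p_v)² + l H (`momentumPolynomial_eq_of_root`). If k ≠ 0, then P is a polynomial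
of degree at most two, which is the asserted form of f.

This argument is local and needs f ≠ 0. It is globalised by unique continuation
(`IsKillingTensor.eq_zero_of_eventually`): the integral is constant along geodesics, so its
vanishing propagates from a ball to every boundary point, where a geodesic can be aimed into the
ball. Hence k ≠ 0 near every point with f ≠ 0. Two quadratics that represent f up to sign on a
common interval have proportional squares, so the local forms continue each other. At a limit point
f Q² = ε persists by continuity, so f cannot vanish there (`exists_hasWilsForm`). -/

open scoped ContDiff Matrix

noncomputable section

namespace KillingWils

/-! ### The Killing equations: first integrability conditions -/

section

/-- A commutative algebra with four commuting derivations, modelled on the smooth functions of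
`x, y, u, s`, in which `x` and a function `f` of `u` are invertible. -/
structure WilsFrame (R : Type*) [CommRing R] [Algebra ℝ R] where
  Dx : Derivation ℝ R R
  Dy : Derivation ℝ R R
  Du : Derivation ℝ R R
  Ds : Derivation ℝ R R
  x : R
  y : R
  s : R
  f : R
  isUnit_x : IsUnit x
  isUnit_f : IsUnit f
  Dx_x : Dx x = 1
  Dy_x : Dy x = 0
  Du_x : Du x = 0
  Ds_x : Ds x = 0
  Dx_y : Dx y = 0
  Dy_y : Dy y = 1
  Du_y : Du y = 0
  Ds_y : Ds y = 0
  Dx_s : Dx s = 0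
  Dy_s : Dy s = 0
  Du_s : Du s = 0
  Ds_s : Ds s = 1
  Dx_f : Dx f = 0
  Dy_f : Dy f = 0
  Ds_f : Ds f = 0
  comm_yx : ∀ a, Dy (Dx a) = Dx (Dy a)
  comm_ux : ∀ a, Du (Dx a) = Dx (Du a)
  comm_sx : ∀ a, Ds (Dx a) = Dx (Ds a)
  comm_uy : ∀ a, Du (Dy a) = Dy (Du a)
  comm_sy : ∀ a, Ds (Dy a) = Dy (Ds a)
  comm_su : ∀ a, Ds (Du a) = Du (Ds a)

attribute [simp] WilsFrame.Dx_x WilsFrame.Dy_x WilsFrame.Du_x WilsFrame.Ds_x WilsFrame.Dx_y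
  WilsFrame.Dy_y WilsFrame.Du_y WilsFrame.Ds_y WilsFrame.Dx_s WilsFrame.Dy_s WilsFrame.Du_s
  WilsFrame.Ds_s WilsFrame.Dx_f WilsFrame.Dy_f WilsFrame.Ds_f WilsFrame.comm_yx
  WilsFrame.comm_ux WilsFrame.comm_sx WilsFrame.comm_uy WilsFrame.comm_sy WilsFrame.comm_su

/-- The Killing equations, sorted by monomials in the momenta, for the quadratic form
`aa a² + ab ab + bb b² + ac ac + bc bc + cc c² + ae ae + be be + ce ce + ee e²`. -/
structure KillingSystem {R : Type*} [CommRing R] [Algebra ℝ R] (S : WilsFrame R) where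
  aa : R
  ab : R
  bb : R
  ac : R
  bc : R
  cc : R
  ae : R
  be : R
  ce : R
  ee : R
  eq_ccc : S.Ds cc = 0
  eq_acc : S.Ds ac = S.x ^ 2 * S.Dx cc
  eq_bcc : S.Ds bc = S.x ^ 2 * S.Dy cc
  eq_cce : S.x * S.Ds ce = -(S.x * S.Du cc) - 2 * ac
  eq_aac : S.Ds aa = S.x ^ 2 * S.Dx ac
  eq_abc : S.Ds ab = S.x ^ 2 * (S.Dx bc + S.Dy ac)
  eq_bbc : S.Ds bb = S.x ^ 2 * S.Dy bc
  eq_aaa : S.Dx aa = 0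
  eq_aab : S.Dx ab = -S.Dy aa
  eq_abb : S.Dx bb = -S.Dy ab
  eq_bbb : S.Dy bb = 0
  eq_ace : S.x * S.Ds ae = S.x ^ 3 * S.Dx ce - S.x * S.Du ac
    - (S.x * S.s ^ 2 - S.f * (S.x ^ 2 + S.y ^ 2)) * S.Ds ac - 4 * aa
  eq_bce : S.x * S.Ds be = S.x ^ 3 * S.Dy ce - S.x * S.Du bc
    - (S.x * S.s ^ 2 - S.f * (S.x ^ 2 + S.y ^ 2)) * S.Ds bc - 2 * ab
  eq_cee : 2 * S.x ^ 2 * S.Du ce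
    + 2 * S.x * (S.x * S.s ^ 2 - S.f * (S.x ^ 2 + S.y ^ 2)) * S.Ds ce
    + 2 * S.x ^ 2 * S.Ds ee + 4 * S.x * ae
    + (2 * S.x * S.s ^ 2 - S.f * (S.x ^ 2 + 3 * S.y ^ 2)) * ac + 2 * S.x * S.f * S.y * bc
    + 2 * S.x * S.Du S.f * (S.x ^ 2 + S.y ^ 2) * cc - 2 * S.x ^ 2 * S.s * ce = 0
  eq_aae : S.x ^ 3 * S.Dx ae = S.x * S.Du aa
    + (S.x * S.s ^ 2 - S.f * (S.x ^ 2 + S.y ^ 2)) * S.Ds aa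
  eq_bbe : S.x ^ 3 * S.Dy be = S.x * S.Du bb
    + (S.x * S.s ^ 2 - S.f * (S.x ^ 2 + S.y ^ 2)) * S.Ds bb
  eq_abe : S.x ^ 3 * (S.Dy ae + S.Dx be) = S.x * S.Du ab
    + (S.x * S.s ^ 2 - S.f * (S.x ^ 2 + S.y ^ 2)) * S.Ds ab
  eq_aee : 2 * S.x ^ 4 * S.Dx ee = 2 * S.x ^ 2 * S.Du ae
    + 2 * S.x * (S.x * S.s ^ 2 - S.f * (S.x ^ 2 + S.y ^ 2)) * S.Ds ae
    + (4 * S.x * S.s ^ 2 - 2 * S.f * (S.x ^ 2 + 3 * S.y ^ 2)) * aa + 2 * S.x * S.f * S.y * ab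
    + S.x * S.Du S.f * (S.x ^ 2 + S.y ^ 2) * ac - 2 * S.x ^ 2 * S.s * ae
  eq_bee : 2 * S.x ^ 4 * S.Dy ee = 2 * S.x ^ 2 * S.Du be
    + 2 * S.x * (S.x * S.s ^ 2 - S.f * (S.x ^ 2 + S.y ^ 2)) * S.Ds be
    + (2 * S.x * S.s ^ 2 - S.f * (S.x ^ 2 + 3 * S.y ^ 2)) * ab + 4 * S.x * S.f * S.y * bb
    + S.x * S.Du S.f * (S.x ^ 2 + S.y ^ 2) * bc - 2 * S.x ^ 2 * S.s * be
  eq_eee : 2 * S.x ^ 2 * S.Du ee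
    + 2 * S.x * (S.x * S.s ^ 2 - S.f * (S.x ^ 2 + S.y ^ 2)) * S.Ds ee
    + (2 * S.x * S.s ^ 2 - S.f * (S.x ^ 2 + 3 * S.y ^ 2)) * ae + 2 * S.x * S.f * S.y * be
    + S.x * S.Du S.f * (S.x ^ 2 + S.y ^ 2) * ce - 4 * S.x ^ 2 * S.s * ee = 0

variable {R : Type*} [CommRing R] [Algebra ℝ R] {S : WilsFrame R}

theorem WilsFrame.eq_zero_of_mul (S : WilsFrame R) (n : ℕ) [NeZero n] (i j : ℕ) {a : R}
    (h : (n : R) * S.x ^ i * S.f ^ j * a = 0) : a = 0 := by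
  have hn : IsUnit (n : R) := by
    have h1 : IsUnit (n : ℝ) := (Nat.cast_ne_zero.2 (NeZero.ne n)).isUnit
    simpa using h1.map (algebraMap ℝ R)
  exact (((hn.mul (S.isUnit_x.pow i)).mul (S.isUnit_f.pow j)).mul_right_eq_zero).1 h

@[simp]
theorem _root_.Derivation.map_ofNat' (D : Derivation ℝ R R) (n : ℕ) [n.AtLeastTwo] :
    D (ofNat(n) : R) = 0 := by
  rw [← Nat.cast_ofNat, D.map_natCast]

namespace KillingSystem

variable (K : KillingSystem S)

/-- The system prescribes both the s-derivative and plane derivatives of `aa`; commuting them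
constrains `ac`. The next lemmas do the same for `ab` and `bb`. -/
theorem ac_xx : S.x * S.Dx (S.Dx K.ac) + 2 * S.Dx K.ac = 0 := by
  have h := S.comm_sx K.aa
  rw [K.eq_aac, K.eq_aaa] at h
  simp at h
  refine S.eq_zero_of_mul 1 1 0 ?_
  linear_combination -h

theorem ab_xs : S.x * S.Dx (S.Dx K.bc) + 2 * S.x * S.Dx (S.Dy K.ac) + 2 * S.Dx K.bc
    + 2 * S.Dy K.ac = 0 := by
  have h := S.comm_sx K.ab
  rw [K.eq_abc, K.eq_aab] at h
  simp [K.eq_aac] at h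
  refine S.eq_zero_of_mul 1 1 0 ?_
  linear_combination -h

theorem bb_xs : 2 * S.x * S.Dx (S.Dy K.bc) + 2 * S.Dy K.bc + S.x * S.Dy (S.Dy K.ac) = 0 := by
  have h := S.comm_sx K.bb
  rw [K.eq_bbc, K.eq_abb] at h
  simp [K.eq_abc] at h
  refine S.eq_zero_of_mul 1 1 0 ?_
  linear_combination -h

theorem bc_yy : S.Dy (S.Dy K.bc) = 0 := by
  have h := S.comm_sy K.bb
  rw [K.eq_bbc, K.eq_bbb] at h
  simp at h
  refine S.eq_zero_of_mul 1 2 0 ?_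
  linear_combination -h

theorem bb_xxx : S.Dx (S.Dx (S.Dx K.bb)) = 0 := by
  have h1 : S.Dx (S.Dx K.bb) = S.Dy (S.Dy K.aa) := by
    rw [K.eq_abb, map_neg, ← S.comm_yx, K.eq_aab]; simp
  rw [h1, ← S.comm_yx, ← S.comm_yx, K.eq_aaa]; simp

theorem bc_xxy : S.x * S.Dx (S.Dx (S.Dy K.bc)) + 2 * S.Dx (S.Dy K.bc) = 0 := by
  have h1 := congrArg S.Ds K.bb_xxx
  simp [K.eq_bbc] at h1
  have h2 := congrArg (fun t => S.Dy (S.Dy t)) K.ac_xx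
  have h3 := congrArg (fun t => S.Dx (S.Dx t)) K.bb_xs
  simp at h2 h3
  refine S.eq_zero_of_mul 6 0 0 ?_
  linear_combination 2 * h1 - S.x * (h3 - h2)

/-- Elimination of `ae`: its mixed xs-derivative is computed from `eq_ace` and from `eq_aae`.
Likewise `ce_yy` eliminates `be`, and `ce_xy` eliminates both, so that all second derivatives of
`ce` in the plane are known. -/
theorem ce_xx : S.x ^ 4 * (S.x * S.Dx (S.Dx K.ce) + 2 * S.Dx K.ce) =
    2 * S.x ^ 3 * S.Dx (S.Du K.ac) + 2 * S.s * S.x ^ 3 * S.Dx K.ac - 4 * S.x * K.aa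
    + 2 * S.x ^ 2 * (S.x * S.s ^ 2 - S.f * (S.x ^ 2 + S.y ^ 2)) *
      (S.x ^ 2 * S.Dx (S.Dx K.cc) + 2 * S.x * S.Dx K.cc)
    - S.f * S.x ^ 3 * (S.x ^ 2 - S.y ^ 2) * S.Dx K.cc := by
  have h1 := congrArg S.Dx K.eq_ace
  have h2 := congrArg S.Ds K.eq_aae
  simp [K.eq_aac, K.eq_acc, K.eq_aaa] at h1 h2
  have h3 := K.eq_ace
  rw [K.eq_acc] at h3
  linear_combination -S.x ^ 2 * h1 + S.x * h3 + h2

theorem ce_yy : S.x ^ 5 * S.Dy (S.Dy K.ce) =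
    2 * S.x ^ 3 * S.Dy (S.Du K.bc) + 2 * S.s * S.x ^ 3 * S.Dy K.bc + 2 * S.x ^ 2 * S.Dy K.ab
    + 2 * S.x ^ 4 * (S.x * S.s ^ 2 - S.f * (S.x ^ 2 + S.y ^ 2)) * S.Dy (S.Dy K.cc)
    - 2 * S.f * S.y * S.x ^ 4 * S.Dy K.cc := by
  have h1 := congrArg S.Dy K.eq_bce
  have h2 := congrArg S.Ds K.eq_bbe
  simp [K.eq_bbc, K.eq_bcc] at h1 h2
  linear_combination -S.x ^ 2 * h1 + h2

theorem ce_xy : 2 * S.x ^ 4 * (S.x * S.Dx (S.Dy K.ce) + S.Dy K.ce) =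
    2 * S.x ^ 3 * (S.Dx (S.Du K.bc) + S.Dy (S.Du K.ac))
    + 2 * S.s * S.x ^ 3 * (S.Dx K.bc + S.Dy K.ac) + 2 * S.x ^ 2 * S.Dy K.aa - 2 * S.x * K.ab
    + 4 * S.x ^ 3 * (S.x * S.s ^ 2 - S.f * (S.x ^ 2 + S.y ^ 2)) *
      (S.x * S.Dx (S.Dy K.cc) + S.Dy K.cc)
    - 2 * S.f * S.y * S.x ^ 4 * S.Dx K.cc - S.f * S.x ^ 3 * (S.x ^ 2 - S.y ^ 2) * S.Dy K.cc := by
  have h1 := congrArg S.Dy K.eq_ace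
  have h2 := congrArg S.Dx K.eq_bce
  have h3 := K.eq_bce
  have h4 := congrArg S.Ds K.eq_abe
  rw [K.eq_bcc] at h3
  simp [K.eq_abc, K.eq_acc, K.eq_bcc, K.eq_aab] at h1 h2 h4
  linear_combination -S.x ^ 2 * h1 - S.x ^ 2 * h2 + S.x * h3 + h4

theorem cc_yyy : S.Dy (S.Dy (S.Dy K.cc)) = 0 := by
  have h := congrArg S.Ds K.bc_yy
  simp [K.eq_bcc] at h
  refine S.eq_zero_of_mul 1 2 0 ?_
  linear_combination h

theorem cc_xyy : S.x * S.Dx (S.Dy (S.Dy K.cc)) + 2 * S.Dy (S.Dy K.cc) = 0 := by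
  have h := congrArg S.Ds K.bb_xs
  simp [K.eq_bcc, K.eq_acc] at h
  refine S.eq_zero_of_mul 3 2 0 ?_
  linear_combination h

theorem cc_xxy : S.x ^ 2 * S.Dx (S.Dx (S.Dy K.cc)) + 4 * S.x * S.Dx (S.Dy K.cc)
    + 2 * S.Dy K.cc = 0 := by
  have h := congrArg S.Ds K.ab_xs
  simp [K.eq_bcc, K.eq_acc] at h
  refine S.eq_zero_of_mul 3 1 0 ?_
  linear_combination h

/-- Compatibility of `ce_xy` with `ce_yy`. -/
theorem compat_xyy : S.x ^ 2 * S.f * (-3 * (S.x ^ 2 - S.y ^ 2) * S.Dy (S.Dy K.cc)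
      + 6 * S.y * S.Dy K.cc + 6 * S.x * S.y * S.Dx (S.Dy K.cc) + 2 * S.x * S.Dx K.cc)
    + 6 * S.x ^ 2 * (S.Dx (S.Dy (S.Du K.bc)) + S.s * S.Dx (S.Dy K.bc))
    - 6 * (S.x * S.Dy (S.Dy K.aa) + S.Dy K.ab) = 0 := by
  have h1 := congrArg S.Dy K.ce_xy
  have h2 := congrArg S.Dx K.ce_yy
  have h3 := congrArg S.Du K.bb_xs
  have h4 : S.Dx (S.Dy K.ab) = -S.Dy (S.Dy K.aa) := by
    rw [← S.comm_yx, K.eq_aab, map_neg]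
  simp at h1 h2 h3
  refine S.eq_zero_of_mul 1 2 0 ?_
  linear_combination S.x * h1 - 2 * S.x * h2 + 8 * K.ce_yy + 2 * S.x ^ 3 * h3
    + 2 * S.x ^ 3 * S.s * K.bb_xs - 4 * S.x ^ 3 * h4

theorem ab_yy : S.Dy (S.Dy K.ab) = 0 := by
  have h := S.comm_yx K.bb
  rw [K.eq_abb, K.eq_bbb] at h
  simpa using h

theorem aa_yyy : S.Dy (S.Dy (S.Dy K.aa)) = 0 := by
  have h : S.Dy (S.Dy (S.Dx K.ab)) = S.Dx (S.Dy (S.Dy K.ab)) := by simp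
  rw [K.eq_aab, K.ab_yy] at h
  simpa using h

/-- The y-derivative annihilates every term of `compat_xyy` that does not carry the factor f, since
`bc` and `ab` are affine and `aa` is quadratic in y. -/
theorem cc_xy : 4 * S.x * S.Dx (S.Dy K.cc) + 3 * S.Dy K.cc = 0 := by
  have h1 := congrArg S.Dy K.compat_xyy
  have h2 : S.Dy (S.Dy (S.Du K.bc)) = 0 := by simpa using congrArg S.Du K.bc_yy
  simp [K.bc_yy, K.cc_yyy, K.ab_yy, K.aa_yyy, h2] at h1
  refine S.eq_zero_of_mul 2 2 1 ?_
  linear_combination h1 - 6 * S.x ^ 2 * S.f * S.y * K.cc_xyy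

/-- Two Euler equations in x without a common solution: on x^m, `cc_xy` demands 4m + 3 = 0 and
`cc_xxy` demands m² + 3m + 2 = 0. -/
theorem cc_y : S.Dy K.cc = 0 := by
  have h1 := congrArg S.Dx K.cc_xy
  simp at h1
  refine S.eq_zero_of_mul 5 0 0 ?_
  linear_combination 16 * K.cc_xxy - 4 * S.x * h1 - 9 * K.cc_xy

/-- Compatibility of `ce_xy` with `ce_xx`. -/
theorem compat_xxy : S.x ^ 3 * S.f * S.y * (S.x * S.Dx (S.Dx K.cc) + 2 * S.Dx K.cc)
    - (S.x ^ 3 * (S.Dx (S.Dy (S.Du K.ac)) + S.s * S.Dx (S.Dy K.ac))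
      + S.x ^ 2 * (S.Dx (S.Du K.bc) + S.Dy (S.Du K.ac) + S.s * (S.Dx K.bc + S.Dy K.ac)))
    + S.x * S.Dy K.aa + K.ab = 0 := by
  have h1 := congrArg S.Dx K.ce_xy
  have h2 := congrArg S.Dy K.ce_xx
  have h3 := congrArg S.Du K.ab_xs
  have h4 := K.ce_xy
  have h5 : S.Dx (S.Dy K.aa) = 0 := by rw [← S.comm_yx, K.eq_aaa, map_zero]
  rw [K.cc_y] at h4
  simp [K.cc_y, K.eq_aab] at h1 h2 h3 h4
  refine S.eq_zero_of_mul 6 1 0 ?_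
  linear_combination -S.x * h1 + 2 * S.x * h2 + 4 * h4 - 2 * S.x ^ 3 * (h3 + S.s * K.ab_xs + h5)

theorem bc_xxy_u : S.x * S.Dx (S.Dx (S.Dy (S.Du K.bc))) + 2 * S.Dx (S.Dy (S.Du K.bc)) = 0 := by
  simpa using congrArg S.Du K.bc_xxy

/-- Cross-differentiating the two compatibility conditions cancels everything but the terms with
factor f, and those containing the second x-derivative of `cc` cancel as well. -/
theorem cc_x : S.Dx K.cc = 0 := by
  have h1 := congrArg S.Dy K.compat_xxy
  have h2 := congrArg S.Dx K.compat_xyy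
  have h3 := K.compat_xyy
  have h4 : S.Dx (S.Dy K.ab) = -S.Dy (S.Dy K.aa) := by
    rw [← S.comm_yx, K.eq_aab, map_neg]
  have h5 : S.Dx (S.Dy (S.Dy K.aa)) = 0 := by
    rw [← S.comm_yx, ← S.comm_yx, K.eq_aaa]; simp
  have h6 := congrArg S.Dx K.bb_xs
  have h8 := congrArg S.Du h6
  have h9 := K.bc_xxy_u
  have h10 := K.bc_xxy
  simp [K.cc_y, h4, h5] at h1 h2 h3 h6 h8
  refine S.eq_zero_of_mul 4 3 1 ?_
  linear_combination 3 * S.x * (h2 - 6 * S.x * h9 - 6 * S.x * S.s * h10) - 6 * h1 - h3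
    - 6 * S.x ^ 2 * (h8 - 2 * h9) - 6 * S.x ^ 2 * S.s * (h6 - 2 * h10)

@[simp] theorem ac_s : S.Ds K.ac = 0 := by simp [K.eq_acc, K.cc_x]

@[simp] theorem bc_s : S.Ds K.bc = 0 := by simp [K.eq_bcc, K.cc_y]

/-- `aa`, `ab`, `bb` form a Killing tensor of the flat (x, y)-plane depending on u and s. Any
derivation commuting with the plane derivatives preserves this; it is applied with `Du` and `Ds`. -/
theorem D_aa_x (D : Derivation ℝ R R) (hD : ∀ a, D (S.Dx a) = S.Dx (D a)) :
    S.Dx (D K.aa) = 0 := by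
  rw [← hD, K.eq_aaa, map_zero]

theorem D_ab_x (D : Derivation ℝ R R) (hx : ∀ a, D (S.Dx a) = S.Dx (D a))
    (hy : ∀ a, D (S.Dy a) = S.Dy (D a)) : S.Dx (D K.ab) = -S.Dy (D K.aa) := by
  rw [← hx, K.eq_aab, map_neg, hy]

theorem D_ab_y (D : Derivation ℝ R R) (hx : ∀ a, D (S.Dx a) = S.Dx (D a))
    (hy : ∀ a, D (S.Dy a) = S.Dy (D a)) : S.Dy (D K.ab) = -S.Dx (D K.bb) := by
  rw [← hx, K.eq_abb, map_neg, hy, neg_neg]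

theorem D_bb_y (D : Derivation ℝ R R) (hD : ∀ a, D (S.Dy a) = S.Dy (D a)) :
    S.Dy (D K.bb) = 0 := by
  rw [← hD, K.eq_bbb, map_zero]

theorem D_bb_xx (D : Derivation ℝ R R) (hx : ∀ a, D (S.Dx a) = S.Dx (D a))
    (hy : ∀ a, D (S.Dy a) = S.Dy (D a)) : S.Dx (S.Dx (D K.bb)) = S.Dy (S.Dy (D K.aa)) := by
  rw [← neg_neg (S.Dx (D K.bb)), ← K.D_ab_y D hx hy, map_neg, ← S.comm_yx, K.D_ab_x D hx hy,
    map_neg, neg_neg]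

theorem bb_s_quadratic : 2 * S.Ds K.bb - 2 * S.x * S.Dx (S.Ds K.bb)
    + S.x ^ 2 * S.Dy (S.Dy (S.Ds K.aa)) = 0 := by
  rw [← K.D_bb_xx S.Ds S.comm_sx S.comm_sy, K.eq_bbc]
  simp
  linear_combination S.x ^ 3 * K.bc_xxy

/-- The Saint-Venant compatibility condition of `eq_aae`, `eq_abe`, `eq_bbe`. -/
theorem saintVenant :
    S.f * (S.x ^ 3 * S.Dy (S.Dy (S.Ds K.aa))
      - S.x ^ 2 * (S.Dx (S.Ds K.bb) - S.x * S.Dy (S.Dy (S.Ds K.aa))) + 2 * S.x * S.Ds K.aa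
      + 6 * S.y * (S.Ds K.ab + S.x * S.Dy (S.Ds K.aa))
      + 3 * S.y ^ 2 * (S.Dx (S.Ds K.bb) - S.x * S.Dy (S.Dy (S.Ds K.aa)))) =
    3 * (2 * S.Du K.bb - 2 * S.x * S.Dx (S.Du K.bb) + S.x ^ 2 * S.Dy (S.Dy (S.Du K.aa))) := by
  have h1 := congrArg (fun t => S.Dy (S.Dy t)) K.eq_aae
  have h2 := congrArg S.Dx K.eq_bbe
  have h2' := congrArg (fun t => S.Dx (S.Dx t)) K.eq_bbe
  have h3 := congrArg S.Dy K.eq_abe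
  have h3' := congrArg (fun t => S.Dx (S.Dy t)) K.eq_abe
  have h4 := K.eq_bbe
  simp [K.D_ab_x S.Ds S.comm_sx S.comm_sy, K.D_ab_y S.Ds S.comm_sx S.comm_sy,
    K.D_ab_y S.Du S.comm_ux S.comm_uy,
    K.D_bb_xx S.Ds S.comm_sx S.comm_sy, K.D_bb_xx S.Du S.comm_ux S.comm_uy] at h1 h2 h2' h3 h3'
  refine sub_eq_zero.1 (S.eq_zero_of_mul 1 1 0 ?_)
  linear_combination S.x ^ 2 * h1 + S.x ^ 2 * h2' - 6 * S.x * h2 + 12 * h4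
    - S.x ^ 2 * h3' + 3 * S.x * h3
    + (3 * S.x * S.s ^ 2 - 6 * S.f * S.y ^ 2 - S.f * S.x ^ 2) * K.bb_s_quadratic

end KillingSystem

end

/-! ### Independence of s, then elimination of `ac`, `ae` and `be` -/

section

variable {R : Type*} [CommRing R] [Algebra ℝ R] {S : WilsFrame R}
namespace KillingSystem

variable (K : KillingSystem S)

/-- The right side of `saintVenant` is independent of x. Its x-derivative therefore leaves, after
cancelling f, a polynomial in x with coefficients independent of x; further x-derivatives isolate
these from the top degree down. -/
theorem aa_s_yy_and : S.Dy (S.Dy (S.Ds K.aa)) = 0 ∧ S.Dx (S.Ds K.bb) = 0 ∧ S.Ds K.aa = 0 := by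
  have hx : S.Dx (S.Dx (S.Ds K.bb)) = S.Dy (S.Dy (S.Ds K.aa)) :=
    K.D_bb_xx S.Ds S.comm_sx S.comm_sy
  have hux : S.Dx (S.Dx (S.Du K.bb)) = S.Dy (S.Dy (S.Du K.aa)) :=
    K.D_bb_xx S.Du S.comm_ux S.comm_uy
  have ha : S.Dx (S.Ds K.aa) = 0 := K.D_aa_x S.Ds S.comm_sx
  have hb : S.Dx (S.Dy (S.Ds K.aa)) = 0 := by rw [← S.comm_yx, ha, map_zero]
  have hc : S.Dx (S.Dy (S.Dy (S.Ds K.aa))) = 0 := by rw [← S.comm_yx, hb, map_zero]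
  have hd : S.Dx (S.Dy (S.Dy (S.Du K.aa))) = 0 := by
    rw [← S.comm_yx, ← S.comm_yx, K.D_aa_x S.Du S.comm_ux]; simp
  have he : S.Dx (S.Ds K.ab) = -S.Dy (S.Ds K.aa) := K.D_ab_x S.Ds S.comm_sx S.comm_sy
  have h0 := congrArg S.Dx K.saintVenant
  simp [hx, hux, ha, hb, hc, hd, he] at h0
  have h1 : 3 * S.x ^ 2 * S.Dy (S.Dy (S.Ds K.aa))
      - 2 * S.x * (S.Dx (S.Ds K.bb) - S.x * S.Dy (S.Dy (S.Ds K.aa))) + 2 * S.Ds K.aa = 0 := by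
    refine S.eq_zero_of_mul 1 0 1 ?_
    linear_combination h0
  have h2 := congrArg S.Dx h1
  simp [hx, ha, hc] at h2
  have h3 := congrArg S.Dx h2
  simp [hx, hc] at h3
  have hw : S.Dy (S.Dy (S.Ds K.aa)) = 0 := by
    refine S.eq_zero_of_mul 6 0 0 ?_
    linear_combination h3
  rw [hw] at h1 h2
  have hk : S.Dx (S.Ds K.bb) = 0 := by
    refine S.eq_zero_of_mul 2 0 0 ?_
    linear_combination -h2
  rw [hk] at h1
  refine ⟨hw, hk, ?_⟩
  refine S.eq_zero_of_mul 2 0 0 ?_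
  linear_combination h1

@[simp] theorem aa_s : S.Ds K.aa = 0 := K.aa_s_yy_and.2.2

@[simp] theorem bb_s : S.Ds K.bb = 0 := by
  have h := K.bb_s_quadratic
  rw [K.aa_s_yy_and.1, K.aa_s_yy_and.2.1] at h
  refine S.eq_zero_of_mul 2 0 0 ?_
  linear_combination h

@[simp] theorem ab_s : S.Ds K.ab = 0 := by
  have h := congrArg S.Dy K.saintVenant
  have h1 : S.Dy (S.Dy (S.Dy (S.Du K.aa))) = 0 := by simpa using congrArg S.Du K.aa_yyy
  have h2 : S.Dy (S.Du K.bb) = 0 := K.D_bb_y S.Du S.comm_uy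
  have h3 : S.Dy (S.Ds K.ab) = -S.Dx (S.Ds K.bb) := K.D_ab_y S.Ds S.comm_sx S.comm_sy
  simp [h1, h2, h3] at h
  refine S.eq_zero_of_mul 6 0 1 ?_
  linear_combination h

@[simp] theorem ac_x : S.Dx K.ac = 0 := by
  have h := K.eq_aac
  rw [K.aa_s] at h
  refine S.eq_zero_of_mul 1 2 0 ?_
  linear_combination -h

@[simp] theorem bc_y : S.Dy K.bc = 0 := by
  have h := K.eq_bbc
  rw [K.bb_s] at h
  refine S.eq_zero_of_mul 1 2 0 ?_
  linear_combination -h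

theorem bc_x : S.Dx K.bc = -S.Dy K.ac := by
  have h := K.eq_abc
  rw [K.ab_s] at h
  refine eq_neg_of_add_eq_zero_left (S.eq_zero_of_mul 1 2 0 ?_)
  linear_combination -h

/-- By now (`ac`, `bc`) is a Killing vector of the flat plane, so only the last two terms of
`compat_xxy` survive. -/
theorem ab_eq : K.ab = -(S.x * S.Dy K.aa) := by
  have h := K.compat_xxy
  have h1 : S.Dx (S.Dy K.ac) = 0 := by rw [← S.comm_yx, K.ac_x, map_zero]
  have h2 : S.Dx (S.Dy (S.Du K.ac)) = 0 := by
    rw [← S.comm_uy, ← S.comm_ux, h1, map_zero]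
  have h3 : S.Dx (S.Du K.bc) = -S.Dy (S.Du K.ac) := by
    rw [← S.comm_ux, K.bc_x, map_neg, S.comm_uy]
  rw [K.cc_x, map_zero, h1, h2, h3, K.bc_x] at h
  linear_combination h

theorem ce_xs : S.x ^ 2 * S.Dx (S.Ds K.ce) = 2 * K.ac := by
  have h := congrArg S.Dx K.eq_cce
  have h1 : S.Dx (S.Du K.cc) = 0 := by rw [← S.comm_ux, K.cc_x, map_zero]
  simp [h1] at h
  linear_combination S.x * h - K.eq_cce

theorem ae_ss : S.Ds (S.Ds K.ae) = 2 * K.ac := by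
  have h := congrArg S.Ds K.eq_ace
  simp at h
  refine sub_eq_zero.1 (S.eq_zero_of_mul 1 1 0 ?_)
  linear_combination h + S.x * K.ce_xs

/-- Elimination of `ee`: its xs-derivative is computed from `eq_aee` and from `eq_cee`. -/
theorem ae_eq_aux : 3 * S.x * K.ae = 2 * S.x * S.Du (S.Ds K.ae) - S.x * S.s * S.Du K.ac
    + S.x * S.Du (S.Du K.ac) + 3 * S.x * S.s ^ 2 * K.ac + 6 * S.Du K.aa
    + S.x * (S.x ^ 2 - S.y ^ 2) * (S.f * S.Du K.cc + S.Du S.f * K.cc)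
    - S.f * (2 * S.x ^ 2 * K.ac + 3 * S.y ^ 2 * K.ac + S.x * S.y * K.bc
      + S.x ^ 2 * S.y * S.Dy K.ac) := by
  have h1 := congrArg S.Ds K.eq_aee
  have h2 := congrArg S.Dx K.eq_cee
  have h3 := congrArg S.Du K.eq_ace
  have h4 := K.eq_ace
  have h5 : S.Dx (S.Du S.f) = 0 := by rw [← S.comm_ux, S.Dx_f, map_zero]
  have h6 : S.Ds (S.Du S.f) = 0 := by rw [S.comm_su, S.Ds_f, map_zero]
  simp [K.ae_ss, K.bc_x, h5, h6, K.cc_x] at h1 h2 h3 h4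
  refine sub_eq_zero.1 (S.eq_zero_of_mul 2 1 0 ?_)
  linear_combination h1 - S.x ^ 2 * h2 + 2 * S.x * K.eq_cee + 4 * K.eq_aae - 2 * S.x * h3
    + 4 * (S.x * S.s ^ 2 - S.f * (S.x ^ 2 + S.y ^ 2)) * K.aa_s
    + 2 * S.x * S.s * h4 + 2 * S.x * (S.x * S.s ^ 2 - S.f * (S.x ^ 2 + S.y ^ 2)) * K.ce_xs
    - 2 * S.x * S.f * (S.x ^ 2 - S.y ^ 2) * K.eq_cce

theorem ae_s_eq : S.Ds K.ae = S.Du K.ac + 2 * S.s * K.ac := by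
  have h := congrArg S.Ds K.ae_eq_aux
  have h1 : S.Ds (S.Du S.f) = 0 := by rw [S.comm_su, S.Ds_f, map_zero]
  simp [K.ae_ss, K.eq_ccc, h1] at h
  refine sub_eq_zero.1 (S.eq_zero_of_mul 3 1 0 ?_)
  linear_combination h

theorem ae_eq : 3 * S.x * K.ae = 3 * S.x * (S.Du (S.Du K.ac) + S.s * S.Du K.ac
    + S.s ^ 2 * K.ac) + 6 * S.Du K.aa
    + S.x * (S.x ^ 2 - S.y ^ 2) * (S.f * S.Du K.cc + S.Du S.f * K.cc)
    - S.f * (2 * S.x ^ 2 * K.ac + 3 * S.y ^ 2 * K.ac + S.x * S.y * K.bc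
      + S.x ^ 2 * S.y * S.Dy K.ac) := by
  have h := K.ae_eq_aux
  rw [K.ae_s_eq] at h
  simp at h
  linear_combination h

/-- Substituting the x-derivative of `ae_eq` into `eq_aae` eliminates `ae`. -/
theorem aa_u_eq : 9 * S.Du K.aa = 2 * S.x ^ 3 * (S.f * S.Du K.cc + S.Du S.f * K.cc)
    + S.f * (3 * S.y ^ 2 - 2 * S.x ^ 2) * K.ac := by
  have h := congrArg S.Dx K.ae_eq
  have h1 : S.Dx (S.Du S.f) = 0 := by rw [← S.comm_ux, S.Dx_f, map_zero]
  have h2 : S.Dx (S.Du K.cc) = 0 := by rw [← S.comm_ux, K.cc_x, map_zero]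
  have h3 : S.Dx (S.Du K.ac) = 0 := by rw [← S.comm_ux, K.ac_x, map_zero]
  have h4 : S.Dx (S.Dy K.ac) = 0 := by rw [← S.comm_yx, K.ac_x, map_zero]
  have h5 : S.Dx (S.Du K.aa) = 0 := by rw [← S.comm_ux, K.eq_aaa, map_zero]
  have h6 := K.eq_aae
  have h7 : S.Dx (S.Du (S.Du K.ac)) = 0 := by rw [← S.comm_ux, h3, map_zero]
  simp [h1, h2, h3, h4, h5, K.cc_x, K.bc_x] at h h6
  refine sub_eq_zero.1 (S.eq_zero_of_mul 1 1 0 ?_)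
  linear_combination S.x ^ 2 * h - S.x * K.ae_eq - 3 * h6 + 3 * S.x ^ 3 * h7

/-- `aa` does not depend on x, so the coefficients of x³ and of x² in `aa_u_eq` must vanish
separately. -/
theorem fcc_u_and : S.f * S.Du K.cc + S.Du S.f * K.cc = 0 ∧ K.ac = 0 := by
  have h1 : S.Dx (S.Du S.f) = 0 := by rw [← S.comm_ux, S.Dx_f, map_zero]
  have h2 : S.Dx (S.Du K.cc) = 0 := by rw [← S.comm_ux, K.cc_x, map_zero]
  have h5 : S.Dx (S.Du K.aa) = 0 := by rw [← S.comm_ux, K.eq_aaa, map_zero]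
  have h := congrArg S.Dx K.aa_u_eq
  simp [h1, h2, h5, K.cc_x] at h
  have h' : 3 * S.x * (S.f * S.Du K.cc + S.Du S.f * K.cc) - 2 * S.f * K.ac = 0 := by
    refine S.eq_zero_of_mul 2 1 0 ?_
    linear_combination -h
  have h3 := congrArg S.Dx h'
  simp [h1, h2, K.cc_x] at h3
  have h4 : S.f * S.Du K.cc + S.Du S.f * K.cc = 0 := by
    refine S.eq_zero_of_mul 3 0 0 ?_
    linear_combination h3
  refine ⟨h4, S.eq_zero_of_mul 2 0 1 ?_⟩
  rw [h4] at h'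
  linear_combination -h'

theorem fcc_u : S.f * S.Du K.cc + S.Du S.f * K.cc = 0 := K.fcc_u_and.1

@[simp] theorem ac_eq : K.ac = 0 := K.fcc_u_and.2

@[simp] theorem aa_u : S.Du K.aa = 0 := by
  have h := K.aa_u_eq
  rw [K.fcc_u, K.ac_eq] at h
  refine S.eq_zero_of_mul 9 0 0 ?_
  linear_combination h

@[simp] theorem bc_x_eq : S.Dx K.bc = 0 := by simp [K.bc_x]

theorem ae_eq' : 3 * K.ae = -(S.f * S.y * K.bc) := by
  have h := K.ae_eq
  rw [K.fcc_u, K.ac_eq, K.aa_u] at h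
  simp at h
  refine sub_eq_zero.1 (S.eq_zero_of_mul 1 1 0 ?_)
  linear_combination h

@[simp] theorem ae_s : S.Ds K.ae = 0 := by simp [K.ae_s_eq]

theorem ce_x : S.x ^ 3 * S.Dx K.ce = 4 * K.aa := by
  have h := K.eq_ace
  simp at h
  linear_combination -h

@[simp] theorem ce_s : S.Ds K.ce = -S.Du K.cc := by
  have h := K.eq_cce
  rw [K.ac_eq] at h
  refine eq_neg_of_add_eq_zero_left (S.eq_zero_of_mul 1 1 0 ?_)
  linear_combination h

@[simp] theorem f_xu : S.Dx (S.Du S.f) = 0 := by rw [← S.comm_ux, S.Dx_f, map_zero]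
@[simp] theorem f_yu : S.Dy (S.Du S.f) = 0 := by rw [← S.comm_uy, S.Dy_f, map_zero]
@[simp] theorem cc_xu : S.Dx (S.Du K.cc) = 0 := by rw [← S.comm_ux, K.cc_x, map_zero]
@[simp] theorem cc_yu : S.Dy (S.Du K.cc) = 0 := by rw [← S.comm_uy, K.cc_y, map_zero]
@[simp] theorem bc_yu : S.Dy (S.Du K.bc) = 0 := by rw [← S.comm_uy, K.bc_y, map_zero]
@[simp] theorem bc_xu : S.Dx (S.Du K.bc) = 0 := by rw [← S.comm_ux, K.bc_x_eq, map_zero]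
@[simp] theorem aa_yu : S.Dy (S.Du K.aa) = 0 := by rw [K.aa_u, map_zero]

theorem ce_y : S.x ^ 2 * S.Dy K.ce = -2 * S.Dy K.aa := by
  have h := K.ce_xy
  have h1 := congrArg S.Dy K.ce_x
  have h2 := K.ab_eq
  simp [K.cc_x, K.cc_y] at h h1
  refine sub_eq_zero.1 (S.eq_zero_of_mul 2 2 0 ?_)
  linear_combination h - 2 * S.x ^ 2 * h1 - 2 * S.x * h2

theorem be_s : S.Ds K.be = -S.Du K.bc := by
  have h := K.eq_bce
  have h1 := K.ce_y
  have h2 := K.ab_eq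
  simp at h
  refine eq_neg_of_add_eq_zero_left (S.eq_zero_of_mul 1 1 0 ?_)
  linear_combination h + S.x * h1 - 2 * h2

/-- The same elimination of `ee` as for `ae`, now through its ys-derivative from `eq_bee` and
`eq_cee`. -/
theorem be_eq : 3 * K.be = -3 * S.Du (S.Du K.bc) - 3 * S.s * S.Du K.bc + S.f * S.x * K.bc := by
  have h1 := congrArg S.Ds K.eq_bee
  have h2 := congrArg S.Dy K.eq_cee
  have h3 := congrArg S.Du K.ce_y
  have h4 := congrArg S.Dy K.ae_eq'
  simp [K.be_s, K.cc_y, K.ab_eq] at h1 h2 h3 h4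
  refine sub_eq_zero.1 (S.eq_zero_of_mul 2 2 0 ?_)
  linear_combination 3 * (h1 - S.x ^ 2 * h2) + 6 * S.x ^ 2 * h3 + 4 * S.x ^ 3 * h4
    - 6 * S.x ^ 2 * S.s * K.ce_y + 12 * S.x ^ 3 * S.y * K.fcc_u

theorem bb_x : S.Dx K.bb = S.x * S.Dy (S.Dy K.aa) := by
  rw [K.eq_abb, K.ab_eq]
  simp

@[simp] theorem aa_yx : S.Dx (S.Dy K.aa) = 0 := by rw [← S.comm_yx, K.eq_aaa, map_zero]
@[simp] theorem aa_yyx : S.Dx (S.Dy (S.Dy K.aa)) = 0 := by rw [← S.comm_yx, K.aa_yx, map_zero]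

/-- The xy-derivative of `ee` from `eq_aee` and from `eq_bee`, with all lower components
substituted. -/
theorem ee_compat : S.f * (-3 * S.x ^ 2 * S.Dy K.aa + 3 * S.y ^ 2 * S.Dy K.aa
      - 12 * S.y * K.aa - 6 * S.x ^ 2 * S.y * S.Dy (S.Dy K.aa) + 12 * S.y * K.bb)
    - 4 * S.x * S.Du (S.Du (S.Du K.bc))
    + (2 * S.f * S.Du K.bc + S.Du S.f * K.bc) * (S.x ^ 2 + 3 * S.y ^ 2) = 0 := by
  have h1 := congrArg S.Dy K.eq_aee
  have h2 := congrArg S.Dx K.eq_bee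
  have h3 := K.eq_bee
  have h4 := congrArg S.Du K.be_eq
  have h5 := congrArg S.Dx K.be_eq
  have h6 := congrArg S.Dy K.ae_eq'
  have h7 := congrArg S.Du h6
  have h8 := K.be_eq
  have h9 := congrArg S.Du h5
  have h10 : S.Dx (S.Du (S.Du K.bc)) = 0 := by rw [← S.comm_ux, K.bc_xu, map_zero]
  simp [K.be_s, K.ab_eq, K.bb_x, h10] at h1 h2 h3 h4 h5 h6 h7 h9
  refine S.eq_zero_of_mul 3 1 0 ?_
  linear_combination -3 * (S.x * h1 - S.x * h2 + 4 * h3) - 4 * S.x ^ 2 * h4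
    - 2 * S.x ^ 3 * h7 + 2 * S.x ^ 3 * S.s * h6 + 2 * S.x ^ 3 * h9 - 2 * S.x ^ 3 * S.s * h5
    + 4 * S.x ^ 2 * S.s * h8

/-- `ee_compat` is a polynomial of degree two in x; the coefficients of x² and x give the two
identities. The dependence of `bb` on x cancels the explicit term with the second y-derivative of
`aa`. -/
theorem bc_uuu_and : S.Du (S.Du (S.Du K.bc)) = 0 ∧
    2 * S.f * S.Du K.bc + S.Du S.f * K.bc = 3 * S.f * S.Dy K.aa := by
  have h1 : S.Dx (S.Du (S.Du K.bc)) = 0 := by rw [← S.comm_ux, K.bc_xu, map_zero]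
  have h2 : S.Dx (S.Du (S.Du (S.Du K.bc))) = 0 := by rw [← S.comm_ux, h1, map_zero]
  have h3 := congrArg S.Dx K.ee_compat
  simp [h2, K.bb_x, K.eq_aaa] at h3
  have h4 := congrArg S.Dx h3
  simp [h2] at h4
  have h5 : 2 * S.f * S.Du K.bc + S.Du S.f * K.bc = 3 * S.f * S.Dy K.aa := by
    refine sub_eq_zero.1 (S.eq_zero_of_mul 2 0 0 ?_)
    linear_combination h4
  refine ⟨S.eq_zero_of_mul 4 0 0 ?_, h5⟩
  rw [h5] at h3
  linear_combination -h3

theorem bc_u_eq : 2 * S.f * S.Du K.bc + S.Du S.f * K.bc = 3 * S.f * S.Dy K.aa := K.bc_uuu_and.2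

@[simp] theorem aa_yy : S.Dy (S.Dy K.aa) = 0 := by
  have h := congrArg S.Dy K.bc_u_eq
  simp at h
  exact S.eq_zero_of_mul 3 0 1 (by linear_combination -h)

theorem aa_eq : K.aa = K.bb + S.y * S.Dy K.aa := by
  have h := K.ee_compat
  rw [K.bc_uuu_and.1, K.bc_u_eq, K.aa_yy] at h
  -- What remains is 12 f y times the desired difference. As y is not invertible, it is removed by a
  -- y-derivative, under which the difference itself is constant.
  have h1 := congrArg S.Dy h
  simp [K.eq_bbb] at h1
  refine sub_eq_zero.1 (S.eq_zero_of_mul 12 0 1 ?_)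
  linear_combination -h1

@[simp] theorem bb_u : S.Du K.bb = 0 := by
  have h := congrArg S.Du K.aa_eq
  simpa using h.symm

theorem ee_s : 6 * S.x ^ 2 * S.Ds K.ee = -6 * S.x ^ 2 * S.Du K.ce
    + 6 * S.x * (S.x * S.s ^ 2 - S.f * (S.x ^ 2 + S.y ^ 2)) * S.Du K.cc
    - 2 * S.x * S.f * S.y * K.bc
    - 6 * S.x * S.Du S.f * (S.x ^ 2 + S.y ^ 2) * K.cc + 6 * S.x ^ 2 * S.s * K.ce := by
  have h := K.eq_cee
  have h1 := K.ae_eq'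
  simp at h
  linear_combination 3 * h - 4 * S.x * h1

theorem ee_y : 3 * S.x ^ 3 * S.Dy K.ee = -3 * S.x * S.s ^ 2 * S.Dy K.aa
    - S.x ^ 2 * S.s * S.f * K.bc + S.x ^ 2 * (S.f * S.Du K.bc + S.Du S.f * K.bc)
    + 3 * S.f * (2 * S.x ^ 2 + 3 * S.y ^ 2) * S.Dy K.aa + 6 * S.f * S.y * K.bb := by
  have h := K.eq_bee
  have h1 := K.be_eq
  have h2 := congrArg S.Du K.be_eq
  simp [K.be_s, K.ab_eq, K.bc_uuu_and.1] at h h2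
  refine sub_eq_zero.1 (S.eq_zero_of_mul 2 1 0 ?_)
  linear_combination 3 * h - 2 * S.x ^ 2 * S.s * h1 + 2 * S.x ^ 2 * h2
    + 3 * S.x * (S.x ^ 2 + S.y ^ 2) * K.bc_u_eq

end KillingSystem

end

/-! ### The E³-equation and the remaining components -/

section

variable {R : Type*} [CommRing R] [Algebra ℝ R] {S : WilsFrame R}
namespace KillingSystem

variable (K : KillingSystem S)

/-- `ce_x`, `ce_y` and `ce_s` integrate in closed form; η is the integration constant, a function of
u alone. -/
theorem exists_eta : ∃ η, S.x ^ 2 * K.ce = S.x ^ 2 * η - S.x ^ 2 * S.s * S.Du K.cc - 2 * K.aa ∧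
    S.Dx η = 0 ∧ S.Dy η = 0 ∧ S.Ds η = 0 := by
  obtain ⟨i, hi⟩ := S.isUnit_x.exists_right_inv
  have h : S.x ^ 2 * K.ce = S.x ^ 2 * (K.ce + S.s * S.Du K.cc + 2 * i ^ 2 * K.aa)
      - S.x ^ 2 * S.s * S.Du K.cc - 2 * K.aa := by
    linear_combination -2 * K.aa * (S.x * i + 1) * hi
  generalize K.ce + S.s * S.Du K.cc + 2 * i ^ 2 * K.aa = η at h
  refine ⟨η, h, ?_, ?_, ?_⟩
  · have h1 := congrArg S.Dx h
    simp [K.eq_aaa] at h1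
    refine S.eq_zero_of_mul 1 3 0 ?_
    linear_combination -S.x * h1 + 2 * h + K.ce_x
  · have h1 := congrArg S.Dy h
    simp at h1
    refine S.eq_zero_of_mul 1 2 0 ?_
    linear_combination -h1 + K.ce_y
  · have h1 := congrArg S.Ds h
    have h2 : S.Ds (S.Du K.cc) = 0 := by rw [S.comm_su, K.eq_ccc, map_zero]
    simp [K.eq_ccc] at h1
    refine S.eq_zero_of_mul 1 2 0 ?_
    linear_combination -h1

variable {K} {η : R}

/-- The one equation not yet used is `eq_eee`. After differentiation in y and s it contains `ee`
only through its y- and s-derivatives, which `ee_y` and `ee_s` supply. -/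
theorem eee_ys (hη : S.x ^ 2 * K.ce = S.x ^ 2 * η - S.x ^ 2 * S.s * S.Du K.cc - 2 * K.aa) :
    5 * S.f * S.Dy K.aa
    + S.y * (2 * S.f * (η + S.Du (S.Du K.cc)) + S.Du S.f * S.Du K.cc) = 0 := by
  have h := congrArg (fun t => S.Ds (S.Dy t)) K.eq_eee
  have hy := K.ee_y
  have hys := congrArg S.Ds hy
  have hyus := congrArg (fun t => S.Ds (S.Du t)) hy
  have hyss := congrArg (fun t => S.Ds (S.Ds t)) hy
  have hss := congrArg S.Ds K.ee_s
  have hay := congrArg S.Dy K.ae_eq'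
  have h1 : S.Du (S.Dy K.aa) = 0 := by rw [S.comm_uy, K.aa_yu]
  simp [K.be_s, K.eq_ccc] at h hys hyus hyss hss hay
  refine S.eq_zero_of_mul 6 3 0 ?_
  linear_combination -3 * S.x ^ 2 * h + 2 * S.x * hyus
    + 2 * (S.x * S.s ^ 2 - S.f * (S.x ^ 2 + S.y ^ 2)) * hyss - 2 * S.x * S.f * S.y * hss
    + 4 * S.x ^ 3 * S.s * hay - 4 * S.x * hy - 12 * S.x * S.f * S.y * hη
    - 6 * S.x ^ 3 * K.bc_u_eq + 24 * S.x * S.f * S.y * K.aa_eq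

variable (K) in
-- `eee_ys` is affine in y with coefficients independent of y: the y-derivative removes the slope,
-- and the constant term is 5 f times the claim.
@[simp] theorem aa_y : S.Dy K.aa = 0 := by
  obtain ⟨η, hη, hx, hy, hs⟩ := K.exists_eta
  have h := K.eee_ys hη
  have h1 := congrArg S.Dy h
  have h2 : S.Dy (S.Du (S.Du K.cc)) = 0 := by rw [← S.comm_uy, K.cc_yu, map_zero]
  simp [hy, h2] at h1
  rw [h1] at h
  exact S.eq_zero_of_mul 5 0 1 (by linear_combination h)

variable (K) in
theorem aa_eq_bb : K.aa = K.bb := by simpa using K.aa_eq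

theorem eta_eq (hη : S.x ^ 2 * K.ce = S.x ^ 2 * η - S.x ^ 2 * S.s * S.Du K.cc - 2 * K.aa)
    (hy : S.Dy η = 0) : 2 * S.f * (η + S.Du (S.Du K.cc)) + S.Du S.f * S.Du K.cc = 0 := by
  have h1 := congrArg S.Dy (K.eee_ys hη)
  have h2 : S.Dy (S.Du (S.Du K.cc)) = 0 := by rw [← S.comm_uy, K.cc_yu, map_zero]
  simpa [hy, h2] using h1

theorem eee_y (hη : S.x ^ 2 * K.ce = S.x ^ 2 * η - S.x ^ 2 * S.s * S.Du K.cc - 2 * K.aa)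
    (hy : S.Dy η = 0) :
    2 * S.x * S.Du (S.f * S.Du K.bc + S.Du S.f * K.bc) - 6 * S.x * S.f * S.Du (S.Du K.bc)
    + 5 * S.f ^ 2 * (S.x ^ 2 + 3 * S.y ^ 2) * K.bc
    + 6 * S.x * S.y * (2 * S.f * S.Du η + S.Du S.f * η) = 0 := by
  have h := congrArg S.Dy K.eq_eee
  have hey := K.ee_y
  have heys := congrArg S.Ds hey
  have heyu := congrArg S.Du hey
  have hay := congrArg S.Dy K.ae_eq'
  have hu := congrArg S.Du hη
  have hb := K.be_eq
  have hby := congrArg S.Dy hb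
  have h3 : S.Dy (S.Du (S.Du K.bc)) = 0 := by rw [← S.comm_uy, K.bc_yu, map_zero]
  have hcy := K.ce_y
  have hb2 := K.bc_u_eq
  simp [h3] at h hey heys heyu hay hu hby hcy hb2 ⊢
  refine S.eq_zero_of_mul 1 2 0 ?_
  linear_combination 3 * S.x ^ 2 * h - 2 * S.x * heyu
    - 2 * (S.x * S.s ^ 2 - S.f * (S.x ^ 2 + S.y ^ 2)) * heys + 2 * S.x * S.f * S.y * K.ee_s
    - S.x ^ 2 * (2 * S.x * S.s ^ 2 - S.f * (S.x ^ 2 + 3 * S.y ^ 2)) * hay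
    + 6 * S.x ^ 2 * S.f * S.y * K.ae_eq' - 2 * S.x ^ 3 * S.f * hb + 4 * S.x * S.s * hey
    - 6 * S.x * S.y * S.Du S.f * hη + 12 * S.x * S.f * S.y * S.s * hη
    - 12 * S.x * S.f * S.y * hu - 2 * S.x ^ 3 * S.f * S.y * hby
    - 3 * S.x * S.Du S.f * (S.x ^ 2 + S.y ^ 2) * hcy
    - 12 * S.x ^ 2 * S.f * S.y * (S.x ^ 2 + S.y ^ 2) * K.fcc_u + 6 * S.x ^ 3 * S.s * hb2
    + (12 * S.x * S.y * S.Du S.f - 24 * S.x * S.f * S.y * S.s) * K.aa_eq_bb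
    + 6 * S.x ^ 3 * S.y * S.s * K.eta_eq hη hy

variable (K) in
-- `eee_y` is quadratic in y with leading coefficient 15 f² `bc`.
@[simp] theorem bc_eq : K.bc = 0 := by
  obtain ⟨η, hη, hx, hy, hs⟩ := K.exists_eta
  have h := congrArg (fun t => S.Dy (S.Dy t)) (K.eee_y hη hy)
  have h1 : S.Dy (S.Du η) = 0 := by rw [← S.comm_uy, hy, map_zero]
  have h2 : S.Dy (S.Du (S.Du K.bc)) = 0 := by rw [← S.comm_uy, K.bc_yu, map_zero]
  have h3 : S.Dy (S.Du (S.Du S.f)) = 0 := by rw [← S.comm_uy, f_yu, map_zero]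
  simp [h1, h2, h3, hy] at h
  exact S.eq_zero_of_mul 30 0 2 (by linear_combination h)

variable (K) in
@[simp] theorem ab_eq_zero : K.ab = 0 := by simp [K.ab_eq]

variable (K) in
@[simp] theorem ae_eq_zero : K.ae = 0 := by
  have h := K.ae_eq'
  rw [K.bc_eq] at h
  exact S.eq_zero_of_mul 3 0 0 (by linear_combination h)

variable (K) in
@[simp] theorem be_eq_zero : K.be = 0 := by
  have h := K.be_eq
  simp at h
  exact S.eq_zero_of_mul 3 0 0 (by linear_combination h)

/-- By `ee_s`, `ee` is quadratic in s. The s-derivative of `eq_eee` therefore determines `ee`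
itself, through the term -4x² s `ee`, and the second s-derivative gives the relation between η and
`cc`. -/
theorem ee_eq_and (hη : S.x ^ 2 * K.ce = S.x ^ 2 * η - S.x ^ 2 * S.s * S.Du K.cc - 2 * K.aa)
    (hy : S.Dy η = 0) (hs : S.Ds η = 0) :
    3 * S.Du η + S.Du (S.Du (S.Du K.cc)) = 0 ∧
    2 * S.x ^ 3 * K.ee = -2 * (S.x * S.s ^ 2 - S.f * (S.x ^ 2 + S.y ^ 2)) * K.aa
      + S.x ^ 3 * (S.s ^ 2 * (η + S.Du (S.Du K.cc)) - 2 * S.s * S.Du η - S.Du (S.Du η)) := by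
  have h1 : S.Ds (S.Du (S.Du K.cc)) = 0 := by
    rw [S.comm_su, S.comm_su, K.eq_ccc]; simp
  have h2 : S.Ds (S.Du η) = 0 := by rw [S.comm_su, hs, map_zero]
  have h3 : S.Ds (S.Du K.cc) = 0 := by rw [S.comm_su, K.eq_ccc, map_zero]
  have hu := congrArg S.Du hη
  have hes : S.x ^ 2 * S.Ds K.ee
      = S.x ^ 2 * (S.s * (η + S.Du (S.Du K.cc)) - S.Du η) - 2 * S.s * K.aa := by
    have h := K.ee_s
    simp at hu h
    refine sub_eq_zero.1 (S.eq_zero_of_mul 6 0 0 ?_)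
    linear_combination h - 6 * hu + 6 * S.s * hη - 6 * S.x * (S.x ^ 2 + S.y ^ 2) * K.fcc_u
  have hess := congrArg S.Ds hes
  have hesss := congrArg S.Ds hess
  have heus := congrArg S.Du hes
  have heuss := congrArg S.Du hess
  have hk := congrArg S.Ds K.eq_eee
  have hkk := congrArg S.Ds hk
  simp [h1, h2, h3, hs] at hess hesss heus heuss hk hkk
  have hsss : S.Ds (S.Ds (S.Ds K.ee)) = 0 := S.eq_zero_of_mul 1 2 0 (by linear_combination hesss)
  rw [hsss] at hkk
  have h4 : 3 * S.Du η + S.Du (S.Du (S.Du K.cc)) = 0 := by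
    refine S.eq_zero_of_mul 2 2 0 ?_
    linear_combination hkk - 2 * heuss - 4 * S.s * hess + 4 * hes
  refine ⟨h4, sub_eq_zero.1 (S.eq_zero_of_mul 2 0 0 ?_)⟩
  linear_combination -S.x * hk + 2 * S.x * heus
    + 2 * (S.x * S.s ^ 2 - S.f * (S.x ^ 2 + S.y ^ 2)) * hess
    + 2 * S.x ^ 3 * S.s * h4 - S.x ^ 2 * (S.x ^ 2 + S.y ^ 2) * K.eta_eq hη hy

end KillingSystem

end

/-! ### Solution of the system, and its extraction from a Poisson bracket -/

section

variable {R : Type*} [CommRing R] [Algebra ℝ R] {S : WilsFrame R}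

/-- The constant is k = c f `cc`, so that `cc` = kP². Then `eta_eq` gives η = -2kPP'', and the
relation between η and `cc` in `ee_eq_and` collapses to a multiple of k P P'''. P is a unit because
f P² = c is one. -/
theorem KillingSystem.eq_of_root (K : KillingSystem S) {P c : R} (hc : c * c = 1)
    (hP : S.f * P ^ 2 = c) (hcu : S.Du c = 0)
    (hx : S.Dx P = 0) (hy : S.Dy P = 0) (hs : S.Ds P = 0) :
    ∃ k, S.Dx k = 0 ∧ S.Dy k = 0 ∧ S.Du k = 0 ∧ S.Ds k = 0 ∧
      k * S.Du (S.Du (S.Du P)) = 0 ∧ K.cc = k * P ^ 2 ∧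
      S.x ^ 2 * K.ce = -(2 * k * P * S.x ^ 2 * (S.s * S.Du P + S.Du (S.Du P))) - 2 * K.aa ∧
      S.x ^ 3 * K.ee = -((S.x * S.s ^ 2 - S.f * (S.x ^ 2 + S.y ^ 2)) * K.aa)
        + k * S.x ^ 3 * (S.s * S.Du P + S.Du (S.Du P)) ^ 2 := by
  obtain ⟨η, hη, ex, ey, es⟩ := K.exists_eta
  obtain ⟨h4, hee⟩ := K.ee_eq_and hη ey es
  have hPu : IsUnit P := isUnit_of_mul_isUnit_right (x := S.f * P) (by
    rw [show S.f * P * P = c by rw [← hP]; ring]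
    exact IsUnit.of_mul_eq_one c hc)
  have hcan : ∀ {a : R}, P * a = 0 → a = 0 := fun h => (hPu.mul_right_eq_zero).1 h
  have hcx : S.Dx c = 0 := by rw [← hP]; simp [hx]
  have hcy : S.Dy c = 0 := by rw [← hP]; simp [hy]
  have hcs : S.Ds c = 0 := by rw [← hP]; simp [hs]
  have hf : S.Du S.f * P + 2 * S.f * S.Du P = 0 := by
    have h := congrArg S.Du hP
    simp [hcu] at h
    exact hcan (by linear_combination h)
  have hk : S.Du (c * (S.f * K.cc)) = 0 := by
    simp [hcu]
    linear_combination c * K.fcc_u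
  have hcc : K.cc = c * (S.f * K.cc) * P ^ 2 := by
    linear_combination -c * K.cc * hP - K.cc * hc
  have hkx : S.Dx (c * (S.f * K.cc)) = 0 := by simp [hcx, K.cc_x]
  have hky : S.Dy (c * (S.f * K.cc)) = 0 := by simp [hcy, K.cc_y]
  have hks : S.Ds (c * (S.f * K.cc)) = 0 := by simp [hcs, K.eq_ccc]
  generalize c * (S.f * K.cc) = k at hk hkx hky hks hcc
  have h1 : S.Du K.cc = 2 * k * P * S.Du P := by
    rw [hcc]; simp [hk]; ring
  have h2 : S.Du (S.Du K.cc) = 2 * k * (S.Du P ^ 2 + P * S.Du (S.Du P)) := by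
    rw [h1]; simp [hk]; ring
  have h3 : η = -(2 * k * P * S.Du (S.Du P)) := by
    have h := K.eta_eq hη ey
    rw [h2, h1] at h
    refine eq_neg_of_add_eq_zero_left (S.eq_zero_of_mul 2 0 1 (hcan ?_))
    linear_combination P * h - 2 * k * P * S.Du P * hf
  have h5 : k * S.Du (S.Du (S.Du P)) = 0 := by
    rw [h2, h3] at h4
    simp [hk] at h4
    refine S.eq_zero_of_mul 4 0 0 (hcan ?_)
    linear_combination -h4
  refine ⟨k, hkx, hky, hk, hks, h5, hcc, ?_, sub_eq_zero.1 (S.eq_zero_of_mul 2 0 0 ?_)⟩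
  · rw [hη, h1, h3]; ring
  · have h6 : S.Du η = -(2 * k * S.Du P * S.Du (S.Du P)) := by
      rw [h3]; simp [hk]
      linear_combination -2 * P * h5
    have h7 : S.Du (S.Du η) = -(2 * k * S.Du (S.Du P) ^ 2) := by
      rw [h6]; simp [hk]
      linear_combination -2 * S.Du P * h5
    rw [h7, h6, h2, h3] at hee
    linear_combination hee

/-- A quaternary quadratic form given by its coefficients. -/
def quadForm (q : Fin 4 → Fin 4 → R) (p₀ p₁ p₂ p₃ : R) : R :=
  q 0 0 * p₀ ^ 2 + q 0 1 * p₀ * p₁ + q 0 2 * p₀ * p₂ + q 0 3 * p₀ * p₃ + q 1 1 * p₁ ^ 2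
    + q 1 2 * p₁ * p₂ + q 1 3 * p₁ * p₃ + q 2 2 * p₂ ^ 2 + q 2 3 * p₂ * p₃ + q 3 3 * p₃ ^ 2

/-- Values at vectors with entries 0, 1, -1 suffice, since 2 is invertible: single vectors give the
cubes, pairs with both signs the terms in two variables, triples the rest. -/
theorem cubic_coeff_eq_zero {c₀₀₀ c₁₁₁ c₂₂₂ c₃₃₃ c₀₀₁ c₀₀₂ c₀₀₃ c₀₁₁ c₁₁₂ c₁₁₃ c₀₂₂ c₁₂₂ c₂₂₃
    c₀₃₃ c₁₃₃ c₂₃₃ c₀₁₂ c₀₁₃ c₀₂₃ c₁₂₃ : R}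
    (h : ∀ a b c e : R, c₀₀₀ * a ^ 3 + c₁₁₁ * b ^ 3 + c₂₂₂ * c ^ 3 + c₃₃₃ * e ^ 3
      + c₀₀₁ * a ^ 2 * b + c₀₀₂ * a ^ 2 * c + c₀₀₃ * a ^ 2 * e
      + c₀₁₁ * a * b ^ 2 + c₁₁₂ * b ^ 2 * c + c₁₁₃ * b ^ 2 * e
      + c₀₂₂ * a * c ^ 2 + c₁₂₂ * b * c ^ 2 + c₂₂₃ * c ^ 2 * e
      + c₀₃₃ * a * e ^ 2 + c₁₃₃ * b * e ^ 2 + c₂₃₃ * c * e ^ 2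
      + c₀₁₂ * a * b * c + c₀₁₃ * a * b * e + c₀₂₃ * a * c * e + c₁₂₃ * b * c * e = 0) :
    (c₀₀₀ = 0 ∧ c₁₁₁ = 0 ∧ c₂₂₂ = 0 ∧ c₃₃₃ = 0) ∧
    (c₀₀₁ = 0 ∧ c₀₀₂ = 0 ∧ c₀₀₃ = 0 ∧ c₀₁₁ = 0 ∧ c₁₁₂ = 0 ∧ c₁₁₃ = 0) ∧
    (c₀₂₂ = 0 ∧ c₁₂₂ = 0 ∧ c₂₂₃ = 0 ∧ c₀₃₃ = 0 ∧ c₁₃₃ = 0 ∧ c₂₃₃ = 0) ∧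
    (c₀₁₂ = 0 ∧ c₀₁₃ = 0 ∧ c₀₂₃ = 0 ∧ c₁₂₃ = 0) := by
  have two : ∀ {t : R}, 2 * t = 0 → t = 0 := fun {t} ht => by
    have h1 : IsUnit (2 : R) := by
      simpa only [map_ofNat] using
        (isUnit_iff_ne_zero.2 (two_ne_zero (α := ℝ))).map (algebraMap ℝ R)
    exact h1.mul_right_eq_zero.1 ht
  have h0 : c₀₀₀ = 0 := by linear_combination h 1 0 0 0
  have h1 : c₁₁₁ = 0 := by linear_combination h 0 1 0 0
  have h2 : c₂₂₂ = 0 := by linear_combination h 0 0 1 0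
  have h3 : c₃₃₃ = 0 := by linear_combination h 0 0 0 1
  subst h0 h1 h2 h3
  have h01 : c₀₀₁ = 0 := two (by linear_combination h 1 1 0 0 - h 1 (-1) 0 0)
  have h10 : c₀₁₁ = 0 := two (by linear_combination h 1 1 0 0 + h 1 (-1) 0 0)
  have h02 : c₀₀₂ = 0 := two (by linear_combination h 1 0 1 0 - h 1 0 (-1) 0)
  have h20 : c₀₂₂ = 0 := two (by linear_combination h 1 0 1 0 + h 1 0 (-1) 0)
  have h03 : c₀₀₃ = 0 := two (by linear_combination h 1 0 0 1 - h 1 0 0 (-1))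
  have h30 : c₀₃₃ = 0 := two (by linear_combination h 1 0 0 1 + h 1 0 0 (-1))
  have h12 : c₁₁₂ = 0 := two (by linear_combination h 0 1 1 0 - h 0 1 (-1) 0)
  have h21 : c₁₂₂ = 0 := two (by linear_combination h 0 1 1 0 + h 0 1 (-1) 0)
  have h13 : c₁₁₃ = 0 := two (by linear_combination h 0 1 0 1 - h 0 1 0 (-1))
  have h31 : c₁₃₃ = 0 := two (by linear_combination h 0 1 0 1 + h 0 1 0 (-1))
  have h23 : c₂₂₃ = 0 := two (by linear_combination h 0 0 1 1 - h 0 0 1 (-1))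
  have h32 : c₂₃₃ = 0 := two (by linear_combination h 0 0 1 1 + h 0 0 1 (-1))
  subst h01 h10 h02 h20 h03 h30 h12 h21 h13 h31 h23 h32
  refine ⟨⟨rfl, rfl, rfl, rfl⟩, ⟨rfl, rfl, rfl, rfl, rfl, rfl⟩, ⟨rfl, rfl, rfl, rfl, rfl, rfl⟩,
    ?_, ?_, ?_, ?_⟩
  · linear_combination h 1 1 1 0
  · linear_combination h 1 1 0 1
  · linear_combination h 1 0 1 1
  · linear_combination h 0 1 1 1

/-- The Poisson bracket (multiplied by `2 x²`) of the energy function with the quadratic form `q`,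
in the original momenta. -/
def frameBracket (S : WilsFrame R) (q : Fin 4 → Fin 4 → R) (p₀ p₁ p₂ p₃ : R) : R :=
  -2 * S.x * (p₀ + S.s * p₃) * (S.x * quadForm (fun i j => S.Dx (q i j)) p₀ p₁ p₂ p₃
      - S.s * quadForm (fun i j => S.Ds (q i j)) p₀ p₁ p₂ p₃)
    - 2 * S.x ^ 2 * p₁ * quadForm (fun i j => S.Dy (q i j)) p₀ p₁ p₂ p₃
    + 2 * S.x * p₃ * quadForm (fun i j => S.Du (q i j)) p₀ p₁ p₂ p₃
    + 2 * (p₂ - S.x * S.s * p₀ - S.f * (S.x ^ 2 + S.y ^ 2) * p₃)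
      * quadForm (fun i j => S.Ds (q i j)) p₀ p₁ p₂ p₃
    + (2 * (p₂ - S.x * S.s * p₀) * p₃ + S.f * (S.x ^ 2 - S.y ^ 2) * p₃ ^ 2)
      * (2 * q 0 0 * p₀ + q 0 1 * p₁ + q 0 2 * p₂ + q 0 3 * p₃)
    + 2 * S.x * S.f * S.y * p₃ ^ 2 * (q 0 1 * p₀ + 2 * q 1 1 * p₁ + q 1 2 * p₂ + q 1 3 * p₃)
    + S.x * S.Du S.f * (S.x ^ 2 + S.y ^ 2) * p₃ ^ 2
      * (q 0 2 * p₀ + q 1 2 * p₁ + 2 * q 2 2 * p₂ + q 2 3 * p₃)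
    + 2 * S.x * p₀ * p₃ * (q 0 3 * p₀ + q 1 3 * p₁ + q 2 3 * p₂ + 2 * q 3 3 * p₃)

theorem exists_killingSystem {aa ab bb ac bc cc ae be ce ee : R} {q : Fin 4 → Fin 4 → R}
    (h00 : q 0 0 = aa) (h01 : q 0 1 = ab) (h11 : q 1 1 = bb) (h02 : q 0 2 = ac)
    (h12 : q 1 2 = bc) (h22 : q 2 2 = cc) (h03 : q 0 3 = S.x * ae + 2 * S.s * aa)
    (h13 : q 1 3 = S.x * be + S.s * ab) (h23 : q 2 3 = S.x * ce + S.s * ac)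
    (h33 : q 3 3 = S.x ^ 2 * ee + S.x * S.s * ae + S.s ^ 2 * aa)
    (hq : ∀ p₀ p₁ p₂ p₃, frameBracket S q p₀ p₁ p₂ p₃ = 0) :
    ∃ K : KillingSystem S, K.aa = aa ∧ K.ab = ab ∧ K.bb = bb ∧ K.ac = ac ∧ K.bc = bc ∧ K.cc = cc ∧
      K.ae = ae ∧ K.be = be ∧ K.ce = ce ∧ K.ee = ee := by
  obtain ⟨⟨e000, e111, e222, e333⟩, ⟨e001, e002, e003, e011, e112, e113⟩,
    ⟨e022, e122, e223, e033, e133, e233⟩, e012, e013, e023, e123⟩ :=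
    cubic_coeff_eq_zero (c₀₀₀ := -2 * S.x ^ 5 * S.Dx aa) (c₁₁₁ := -2 * S.x ^ 5 * S.Dy bb)
      (c₂₂₂ := 2 * S.x ^ 3 * S.Ds cc)
      (c₃₃₃ := S.x * (2 * S.x ^ 2 * S.Du ee
        + 2 * S.x * (S.x * S.s ^ 2 - S.f * (S.x ^ 2 + S.y ^ 2)) * S.Ds ee
        + (2 * S.x * S.s ^ 2 - S.f * (S.x ^ 2 + 3 * S.y ^ 2)) * ae + 2 * S.x * S.f * S.y * be
        + S.x * S.Du S.f * (S.x ^ 2 + S.y ^ 2) * ce - 4 * S.x ^ 2 * S.s * ee))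
      (c₀₀₁ := -2 * S.x ^ 5 * (S.Dx ab + S.Dy aa))
      (c₀₀₂ := 2 * S.x ^ 3 * (S.Ds aa - S.x ^ 2 * S.Dx ac))
      (c₀₀₃ := 2 * S.x ^ 2 * (S.x * S.Du aa
        + (S.x * S.s ^ 2 - S.f * (S.x ^ 2 + S.y ^ 2)) * S.Ds aa - S.x ^ 3 * S.Dx ae))
      (c₀₁₁ := -2 * S.x ^ 5 * (S.Dx bb + S.Dy ab))
      (c₁₁₂ := 2 * S.x ^ 3 * (S.Ds bb - S.x ^ 2 * S.Dy bc))
      (c₁₁₃ := 2 * S.x ^ 2 * (S.x * S.Du bb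
        + (S.x * S.s ^ 2 - S.f * (S.x ^ 2 + S.y ^ 2)) * S.Ds bb - S.x ^ 3 * S.Dy be))
      (c₀₂₂ := 2 * S.x ^ 3 * (S.Ds ac - S.x ^ 2 * S.Dx cc))
      (c₁₂₂ := 2 * S.x ^ 3 * (S.Ds bc - S.x ^ 2 * S.Dy cc))
      (c₂₂₃ := 2 * S.x ^ 2 * (S.x * S.Du cc + S.x * S.Ds ce + 2 * ac
        + (S.x * S.s ^ 2 - S.f * (S.x ^ 2 + S.y ^ 2)) * S.Ds cc))
      (c₀₃₃ := S.x * (2 * S.x ^ 2 * S.Du ae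
        + 2 * S.x * (S.x * S.s ^ 2 - S.f * (S.x ^ 2 + S.y ^ 2)) * S.Ds ae
        + (4 * S.x * S.s ^ 2 - 2 * S.f * (S.x ^ 2 + 3 * S.y ^ 2)) * aa + 2 * S.x * S.f * S.y * ab
        + S.x * S.Du S.f * (S.x ^ 2 + S.y ^ 2) * ac - 2 * S.x ^ 2 * S.s * ae
        - 2 * S.x ^ 4 * S.Dx ee))
      (c₁₃₃ := S.x * (2 * S.x ^ 2 * S.Du be
        + 2 * S.x * (S.x * S.s ^ 2 - S.f * (S.x ^ 2 + S.y ^ 2)) * S.Ds be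
        + (2 * S.x * S.s ^ 2 - S.f * (S.x ^ 2 + 3 * S.y ^ 2)) * ab + 4 * S.x * S.f * S.y * bb
        + S.x * S.Du S.f * (S.x ^ 2 + S.y ^ 2) * bc - 2 * S.x ^ 2 * S.s * be
        - 2 * S.x ^ 4 * S.Dy ee))
      (c₂₃₃ := S.x * (2 * S.x ^ 2 * S.Du ce
        + 2 * S.x * (S.x * S.s ^ 2 - S.f * (S.x ^ 2 + S.y ^ 2)) * S.Ds ce
        + 2 * S.x ^ 2 * S.Ds ee + 4 * S.x * ae
        + (2 * S.x * S.s ^ 2 - S.f * (S.x ^ 2 + 3 * S.y ^ 2)) * ac + 2 * S.x * S.f * S.y * bc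
        + 2 * S.x * S.Du S.f * (S.x ^ 2 + S.y ^ 2) * cc - 2 * S.x ^ 2 * S.s * ce))
      (c₀₁₂ := 2 * S.x ^ 3 * (S.Ds ab - S.x ^ 2 * (S.Dx bc + S.Dy ac)))
      (c₀₁₃ := 2 * S.x ^ 2 * (S.x * S.Du ab
        + (S.x * S.s ^ 2 - S.f * (S.x ^ 2 + S.y ^ 2)) * S.Ds ab - S.x ^ 3 * (S.Dy ae + S.Dx be)))
      (c₀₂₃ := 2 * S.x ^ 2 * (S.x * S.Ds ae - S.x ^ 3 * S.Dx ce + S.x * S.Du ac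
        + (S.x * S.s ^ 2 - S.f * (S.x ^ 2 + S.y ^ 2)) * S.Ds ac + 4 * aa))
      (c₁₂₃ := 2 * S.x ^ 2 * (S.x * S.Ds be - S.x ^ 3 * S.Dy ce + S.x * S.Du bc
        + (S.x * S.s ^ 2 - S.f * (S.x ^ 2 + S.y ^ 2)) * S.Ds bc + 2 * ab))
      (fun a b c e => by
        -- Here x a = p₀ + s p₃, x b = p₁, x c = p₂ and x e = x p₃ are the canonical momenta of the
        -- coordinates (x, y, u, s).
        have h := hq (S.x * a - S.s * e) (S.x * b) (S.x * c) e
        simp only [frameBracket, quadForm, h00, h01, h11, h02, h12, h22, h03, h13, h23, h33] at h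
        simp at h
        linear_combination h)
  have k : ∀ {a : R} (n : ℕ), 2 * S.x ^ n * a = 0 → a = 0 := fun {a} n h =>
    S.eq_zero_of_mul 2 n 0 (by linear_combination h)
  have k1 : ∀ {a : R}, S.x * a = 0 → a = 0 := fun {a} h =>
    S.eq_zero_of_mul 1 1 0 (by linear_combination h)
  have hcc : S.Ds cc = 0 := k 3 e222
  exact ⟨⟨aa, ab, bb, ac, bc, cc, ae, be, ce, ee, hcc, sub_eq_zero.1 (k 3 e022),
    sub_eq_zero.1 (k 3 e122), by have h := k 2 e223; rw [hcc] at h; linear_combination h,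
    sub_eq_zero.1 (k 3 e002), sub_eq_zero.1 (k 3 e012), sub_eq_zero.1 (k 3 e112),
    k 5 (by linear_combination -e000),
    eq_neg_of_add_eq_zero_left (k 5 (by linear_combination -e001)),
    eq_neg_of_add_eq_zero_left (k 5 (by linear_combination -e011)),
    k 5 (by linear_combination -e111), by linear_combination k 2 e023,
    by linear_combination k 2 e123, k1 e233, by linear_combination -k 2 e003,
    by linear_combination -k 2 e113, by linear_combination -k 2 e013,
    by linear_combination -k1 e033, by linear_combination -k1 e133, k1 e333⟩,
    rfl, rfl, rfl, rfl, rfl, rfl, rfl, rfl, rfl, rfl⟩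

end

/-! ### The differential algebra of smooth functions on an open set -/

section SmoothFunctions

variable {n : ℕ} {V : Set (Fin n → ℝ)}

/-- Extension by zero of a function on `V`. -/
def zeroExt (V : Set (Fin n → ℝ)) (F : V → ℝ) : (Fin n → ℝ) → ℝ :=
  Function.extend Subtype.val F 0

@[simp]
theorem zeroExt_apply (F : V → ℝ) (x : V) : zeroExt V F x = F x :=
  Subtype.val_injective.extend_apply F 0 x

theorem zeroExt_restrict_eqOn (G : (Fin n → ℝ) → ℝ) :
    Set.EqOn (zeroExt V fun x => G x) G V := fun x hx =>
  zeroExt_apply (V := V) (fun x => G x) ⟨x, hx⟩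

theorem zeroExt_mul_eqOn (F G : V → ℝ) :
    Set.EqOn (zeroExt V (F * G)) (fun y => zeroExt V F y * zeroExt V G y) V := fun x hx => by
  lift x to V using hx
  simp

theorem zeroExt_add_eqOn (F G : V → ℝ) :
    Set.EqOn (zeroExt V (F + G)) (fun y => zeroExt V F y + zeroExt V G y) V := fun x hx => by
  lift x to V using hx
  simp

theorem zeroExt_smul_eqOn (r : ℝ) (F : V → ℝ) :
    Set.EqOn (zeroExt V (r • F)) (fun y => r * zeroExt V F y) V := fun x hx => by
  lift x to V using hx
  simp

/-- The algebra of smooth functions on `V`. -/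
def smoothFunctions (V : Set (Fin n → ℝ)) : Subalgebra ℝ (V → ℝ) where
  carrier := {F | ContDiffOn ℝ ∞ (zeroExt V F) V}
  mul_mem' {F G} hF hG := (ContDiffOn.mul hF hG).congr (zeroExt_mul_eqOn F G)
  add_mem' {F G} hF hG := (ContDiffOn.add hF hG).congr (zeroExt_add_eqOn F G)
  algebraMap_mem' r := (contDiffOn_const (c := r)).congr fun x hx =>
    zeroExt_apply (V := V) (fun _ => r) ⟨x, hx⟩

namespace smoothFunctions

theorem add_apply (F G : smoothFunctions V) (z : V) :
    ((F + G : smoothFunctions V) : V → ℝ) z = (F : V → ℝ) z + (G : V → ℝ) z := rfl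

theorem sub_apply (F G : smoothFunctions V) (z : V) :
    ((F - G : smoothFunctions V) : V → ℝ) z = (F : V → ℝ) z - (G : V → ℝ) z := rfl

theorem neg_apply (F : smoothFunctions V) (z : V) :
    ((-F : smoothFunctions V) : V → ℝ) z = -(F : V → ℝ) z := rfl

theorem mul_apply (F G : smoothFunctions V) (z : V) :
    ((F * G : smoothFunctions V) : V → ℝ) z = (F : V → ℝ) z * (G : V → ℝ) z := rfl

theorem pow_apply (F : smoothFunctions V) (n : ℕ) (z : V) :
    ((F ^ n : smoothFunctions V) : V → ℝ) z = (F : V → ℝ) z ^ n := rfl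

theorem zero_apply (z : V) : ((0 : smoothFunctions V) : V → ℝ) z = 0 := rfl

theorem two_apply (z : V) : ((2 : smoothFunctions V) : V → ℝ) z = 2 := rfl

end smoothFunctions

/-- The restriction to `V` of a function smooth on `V`. -/
def smoothRestrict (G : (Fin n → ℝ) → ℝ) (hG : ContDiffOn ℝ ∞ G V) : smoothFunctions V :=
  ⟨fun x => G x, hG.congr (zeroExt_restrict_eqOn G)⟩

@[simp]
theorem smoothRestrict_apply (G : (Fin n → ℝ) → ℝ) (hG : ContDiffOn ℝ ∞ G V) (x : V) :
    (smoothRestrict G hG : V → ℝ) x = G x := rfl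

/-- On an open set derivatives depend only on the values there, so the extension by zero is
harmless. -/
theorem partialDeriv_congr {F G : (Fin n → ℝ) → ℝ} (hV : IsOpen V) (h : Set.EqOn F G V) (i : Fin n)
    {x : Fin n → ℝ} (hx : x ∈ V) : partialDeriv i F x = partialDeriv i G x := by
  unfold partialDeriv
  rw [(h.eventuallyEq_of_mem (hV.mem_nhds hx)).fderiv_eq]

theorem contDiffOn_partialDeriv {G : (Fin n → ℝ) → ℝ} (hV : IsOpen V) (hG : ContDiffOn ℝ ∞ G V)
    (i : Fin n) : ContDiffOn ℝ ∞ (partialDeriv i G) V :=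
  (hG.fderiv_of_isOpen hV le_rfl).clm_apply contDiffOn_const

theorem partialDeriv_add {F G : (Fin n → ℝ) → ℝ} {x : Fin n → ℝ} (hF : DifferentiableAt ℝ F x)
    (hG : DifferentiableAt ℝ G x) (i : Fin n) :
    partialDeriv i (fun y => F y + G y) x = partialDeriv i F x + partialDeriv i G x := by
  simp [partialDeriv, fderiv_fun_add hF hG]

theorem partialDeriv_mul {F G : (Fin n → ℝ) → ℝ} {x : Fin n → ℝ} (hF : DifferentiableAt ℝ F x)
    (hG : DifferentiableAt ℝ G x) (i : Fin n) :
    partialDeriv i (fun y => F y * G y) x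
      = F x * partialDeriv i G x + G x * partialDeriv i F x := by
  simp [partialDeriv, fderiv_fun_mul hF hG]

theorem ContDiffOn.differentiableAt_of_isOpen {G : (Fin n → ℝ) → ℝ} (hV : IsOpen V)
    (hG : ContDiffOn ℝ ∞ G V) {x : Fin n → ℝ} (hx : x ∈ V) : DifferentiableAt ℝ G x :=
  (hG.contDiffAt (hV.mem_nhds hx)).differentiableAt (by simp)

theorem differentiableAt_zeroExt (hV : IsOpen V) (F : smoothFunctions V) (x : V) :
    DifferentiableAt ℝ (zeroExt V F) x :=
  ContDiffOn.differentiableAt_of_isOpen hV F.2 x.2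

/-- The partial derivatives as derivations of the algebra of smooth functions on `V`. -/
def smoothDeriv (hV : IsOpen V) (i : Fin n) :
    Derivation ℝ (smoothFunctions V) (smoothFunctions V) :=
  Derivation.mk'
    { toFun := fun F => smoothRestrict (partialDeriv i (zeroExt V F))
        (contDiffOn_partialDeriv hV F.2 i)
      map_add' := fun F G => by
        ext x
        exact (partialDeriv_congr hV (zeroExt_add_eqOn F.1 G.1) i x.2).trans
          (partialDeriv_add (differentiableAt_zeroExt hV F x) (differentiableAt_zeroExt hV G x) i)
      map_smul' := fun r F => by
        ext x
        refine (partialDeriv_congr hV (zeroExt_smul_eqOn r F.1) i x.2).trans ?_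
        simp [partialDeriv, fderiv_const_mul (differentiableAt_zeroExt hV F x)] }
    fun F G => by
      ext x
      refine (partialDeriv_congr hV (zeroExt_mul_eqOn F.1 G.1) i x.2).trans ?_
      rw [partialDeriv_mul (differentiableAt_zeroExt hV F x) (differentiableAt_zeroExt hV G x) i]
      simp

theorem smoothDeriv_restrict (hV : IsOpen V) (i : Fin n) (G : (Fin n → ℝ) → ℝ)
    (hG : ContDiffOn ℝ ∞ G V) :
    smoothDeriv hV i (smoothRestrict G hG)
      = smoothRestrict (partialDeriv i G) (contDiffOn_partialDeriv hV hG i) := by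
  ext x
  exact partialDeriv_congr hV (zeroExt_restrict_eqOn G) i x.2

theorem smoothRestrict_zeroExt (F : smoothFunctions V) : smoothRestrict (zeroExt V F.1) F.2 = F :=
  Subtype.ext (funext fun x => zeroExt_apply F.1 x)

theorem smoothDeriv_comm (hV : IsOpen V) (i j : Fin n) (F : smoothFunctions V) :
    smoothDeriv hV i (smoothDeriv hV j F) = smoothDeriv hV j (smoothDeriv hV i F) := by
  obtain ⟨G, hF, rfl⟩ : ∃ G hG, smoothRestrict G hG = F := ⟨_, _, smoothRestrict_zeroExt F⟩
  simp only [smoothDeriv_restrict]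
  ext x
  have hG : ContDiffAt ℝ ∞ G x := hF.contDiffAt (hV.mem_nhds x.2)
  have hd : DifferentiableAt ℝ (fderiv ℝ G) x :=
    (hG.fderiv_right (m := ∞) le_rfl).differentiableAt (by simp)
  have key : ∀ i j, partialDeriv i (partialDeriv j G) x
      = fderiv ℝ (fderiv ℝ G) x (Pi.single i 1) (Pi.single j 1) := fun i j => by
    unfold partialDeriv
    rw [fderiv_clm_apply hd (differentiableAt_const _)]
    simp
  simp only [smoothRestrict_apply, key]
  exact hG.isSymmSndFDerivAt (by simpa using WithTop.coe_le_coe.2 (le_top (a := (2 : ℕ∞)))) _ _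

theorem fderiv_eq_zero_of_partialDeriv {F : (Fin n → ℝ) → ℝ} {x : Fin n → ℝ}
    (h : ∀ i, partialDeriv i F x = 0) : fderiv ℝ F x = 0 := by
  ext v
  rw [← Finset.univ_sum_single v, map_sum]
  refine Finset.sum_eq_zero fun i _ => ?_
  have : Pi.single i (v i) = v i • (Pi.single i 1 : Fin n → ℝ) := by
    rw [← Pi.single_smul]; simp
  simp [this, show fderiv ℝ F x (Pi.single i 1) = 0 from h i]

theorem exists_eq_const_of_smoothDeriv (hV : IsOpen V) (hc : IsPreconnected V)
    {F : smoothFunctions V} (h : ∀ i, smoothDeriv hV i F = 0) :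
    ∃ c : ℝ, ∀ x : V, (F : V → ℝ) x = c := by
  obtain ⟨c, hc⟩ := hV.exists_is_const_of_fderiv_eq_zero hc
    (fun x hx => (differentiableAt_zeroExt hV F ⟨x, hx⟩).differentiableWithinAt) (fun x hx =>
      fderiv_eq_zero_of_partialDeriv fun i => by
        have := congrFun (congrArg Subtype.val (h i)) ⟨x, hx⟩
        exact this)
  exact ⟨c, fun x => (zeroExt_apply F.1 x).symm.trans (hc x x.2)⟩

theorem partialDeriv_coord (i j : Fin n) (x : Fin n → ℝ) :
    partialDeriv i (fun y => y j) x = if i = j then 1 else 0 := by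
  have h : HasFDerivAt (fun y : Fin n → ℝ => y j)
      (ContinuousLinearMap.proj (R := ℝ) (φ := fun _ : Fin n => ℝ) j) x :=
    (ContinuousLinearMap.proj (R := ℝ) (φ := fun _ : Fin n => ℝ) j).hasFDerivAt
  unfold partialDeriv
  rw [h.fderiv]
  simp [Pi.single_apply, eq_comm]

theorem partialDeriv_comp_coord (i j : Fin n) {h : ℝ → ℝ} {x : Fin n → ℝ}
    (hh : DifferentiableAt ℝ h (x j)) :
    partialDeriv i (fun y => h (y j)) x = if i = j then deriv h (x j) else 0 := by
  have hc : HasFDerivAt (fun y : Fin n → ℝ => y j)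
      (ContinuousLinearMap.proj (R := ℝ) (φ := fun _ : Fin n => ℝ) j) x :=
    (ContinuousLinearMap.proj (R := ℝ) (φ := fun _ : Fin n => ℝ) j).hasFDerivAt
  unfold partialDeriv
  have := (hh.hasDerivAt.comp_hasFDerivAt x hc).fderiv
  simp only [Function.comp_def] at this
  rw [this]
  simp [Pi.single_apply, eq_comm]

/-- The `j`-th coordinate as a smooth function on `V`. -/
def smoothCoord (V : Set (Fin n → ℝ)) (j : Fin n) : smoothFunctions V :=
  smoothRestrict (fun x => x j) (contDiff_apply ℝ ℝ j).contDiffOn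

theorem smoothDeriv_coord (hV : IsOpen V) (i j : Fin n) :
    smoothDeriv hV i (smoothCoord V j) = if i = j then 1 else 0 := by
  rw [smoothCoord, smoothDeriv_restrict]
  ext x
  simp only [smoothRestrict_apply, partialDeriv_coord]
  split_ifs <;> rfl

end SmoothFunctions

/-- The frame attached to the coordinates `x, y, u, v = x s`. -/
def WilsFrame.ofCoordinates {R : Type*} [CommRing R] [Algebra ℝ R] (D : Fin 4 → Derivation ℝ R R)
    (comm : ∀ i j a, D i (D j a) = D j (D i a)) (c : Fin 4 → R)
    (hc : ∀ i j, D i (c j) = if i = j then 1 else 0) (r : R) (hr : c 0 * r = 1) (f : R)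
    (hf : IsUnit f) (hf0 : D 0 f = 0) (hf1 : D 1 f = 0) (hf3 : D 3 f = 0) : WilsFrame R :=
  have hr0 : D 0 r = -r ^ 2 := by
    have h := congrArg (D 0) hr
    simp [hc] at h
    linear_combination r * h - D 0 r * hr
  have hri : ∀ i ≠ 0, D i r = 0 := fun i hi => by
    have h := congrArg (D i) hr
    simp [hc, hi] at h
    linear_combination r * h - D i r * hr
  have hr1 := hri 1 (by decide)
  have hr2 := hri 2 (by decide)
  have hr3 := hri 3 (by decide)
  -- Chain rule for v = x s: at fixed s the x-derivative is ∂ₓ + s ∂ᵥ, and ∂ₛ = x ∂ᵥ.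
  { Dx := D 0 + (c 3 * r) • D 3
    Dy := D 1
    Du := D 2
    Ds := c 0 • D 3
    x := c 0
    y := c 1
    s := c 3 * r
    f := f
    isUnit_x := IsUnit.of_mul_eq_one r hr
    isUnit_f := hf
    Dx_x := by simp [hc]
    Dy_x := by simp [hc]
    Du_x := by simp [hc]
    Ds_x := by simp [hc]
    Dx_y := by simp [hc]
    Dy_y := by simp [hc]
    Du_y := by simp [hc]
    Ds_y := by simp [hc]
    Dx_s := by simp [hc, hr0, hr3]; ring
    Dy_s := by simp [hc, hr1]
    Du_s := by simp [hc, hr2]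
    Ds_s := by simp [hc, hr3]; linear_combination hr
    Dx_f := by simp [hf0, hf3]
    Dy_f := hf1
    Ds_f := by simp [hf3]
    comm_yx := fun a => by simp [hc, hr1, comm 1]
    comm_ux := fun a => by simp [hc, hr2, comm 2 0, comm 2 3]
    comm_sx := fun a => by
      simp [hc, hr3, comm 3 0]
      linear_combination D 3 a * hr
    comm_uy := fun a => comm 2 1 a
    comm_sy := fun a => by simp [hc, comm 3 1]
    comm_su := fun a => by simp [hc, comm 3 2] }

/-! ### Hamilton's equations of the Wils metric -/

theorem wilsMetric_inv (f : ℝ → ℝ) {x : Fin 4 → ℝ} (hx : x 0 ≠ 0) :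
    (wilsMetric f x)⁻¹ = !![-1, 0, 0, -x 3 / x 0;
      0, -1, 0, 0;
      0, 0, 0, 1 / x 0;
      -x 3 / x 0, 0, 1 / x 0, -(f (x 2) * (x 0 ^ 2 + x 1 ^ 2)) / x 0] := by
  refine Matrix.inv_eq_right_inv ?_
  ext i j
  fin_cases i <;> fin_cases j <;>
    simp [wilsMetric, Matrix.mul_apply, Fin.sum_univ_four] <;> field_simp <;> ring

theorem hamiltonian_wilsMetric (f : ℝ → ℝ) {x : Fin 4 → ℝ} (hx : x 0 ≠ 0) (p : Fin 4 → ℝ) :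
    hamiltonian (wilsMetric f) x p = -(p 0 ^ 2 + p 1 ^ 2) / 2
      + (p 2 * p 3 - x 3 * (p 0 * p 3) - f (x 2) * (x 0 ^ 2 + x 1 ^ 2) * (p 3 ^ 2 / 2))
        * (x 0)⁻¹ := by
  rw [hamiltonian, wilsMetric_inv f hx]
  simp [Matrix.mulVec, dotProduct, Fin.sum_univ_four]
  field_simp
  ring

theorem hasFDerivAt_coord {n : ℕ} (j : Fin n) (x : Fin n → ℝ) :
    HasFDerivAt (fun y : Fin n → ℝ => y j)
      (ContinuousLinearMap.proj (R := ℝ) (φ := fun _ : Fin n => ℝ) j) x :=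
  (ContinuousLinearMap.proj (R := ℝ) (φ := fun _ : Fin n => ℝ) j).hasFDerivAt

/-- The velocity `∂H/∂p` of the geodesic flow of the Wils metric. -/
def wilsVelocity (f : ℝ → ℝ) (x p : Fin 4 → ℝ) : Fin 4 → ℝ :=
  ![-p 0 - x 3 * p 3 * (x 0)⁻¹, -p 1, p 3 * (x 0)⁻¹,
    (p 2 - x 3 * p 0 - f (x 2) * (x 0 ^ 2 + x 1 ^ 2) * p 3) * (x 0)⁻¹]

/-- The force `-∂H/∂x` of the geodesic flow of the Wils metric. -/
def wilsForce (f : ℝ → ℝ) (x p : Fin 4 → ℝ) : Fin 4 → ℝ :=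
  ![(p 2 * p 3 - x 3 * (p 0 * p 3) - f (x 2) * (x 0 ^ 2 + x 1 ^ 2) * (p 3 ^ 2 / 2))
      * ((x 0)⁻¹) ^ 2 + f (x 2) * p 3 ^ 2,
    f (x 2) * x 1 * p 3 ^ 2 * (x 0)⁻¹,
    deriv f (x 2) * (x 0 ^ 2 + x 1 ^ 2) * (p 3 ^ 2 / 2) * (x 0)⁻¹,
    p 0 * p 3 * (x 0)⁻¹]

theorem partialDeriv_hamiltonian_momentum (f : ℝ → ℝ) {x : Fin 4 → ℝ} (hx : x 0 ≠ 0)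
    (p : Fin 4 → ℝ) (i : Fin 4) :
    partialDeriv i (fun q => hamiltonian (wilsMetric f) x q) p = wilsVelocity f x p i := by
  have hc := fun j => hasFDerivAt_coord j p
  have h := (((((hc 0).pow 2).add ((hc 1).pow 2)).neg.mul_const (1 / 2)).add
    (((((hc 2).mul (hc 3)).sub (((hc 0).mul (hc 3)).const_mul (x 3))).sub
      ((((hc 3).pow 2).mul_const (1 / 2)).const_mul
        (f (x 2) * (x 0 ^ 2 + x 1 ^ 2)))).mul_const (x 0)⁻¹))
  have e : (fun q => hamiltonian (wilsMetric f) x q) = _ :=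
    funext fun q => hamiltonian_wilsMetric f hx q
  unfold partialDeriv
  rw [e]
  have h' := h.congr_of_eventuallyEq (f₁ := fun p : Fin 4 → ℝ => -(p 0 ^ 2 + p 1 ^ 2) / 2
      + (p 2 * p 3 - x 3 * (p 0 * p 3) - f (x 2) * (x 0 ^ 2 + x 1 ^ 2) * (p 3 ^ 2 / 2))
        * (x 0)⁻¹) (Filter.Eventually.of_forall fun q => by simp; ring)
  rw [h'.fderiv]
  fin_cases i <;> simp [wilsVelocity] <;> ring

theorem partialDeriv_hamiltonian_position {f : ℝ → ℝ} {x : Fin 4 → ℝ} (hx : x 0 ≠ 0)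
    (hf : DifferentiableAt ℝ f (x 2)) (p : Fin 4 → ℝ) (i : Fin 4) :
    partialDeriv i (fun y => hamiltonian (wilsMetric f) y p) x = -wilsForce f x p i := by
  have hc := fun j => hasFDerivAt_coord j x
  have hfx : HasFDerivAt (fun y : Fin 4 → ℝ => f (y 2)) _ x :=
    hf.hasDerivAt.comp_hasFDerivAt x (hc 2)
  have hinv : HasFDerivAt (fun y : Fin 4 → ℝ => (y 0)⁻¹) _ x :=
    (hasDerivAt_inv hx).comp_hasFDerivAt x (hc 0)
  have h := (((((hc 3).mul_const (p 0 * p 3)).const_sub (p 2 * p 3)).sub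
    ((hfx.mul (((hc 0).pow 2).add ((hc 1).pow 2))).mul_const (p 3 ^ 2 / 2))).mul hinv).const_add
      (-(p 0 ^ 2 + p 1 ^ 2) / 2)
  have h' := h.congr_of_eventuallyEq (f₁ := fun y => hamiltonian (wilsMetric f) y p) (by
    have h0 : ∀ᶠ y : Fin 4 → ℝ in nhds x, y 0 ≠ 0 :=
      (continuous_apply (0 : Fin 4)).continuousAt.eventually_ne hx
    filter_upwards [h0] with y hy
    rw [hamiltonian_wilsMetric f hy]
    simp)
  unfold partialDeriv
  rw [h'.fderiv]
  fin_cases i <;> simp [wilsForce] <;> field_simp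
  ring

theorem poissonBracket_hamiltonian {f : ℝ → ℝ} {x : Fin 4 → ℝ} (hx : x 0 ≠ 0)
    (hf : DifferentiableAt ℝ f (x 2)) (I : (Fin 4 → ℝ) → (Fin 4 → ℝ) → ℝ) (p : Fin 4 → ℝ) :
    poissonBracket (hamiltonian (wilsMetric f)) I x p =
      ∑ i, (wilsVelocity f x p i * partialDeriv i (fun y => I y p) x
        + wilsForce f x p i * partialDeriv i (fun q => I x q) p) := by
  unfold poissonBracket
  refine Finset.sum_congr rfl fun i _ => ?_
  rw [partialDeriv_hamiltonian_momentum f hx, partialDeriv_hamiltonian_position hx hf]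
  ring

theorem momentumPolynomial_two {n : ℕ} (a : (Fin n → ℝ) → (Fin 2 → Fin n) → ℝ)
    (x p : Fin n → ℝ) :
    momentumPolynomial a x p = ∑ j, ∑ k, a x ![j, k] * (p j * p k) := by
  unfold momentumPolynomial
  rw [← (finTwoArrowEquiv (Fin n)).symm.sum_comp, Fintype.sum_prod_type]
  simp [finTwoArrowEquiv]

theorem partialDeriv_quadratic {n : ℕ} (M : Fin n → Fin n → ℝ) (p : Fin n → ℝ) (i : Fin n) :
    partialDeriv i (fun q => ∑ j, ∑ k, M j k * (q j * q k)) p = ∑ k, (M i k + M k i) * p k := by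
  have h : HasFDerivAt (fun q : Fin n → ℝ => ∑ j, ∑ k, M j k * (q j * q k)) _ p :=
    HasFDerivAt.fun_sum fun j _ => HasFDerivAt.fun_sum fun k _ =>
      ((hasFDerivAt_coord j p).mul (hasFDerivAt_coord k p)).const_mul (M j k)
  unfold partialDeriv
  rw [h.fderiv]
  simp only [sum_apply, smul_apply,
    add_apply, ContinuousLinearMap.proj_apply, smul_eq_mul, mul_add,
    Finset.sum_add_distrib, Pi.single_apply, add_mul]
  rw [add_comm]
  congr 1
  · rw [Finset.sum_comm]
    simp
  · simp

theorem partialDeriv_sum_mul {n m : ℕ} {A : (Fin n → ℝ) → Fin m → Fin m → ℝ} {x : Fin n → ℝ}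
    (hA : ∀ j k, DifferentiableAt ℝ (fun y => A y j k) x) (p : Fin m → ℝ) (i : Fin n) :
    partialDeriv i (fun y => ∑ j, ∑ k, A y j k * (p j * p k)) x
      = ∑ j, ∑ k, partialDeriv i (fun y => A y j k) x * (p j * p k) := by
  have h : HasFDerivAt (fun y : Fin n → ℝ => ∑ j, ∑ k, A y j k * (p j * p k)) _ x :=
    HasFDerivAt.fun_sum fun j _ => HasFDerivAt.fun_sum fun k _ =>
      (hA j k).hasFDerivAt.mul_const (p j * p k)
  unfold partialDeriv
  rw [h.fderiv]
  simp [mul_comm]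

/-! ### From Killing tensors to the algebraic system -/

section Frame

variable {n : ℕ} {V : Set (Fin n → ℝ)}

theorem smoothRestrict_congr {F G : (Fin n → ℝ) → ℝ} {hF : ContDiffOn ℝ ∞ F V}
    {hG : ContDiffOn ℝ ∞ G V} (h : Set.EqOn F G V) : smoothRestrict F hF = smoothRestrict G hG :=
  Subtype.ext (funext fun x => h x.2)

theorem contDiffOn_comp_coord {W : Set ℝ} {j : Fin n} (hVW : ∀ x ∈ V, x j ∈ W) {P : ℝ → ℝ}
    (hP : ContDiffOn ℝ ∞ P W) : ContDiffOn ℝ ∞ (fun x => P (x j)) V :=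
  hP.comp (contDiff_apply ℝ ℝ j).contDiffOn hVW

theorem smoothDeriv_comp_coord (hV : IsOpen V) {W : Set ℝ} (hW : IsOpen W) {j : Fin n}
    (hVW : ∀ x ∈ V, x j ∈ W) {P : ℝ → ℝ} (hP : ContDiffOn ℝ ∞ P W) :
    smoothDeriv hV j (smoothRestrict _ (contDiffOn_comp_coord hVW hP)) =
      smoothRestrict _ (contDiffOn_comp_coord hVW (hP.deriv_of_isOpen hW le_rfl)) := by
  rw [smoothDeriv_restrict]
  refine smoothRestrict_congr fun x hx => ?_
  simp [partialDeriv_comp_coord j j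
    ((hP.contDiffAt (hW.mem_nhds (hVW x hx))).differentiableAt (by simp))]

theorem smoothDeriv_comp_coord_of_ne (hV : IsOpen V) {W : Set ℝ} (hW : IsOpen W) {i j : Fin n}
    (hij : i ≠ j) (hVW : ∀ x ∈ V, x j ∈ W) {P : ℝ → ℝ} (hP : ContDiffOn ℝ ∞ P W) :
    smoothDeriv hV i (smoothRestrict _ (contDiffOn_comp_coord hVW hP)) = 0 := by
  rw [smoothDeriv_restrict]
  ext x
  rw [smoothRestrict_apply, partialDeriv_comp_coord i j
    ((hP.contDiffAt (hW.mem_nhds (hVW x x.2))).differentiableAt (by simp)), if_neg hij]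
  rfl

end Frame

section Wils

variable {V : Set (Fin 4 → ℝ)} {W : Set ℝ} {f : ℝ → ℝ}

/-- The frame of the Wils metric on `V`. -/
def wilsFrame (hV : IsOpen V) (hW : IsOpen W) (hVW : ∀ x ∈ V, x 2 ∈ W) (hx : ∀ x ∈ V, x 0 ≠ 0)
    (hf : ContDiffOn ℝ ∞ f W) (hf0 : ∀ u ∈ W, f u ≠ 0) : WilsFrame (smoothFunctions V) :=
  WilsFrame.ofCoordinates (smoothDeriv hV) (smoothDeriv_comm hV) (smoothCoord V)
    (smoothDeriv_coord hV)
    (smoothRestrict (fun x => (x 0)⁻¹) ((contDiff_apply ℝ ℝ 0).contDiffOn.inv hx))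
    (Subtype.ext (funext fun x => mul_inv_cancel₀ (hx x x.2)))
    (smoothRestrict _ (contDiffOn_comp_coord hVW hf))
    (IsUnit.of_mul_eq_one (smoothRestrict _ (contDiffOn_comp_coord hVW (hf.inv hf0)))
      (Subtype.ext (funext fun x => mul_inv_cancel₀ (hf0 _ (hVW x x.2)))))
    (smoothDeriv_comp_coord_of_ne hV hW (by decide) hVW hf)
    (smoothDeriv_comp_coord_of_ne hV hW (by decide) hVW hf)
    (smoothDeriv_comp_coord_of_ne hV hW (by decide) hVW hf)

variable (hV : IsOpen V) (hW : IsOpen W) (hVW : ∀ x ∈ V, x 2 ∈ W) (hx : ∀ x ∈ V, x 0 ≠ 0)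
    (hf : ContDiffOn ℝ ∞ f W) (hf0 : ∀ u ∈ W, f u ≠ 0)

theorem wilsFrame_Dx (a : smoothFunctions V) : (wilsFrame hV hW hVW hx hf hf0).Dx a =
    smoothDeriv hV 0 a + (wilsFrame hV hW hVW hx hf hf0).s * smoothDeriv hV 3 a := rfl

theorem wilsFrame_Dy (a : smoothFunctions V) : (wilsFrame hV hW hVW hx hf hf0).Dy a =
    smoothDeriv hV 1 a := rfl

theorem wilsFrame_Du (a : smoothFunctions V) : (wilsFrame hV hW hVW hx hf hf0).Du a =
    smoothDeriv hV 2 a := rfl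

theorem wilsFrame_Ds (a : smoothFunctions V) : (wilsFrame hV hW hVW hx hf hf0).Ds a =
    (wilsFrame hV hW hVW hx hf hf0).x * smoothDeriv hV 3 a := rfl

theorem wilsFrame_x (z : V) : ((wilsFrame hV hW hVW hx hf hf0).x : V → ℝ) z = z.1 0 := rfl

theorem wilsFrame_y (z : V) : ((wilsFrame hV hW hVW hx hf hf0).y : V → ℝ) z = z.1 1 := rfl

theorem wilsFrame_s (z : V) :
    ((wilsFrame hV hW hVW hx hf hf0).s : V → ℝ) z = z.1 3 * (z.1 0)⁻¹ := rfl

theorem wilsFrame_f :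
    (wilsFrame hV hW hVW hx hf hf0).f = smoothRestrict _ (contDiffOn_comp_coord hVW hf) := rfl

theorem exists_eq_const_of_wilsFrame (hVc : IsPreconnected V) {a : smoothFunctions V}
    (h0 : (wilsFrame hV hW hVW hx hf hf0).Dx a = 0) (h1 : (wilsFrame hV hW hVW hx hf hf0).Dy a = 0)
    (h2 : (wilsFrame hV hW hVW hx hf hf0).Du a = 0)
    (h3 : (wilsFrame hV hW hVW hx hf hf0).Ds a = 0) :
    ∃ c : ℝ, ∀ x : V, (a : V → ℝ) x = c := by
  have h3' : smoothDeriv hV 3 a = 0 :=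
    ((wilsFrame hV hW hVW hx hf hf0).isUnit_x.mul_right_eq_zero).1 h3
  refine exists_eq_const_of_smoothDeriv hV hVc fun i => ?_
  fin_cases i
  · rw [wilsFrame_Dx, h3', mul_zero, add_zero] at h0
    exact h0
  exacts [h1, h2, h3']

/-- The components of a symmetric tensor field, as coefficients of a quadratic form. -/
def quadCoeff {a : (Fin 4 → ℝ) → (Fin 2 → Fin 4) → ℝ} (ha : ContDiffOn ℝ ∞ a V) (i j : Fin 4) :
    smoothFunctions V :=
  (if i = j then (1 : ℝ) else 2) • smoothRestrict (fun y => a y ![i, j])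
    ((contDiff_apply ℝ ℝ _).comp_contDiffOn ha)

theorem quadForm_apply (q : Fin 4 → Fin 4 → smoothFunctions V) (p₀ p₁ p₂ p₃ : smoothFunctions V)
    (z : V) : ((quadForm q p₀ p₁ p₂ p₃ : smoothFunctions V) : V → ℝ) z =
      quadForm (fun i j => (q i j : V → ℝ) z) ((p₀ : V → ℝ) z) ((p₁ : V → ℝ) z) ((p₂ : V → ℝ) z)
        ((p₃ : V → ℝ) z) := by
  simp [quadForm]

theorem quadForm_eq_sum {M : Fin 4 → Fin 4 → ℝ} (hM : ∀ i j, M i j = M j i) (p : Fin 4 → ℝ) :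
    quadForm (fun i j => (if i = j then 1 else 2) * M i j) (p 0) (p 1) (p 2) (p 3)
      = ∑ i, ∑ j, M i j * (p i * p j) := by
  simp [quadForm, Fin.sum_univ_four]
  rw [hM 1 0, hM 2 0, hM 3 0, hM 2 1, hM 3 1, hM 3 2]
  ring

theorem IsKillingTensor.symm_two {g : (Fin 4 → ℝ) → Matrix (Fin 4) (Fin 4) ℝ}
    {a : (Fin 4 → ℝ) → (Fin 2 → Fin 4) → ℝ} (ha : IsKillingTensor g V 2 a) {x : Fin 4 → ℝ}
    (hxV : x ∈ V) (i j : Fin 4) : a x ![i, j] = a x ![j, i] := by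
  rw [← ha.2.1 x hxV (Equiv.swap 0 1) ![j, i]]
  congr 1
  ext k
  fin_cases k <;> simp

/-- Pointwise, this is 2x² times the Poisson bracket with H. The momenta may be arbitrary functions
because only their values at the point enter. -/
theorem frameBracket_quadCoeff {a : (Fin 4 → ℝ) → (Fin 2 → Fin 4) → ℝ}
    (ha : IsKillingTensor (wilsMetric f) V 2 a) (p₀ p₁ p₂ p₃ : smoothFunctions V) :
    frameBracket (wilsFrame hV hW hVW hx hf hf0) (quadCoeff ha.1) p₀ p₁ p₂ p₃ = 0 := by
  ext z
  obtain ⟨p, h0, h1, h2, h3⟩ : ∃ p : Fin 4 → ℝ, (p₀ : V → ℝ) z = p 0 ∧ (p₁ : V → ℝ) z = p 1 ∧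
      (p₂ : V → ℝ) z = p 2 ∧ (p₃ : V → ℝ) z = p 3 :=
    ⟨![(p₀ : V → ℝ) z, (p₁ : V → ℝ) z, (p₂ : V → ℝ) z, (p₃ : V → ℝ) z], rfl, rfl, rfl, rfl⟩
  set A : Fin 4 → Fin 4 → ℝ := fun j k => a z ![j, k] with hA
  have hAs : ∀ j k, A j k = A k j := ha.symm_two z.2
  set B : Fin 4 → Fin 4 → Fin 4 → ℝ := fun i j k => partialDeriv i (fun y => a y ![j, k]) z with hB
  have hBs : ∀ i j k, B i j k = B i k j := fun i j k =>
    partialDeriv_congr hV (fun y hy => ha.symm_two hy j k) i z.2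
  have hq : ∀ i j, ((quadCoeff ha.1 i j : smoothFunctions V) : V → ℝ) z
      = (if i = j then 1 else 2) * A i j := fun i j => rfl
  have hdq : ∀ l i j, ((smoothDeriv hV l (quadCoeff ha.1 i j) : smoothFunctions V) : V → ℝ) z
      = (if i = j then 1 else 2) * B l i j := fun l i j => by
    rw [quadCoeff, Derivation.map_smul, smoothDeriv_restrict]
    rfl
  have hQ : ∀ l, ((quadForm (fun i j => smoothDeriv hV l (quadCoeff ha.1 i j)) p₀ p₁ p₂ p₃ :
      smoothFunctions V) : V → ℝ) z
      = ∑ i, ∑ j, B l i j * (p i * p j) := fun l => by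
    rw [quadForm_apply]
    simp only [hdq, h0, h1, h2, h3]
    exact quadForm_eq_sum (hBs l) p
  have hz := hx z z.2
  have hbr := ha.2.2 z z.2 p
  have hfz : DifferentiableAt ℝ f (z.1 2) :=
    (hf.contDiffAt (hW.mem_nhds (hVW z z.2))).differentiableAt (by simp)
  rw [poissonBracket_hamiltonian hz hfz] at hbr
  simp only [momentumPolynomial_two] at hbr
  simp only [partialDeriv_quadratic] at hbr
  have hd : ∀ j k, DifferentiableAt ℝ (fun y => a y ![j, k]) z := fun j k =>
    ContDiffOn.differentiableAt_of_isOpen hV ((contDiff_apply ℝ ℝ _).comp_contDiffOn ha.1) z.2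
  have hpd := fun i => partialDeriv_sum_mul (A := fun y j k => a y ![j, k]) hd p i
  simp only [hpd] at hbr
  have e1 : quadForm
      (fun i j => (wilsFrame hV hW hVW hx hf hf0).Dx (quadCoeff ha.1 i j)) p₀ p₁ p₂ p₃
      = quadForm (fun i j => smoothDeriv hV 0 (quadCoeff ha.1 i j)) p₀ p₁ p₂ p₃
        + (wilsFrame hV hW hVW hx hf hf0).s *
          quadForm (fun i j => smoothDeriv hV 3 (quadCoeff ha.1 i j)) p₀ p₁ p₂ p₃ := by
    simp only [quadForm, wilsFrame_Dx]
    ring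
  have e2 : quadForm
      (fun i j => (wilsFrame hV hW hVW hx hf hf0).Ds (quadCoeff ha.1 i j)) p₀ p₁ p₂ p₃
      = (wilsFrame hV hW hVW hx hf hf0).x *
          quadForm (fun i j => smoothDeriv hV 3 (quadCoeff ha.1 i j)) p₀ p₁ p₂ p₃ := by
    simp only [quadForm, wilsFrame_Ds]
    ring
  unfold frameBracket
  rw [e1, e2]
  simp only [wilsFrame_Dy, wilsFrame_Du, wilsFrame_f, smoothDeriv_comp_coord hV hW hVW hf]
  change _ = (0 : ℝ)
  simp only [smoothFunctions.add_apply, smoothFunctions.sub_apply, smoothFunctions.mul_apply,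
    smoothFunctions.pow_apply, smoothFunctions.neg_apply, smoothFunctions.two_apply, hQ, hq, h0, h1,
    h2, h3, wilsFrame_x, wilsFrame_y, wilsFrame_s, smoothRestrict_apply]
  change ∑ i, (wilsVelocity f z p i * ∑ j, ∑ k, B i j k * (p j * p k) + wilsForce f z p i *
    ∑ k, (A i k + A k i) * p k) = 0 at hbr
  -- Derivatives of the tensor enter only through these four quadratic forms, which can stay opaque.
  generalize hS : (fun i => ∑ j, ∑ k, B i j k * (p j * p k)) = T at hbr
  have hS' : ∀ i, ∑ j, ∑ k, B i j k * (p j * p k) = T i := fun i => congrFun hS i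
  simp only [hS'] at hbr ⊢
  simp [wilsVelocity, wilsForce, Fin.sum_univ_four, hAs 1 0, hAs 2 0, hAs 3 0, hAs 2 1, hAs 3 1,
    hAs 3 2] at hbr ⊢
  field_simp at hbr ⊢
  linear_combination hbr

end Wils

/-! ### Quadratic integrals where f P² = ±1 -/

section Root

variable {V : Set (Fin 4 → ℝ)} {W : Set ℝ} {f P : ℝ → ℝ}

theorem momentumPolynomial_eq_of_root (hV : IsOpen V) (hVc : IsPreconnected V) (hW : IsOpen W)
    (hVW : ∀ x ∈ V, x 2 ∈ W) (hx : ∀ x ∈ V, x 0 ≠ 0) (hf : ContDiffOn ℝ ∞ f W)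
    (hP : ContDiffOn ℝ ∞ P W) {ε : ℝ} (hε : ε * ε = 1) (hfP : ∀ u ∈ W, f u * P u ^ 2 = ε)
    {a : (Fin 4 → ℝ) → (Fin 2 → Fin 4) → ℝ} (ha : IsKillingTensor (wilsMetric f) V 2 a) :
    ∃ k l : ℝ, (∀ x ∈ V, k * deriv (deriv (deriv P)) (x 2) = 0) ∧
      ∀ x ∈ V, ∀ p, momentumPolynomial a x p =
        k * (P (x 2) * p 2 - (deriv P (x 2) * x 3 + deriv (deriv P) (x 2) * x 0) * p 3) ^ 2
          + l * hamiltonian (wilsMetric f) x p := by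
  have hf0 : ∀ u ∈ W, f u ≠ 0 := fun u hu h0 => by
    have := hfP u hu
    rw [h0, zero_mul] at this
    rw [← this] at hε
    simp at hε
  have hP1 := hP.deriv_of_isOpen (m := ∞) hW le_rfl
  have hP2 := hP1.deriv_of_isOpen (m := ∞) hW le_rfl
  set S := wilsFrame hV hW hVW hx hf hf0 with hS
  set q := quadCoeff ha.1 with hq
  obtain ⟨r, hr⟩ := S.isUnit_x.exists_right_inv
  obtain ⟨K, haa, hab, hbb, hac, hbc, hcc, hae, hbe, hce, hee⟩ :=
    -- These values invert the triangular change of components to (x, y, u, s), r being 1/x.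
    exists_killingSystem (S := S) (q := q) (ae := r * (q 0 3 - 2 * S.s * q 0 0))
      (be := r * (q 1 3 - S.s * q 0 1)) (ce := r * (q 2 3 - S.s * q 0 2))
      (ee := r ^ 2 * (q 3 3 - S.x * S.s * (r * (q 0 3 - 2 * S.s * q 0 0)) - S.s ^ 2 * q 0 0))
      rfl rfl rfl rfl rfl rfl (by linear_combination -(q 0 3 - 2 * S.s * q 0 0) * hr)
      (by linear_combination -(q 1 3 - S.s * q 0 1) * hr)
      (by linear_combination -(q 2 3 - S.s * q 0 2) * hr)
      (by linear_combination -(1 + S.x * r) *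
            (q 3 3 - S.x * S.s * (r * (q 0 3 - 2 * S.s * q 0 0)) - S.s ^ 2 * q 0 0) * hr)
      (frameBracket_quadCoeff hV hW hVW hx hf hf0 ha)
  have hDP : S.Dx (smoothRestrict _ (contDiffOn_comp_coord hVW hP)) = 0 := by
    rw [hS, wilsFrame_Dx, smoothDeriv_comp_coord_of_ne hV hW (by decide) hVW hP,
      smoothDeriv_comp_coord_of_ne hV hW (by decide) hVW hP, mul_zero, add_zero]
  have hDs : S.Ds (smoothRestrict _ (contDiffOn_comp_coord hVW hP)) = 0 := by
    rw [hS, wilsFrame_Ds, smoothDeriv_comp_coord_of_ne hV hW (by decide) hVW hP, mul_zero]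
  obtain ⟨k, hkx, hky, hku, hks, h3, ecc, ece, eee⟩ := K.eq_of_root
    (P := smoothRestrict _ (contDiffOn_comp_coord hVW hP))
    (c := algebraMap ℝ _ ε) (by rw [← map_mul, hε, map_one])
    (Subtype.ext (funext fun x => hfP _ (hVW x x.2))) (Derivation.map_algebraMap _ _)
    hDP (smoothDeriv_comp_coord_of_ne hV hW (by decide) hVW hP) hDs
  obtain ⟨k₀, hk₀⟩ := exists_eq_const_of_wilsFrame hV hW hVW hx hf hf0 hVc hkx hky hku hks
  obtain ⟨l₀, hl₀⟩ := exists_eq_const_of_wilsFrame hV hW hVW hx hf hf0 hVc K.eq_aaa K.aa_y K.aa_u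
    K.aa_s
  have hu1 : S.Du (smoothRestrict _ (contDiffOn_comp_coord hVW hP))
      = smoothRestrict _ (contDiffOn_comp_coord hVW hP1) := smoothDeriv_comp_coord hV hW hVW hP
  have hu2 : S.Du (smoothRestrict _ (contDiffOn_comp_coord hVW hP1))
      = smoothRestrict _ (contDiffOn_comp_coord hVW hP2) := smoothDeriv_comp_coord hV hW hVW hP1
  have hu3 : S.Du (smoothRestrict _ (contDiffOn_comp_coord hVW hP2)) = _ :=
    smoothDeriv_comp_coord hV hW hVW hP2
  rw [hu1, hu2, hu3] at h3
  rw [hu1, hu2] at ece eee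
  -- H contains -p₀²/2, so the constant component `aa` = l₀ contributes -2 l₀ H.
  refine ⟨k₀, -2 * l₀, fun x hxV => ?_, fun x hxV p => ?_⟩
  · rw [← hk₀ ⟨x, hxV⟩]
    exact congrFun (congrArg Subtype.val h3) ⟨x, hxV⟩
  · set z : V := ⟨x, hxV⟩
    have ev : ∀ {F G : smoothFunctions V}, F = G → (F : V → ℝ) z = (G : V → ℝ) z := fun h => by
      rw [h]
    have hk := hk₀ z
    have hl := hl₀ z
    have hz := hx x hxV
    have e11 : q 1 1 = K.aa := hbb.symm.trans K.aa_eq_bb.symm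
    have e01 : q 0 1 = 0 := hab.symm.trans K.ab_eq_zero
    have e02 : q 0 2 = 0 := hac.symm.trans K.ac_eq
    have e12 : q 1 2 = 0 := hbc.symm.trans K.bc_eq
    have e03 : q 0 3 = 2 * S.s * K.aa := by
      have h := hae.symm.trans K.ae_eq_zero
      rw [haa]
      linear_combination S.x * h - (q 0 3 - 2 * S.s * q 0 0) * hr
    have e13 : q 1 3 = 0 := by
      have h := hbe.symm.trans K.be_eq_zero
      rw [e01] at h
      linear_combination S.x * h - q 1 3 * hr
    have e23 : q 2 3 = S.x * K.ce := by
      rw [hce, e02]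
      linear_combination -q 2 3 * hr
    have e33 : q 3 3 = S.x ^ 2 * K.ee + S.s ^ 2 * K.aa := by
      have h := hae.symm.trans K.ae_eq_zero
      rw [hee, h, haa]
      linear_combination -(1 + S.x * r) * (q 3 3 - S.s ^ 2 * q 0 0) * hr
    have hsum : momentumPolynomial a x p = quadForm (fun i j => (q i j : V → ℝ) z) (p 0) (p 1)
        (p 2) (p 3) := by
      rw [momentumPolynomial_two]
      exact (quadForm_eq_sum (M := fun i j => a x ![i, j]) (ha.symm_two hxV) p).symm
    have v00 := ev haa
    have v22 := ev (hcc.symm.trans ecc)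
    have v11 := ev e11
    have v01 := ev e01
    have v02 := ev e02
    have v12 := ev e12
    have v03 := ev e03
    have v13 := ev e13
    have v23 := ev e23
    have v33 := ev e33
    have vce := ev ece
    have vee := ev eee
    have sx : (S.x : V → ℝ) z = x 0 := rfl
    have sy : (S.y : V → ℝ) z = x 1 := rfl
    have ss : (S.s : V → ℝ) z = x 3 * (x 0)⁻¹ := rfl
    have sf : (S.f : V → ℝ) z = f (x 2) := rfl
    simp only [smoothFunctions.add_apply, smoothFunctions.sub_apply, smoothFunctions.mul_apply,
      smoothFunctions.pow_apply, smoothFunctions.neg_apply, smoothFunctions.two_apply,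
      smoothFunctions.zero_apply, sx, sy, ss, sf, smoothRestrict_apply, hk, hl] at v00 v22 v11 v01 v02 v12 v03 v13 v23 v33 vce vee
    rw [hsum, hamiltonian_wilsMetric f hz]
    simp only [quadForm, ← v00, v22, v11, v01, v02, v12, v03, v13, v23, v33]
    have tz : (z : Fin 4 → ℝ) = x := rfl
    rw [tz] at vce vee ⊢
    generalize (K.ce : V → ℝ) z = ce at vce ⊢
    generalize (K.ee : V → ℝ) z = ee at vee ⊢
    field_simp at vce vee ⊢
    linear_combination (x 0 * p 2 * p 3) * vce + p 3 ^ 2 * vee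

end Root

/-! ### Unique continuation along geodesics -/

open Filter Topology in
/-- A first integral of a `C¹` vector field that vanishes on an open set vanishes near every point
whose trajectory enters that set. -/
theorem eventually_eq_zero_of_trajectory {E : Type*} [NormedAddCommGroup E] [NormedSpace ℝ E]
    [CompleteSpace E] {v : E → E} {F : E → ℝ} {y₀ : E} (hv : ContDiffAt ℝ 1 v y₀)
    (hF : ∀ᶠ y in 𝓝 y₀, DifferentiableAt ℝ F y ∧ fderiv ℝ F y (v y) = 0) {O : Set E}
    (hO : IsOpen O) (hFO : ∀ y ∈ O, F y = 0)
    (henter : ∀ α : ℝ → E, α 0 = y₀ → HasDerivAt α (v y₀) 0 → ∀ᶠ t in 𝓝[>] (0 : ℝ), α t ∈ O) :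
    ∀ᶠ y in 𝓝 y₀, F y = 0 := by
  -- Picard–Lindelöf gives a local flow that is jointly continuous in the initial point and time.
  obtain ⟨ε, hε, a, r, L, K, hr, H⟩ := IsPicardLindelof.of_contDiffAt_one hv
  obtain ⟨α, hα, hαc⟩ := (H 0).exists_forall_mem_closedBall_eq_hasDerivWithinAt_continuousOn
  simp only [zero_sub, zero_add] at hα hαc
  have hcont : ∀ t, |t| < ε → ContinuousAt α (y₀, t) := fun t ht =>
    hαc.continuousAt (prod_mem_nhds (Metric.closedBall_mem_nhds _ hr)
      (Icc_mem_nhds (abs_lt.1 ht).1 (abs_lt.1 ht).2))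
  have hder : ∀ y ∈ Metric.closedBall y₀ r, ∀ t, |t| < ε →
      HasDerivAt (fun t => α (y, t)) (v (α (y, t))) t := fun y hy t ht =>
    ((hα y hy).2 t ⟨(abs_lt.1 ht).1.le, (abs_lt.1 ht).2.le⟩).hasDerivAt
      (Icc_mem_nhds (abs_lt.1 ht).1 (abs_lt.1 ht).2)
  have h00 : α (y₀, 0) = y₀ := (hα y₀ (Metric.mem_closedBall_self r.2)).1
  have hloc : ∀ᶠ y in 𝓝 (y₀, (0 : ℝ)), DifferentiableAt ℝ F (α y) ∧
      fderiv ℝ F (α y) (v (α y)) = 0 := by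
    have := hcont 0 (by simpa using hε)
    rw [ContinuousAt, h00] at this
    exact this.eventually hF
  rw [nhds_prod_eq, eventually_prod_iff] at hloc
  obtain ⟨A, hA, B, hB, hAB⟩ := hloc
  obtain ⟨δ, hδ, hBδ⟩ := Metric.eventually_nhds_iff.1 hB
  have hent := henter (fun t => α (y₀, t)) h00 (by
    have := hder y₀ (Metric.mem_closedBall_self r.2) 0 (by simpa using hε)
    rwa [h00] at this)
  -- One time t serves all nearby starting points: at t the trajectory of y₀ is in O, so by
  -- continuity its neighbours are too, and F is constant on [0, t] along each.
  obtain ⟨t, htO, htδ, ht0⟩ := (hent.and ((eventually_nhdsWithin_of_eventually_nhds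
    (Iio_mem_nhds (lt_min hδ hε))).and self_mem_nhdsWithin)).exists
  replace ht0 : 0 < t := ht0
  replace htδ : t < min δ ε := htδ
  have htO' : ∀ᶠ y in 𝓝 y₀, α (y, t) ∈ O :=
    (((hcont t (by rw [abs_of_pos ht0]; exact htδ.trans_le (min_le_right _ _))).comp
      (f := fun y => (y, t)) (by fun_prop)).eventually (hO.mem_nhds htO))
  filter_upwards [hA, htO', Metric.closedBall_mem_nhds y₀ hr] with y hyA hyO hyr
  have hd : ∀ s ∈ Set.Icc 0 t, HasDerivAt (fun s => F (α (y, s))) 0 s := fun s hs => by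
    have hs' : |s| < ε := by
      rw [abs_of_nonneg hs.1]; exact (hs.2.trans_lt htδ).trans_le (min_le_right _ _)
    obtain ⟨h1, h2⟩ := hAB hyA (hBδ (y := s) (by
      rw [Real.dist_0_eq_abs, abs_of_nonneg hs.1]
      exact (hs.2.trans_lt htδ).trans_le (min_le_left _ _)))
    have := h1.hasFDerivAt.comp_hasDerivAt s (hder y hyr s hs')
    rwa [h2] at this
  have hconst := constant_of_has_deriv_right_zero (a := 0) (b := t)
    (fun s hs => (hd s hs).continuousAt.continuousWithinAt)
    (fun s hs => (hd s (Set.Ico_subset_Icc_self hs)).hasDerivWithinAt) t ⟨ht0.le, le_rfl⟩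
  simp only [(hα y hyr).1] at hconst
  rw [← hconst, hFO _ hyO]

theorem fderiv_apply_eq_sum {n : ℕ} (F : (Fin n → ℝ) → ℝ) (x v : Fin n → ℝ) :
    fderiv ℝ F x v = ∑ i, v i * partialDeriv i F x := by
  conv_lhs => rw [← Finset.univ_sum_single v]
  rw [map_sum]
  refine Finset.sum_congr rfl fun i _ => ?_
  have : Pi.single i (v i) = v i • (Pi.single i 1 : Fin n → ℝ) := by
    rw [← Pi.single_smul]; simp
  rw [this, map_smul, smul_eq_mul, partialDeriv]

theorem fderiv_prod_apply {n m : ℕ} {F : (Fin n → ℝ) × (Fin m → ℝ) → ℝ} {x : Fin n → ℝ}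
    {p : Fin m → ℝ} (hF : DifferentiableAt ℝ F (x, p)) (v : Fin n → ℝ) (w : Fin m → ℝ) :
    fderiv ℝ F (x, p) (v, w) = ∑ i, v i * partialDeriv i (fun y => F (y, p)) x
      + ∑ i, w i * partialDeriv i (fun q => F (x, q)) p := by
  have h1 := (hF.hasFDerivAt.comp (f := fun y => (y, p)) x (hasFDerivAt_prodMk_left x p)).fderiv
  have h2 := (hF.hasFDerivAt.comp (f := fun q => (x, q)) p (hasFDerivAt_prodMk_right x p)).fderiv
  rw [← fderiv_apply_eq_sum, ← fderiv_apply_eq_sum]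
  simp only [Function.comp_def] at h1 h2
  rw [h1, h2]
  simp [← map_add]

theorem differentiableAt_momentumPolynomial {n : ℕ} {U : Set (Fin n → ℝ)} (hU : IsOpen U)
    {a : (Fin n → ℝ) → (Fin 2 → Fin n) → ℝ} (ha : ContDiffOn ℝ ∞ a U) {x : Fin n → ℝ}
    (hx : x ∈ U) (p : Fin n → ℝ) :
    DifferentiableAt ℝ (fun y : (Fin n → ℝ) × (Fin n → ℝ) => momentumPolynomial a y.1 y.2)
      (x, p) := by
  simp only [momentumPolynomial_two]
  refine DifferentiableAt.fun_sum fun j _ => DifferentiableAt.fun_sum fun k _ => ?_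
  have h : DifferentiableAt ℝ (fun y => a y ![j, k]) x :=
    ContDiffOn.differentiableAt_of_isOpen hU ((contDiff_apply ℝ ℝ _).comp_contDiffOn ha) hx
  have h' : DifferentiableAt ℝ
      (fun y : (Fin n → ℝ) × (Fin n → ℝ) => a y.1 ![j, k]) (x, p) :=
    h.comp (f := Prod.fst) (x, p) differentiableAt_fst
  exact h'.mul (by fun_prop)

/-- The vector field of the geodesic flow of the Wils metric. -/
def wilsField (f : ℝ → ℝ) (y : (Fin 4 → ℝ) × (Fin 4 → ℝ)) : (Fin 4 → ℝ) × (Fin 4 → ℝ) :=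
  (wilsVelocity f y.1 y.2, wilsForce f y.1 y.2)

/-- The Poisson bracket with the energy function is the derivative along the geodesic flow. -/
theorem poissonBracket_eq_fderiv {f : ℝ → ℝ} {x : Fin 4 → ℝ} (hx : x 0 ≠ 0)
    (hf : DifferentiableAt ℝ f (x 2)) {I : (Fin 4 → ℝ) → (Fin 4 → ℝ) → ℝ} {p : Fin 4 → ℝ}
    (hI : DifferentiableAt ℝ (fun y : (Fin 4 → ℝ) × (Fin 4 → ℝ) => I y.1 y.2) (x, p)) :
    poissonBracket (hamiltonian (wilsMetric f)) I x p =
      fderiv ℝ (fun y : (Fin 4 → ℝ) × (Fin 4 → ℝ) => I y.1 y.2) (x, p) (wilsField f (x, p)) := by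
  rw [poissonBracket_hamiltonian hx hf, Finset.sum_add_distrib]
  exact (fderiv_prod_apply hI _ _).symm

theorem contDiffAt_wilsField {f : ℝ → ℝ} {W : Set ℝ} (hW : IsOpen W) (hf : ContDiffOn ℝ ∞ f W)
    {x : Fin 4 → ℝ} (hx : x 0 ≠ 0) (hxW : x 2 ∈ W) (p : Fin 4 → ℝ) :
    ContDiffAt ℝ 1 (wilsField f) (x, p) := by
  have h1 : ∀ i, ContDiffAt ℝ 1 (fun y : (Fin 4 → ℝ) × (Fin 4 → ℝ) => y.1 i) (x, p) := fun i =>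
    ((contDiff_apply ℝ ℝ i).comp contDiff_fst).contDiffAt
  have h2 : ∀ i, ContDiffAt ℝ 1 (fun y : (Fin 4 → ℝ) × (Fin 4 → ℝ) => y.2 i) (x, p) := fun i =>
    ((contDiff_apply ℝ ℝ i).comp contDiff_snd).contDiffAt
  have hi : ContDiffAt ℝ 1 (fun y : (Fin 4 → ℝ) × (Fin 4 → ℝ) => (y.1 0)⁻¹) (x, p) :=
    (h1 0).inv hx
  have h3 : ContDiffAt ℝ 1 (fun y : (Fin 4 → ℝ) × (Fin 4 → ℝ) => f (y.1 2)) (x, p) :=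
    ContDiffAt.comp (g := f) (f := fun y : (Fin 4 → ℝ) × (Fin 4 → ℝ) => y.1 2) (x, p)
      ((hf.contDiffAt (hW.mem_nhds hxW)).of_le (by simp)) (h1 2)
  have h4 : ContDiffAt ℝ 1 (fun y : (Fin 4 → ℝ) × (Fin 4 → ℝ) => deriv f (y.1 2)) (x, p) :=
    ContDiffAt.comp (g := deriv f) (f := fun y : (Fin 4 → ℝ) × (Fin 4 → ℝ) => y.1 2) (x, p)
      (((hf.deriv_of_isOpen (m := ∞) hW le_rfl).contDiffAt (hW.mem_nhds hxW)).of_le (by simp))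
      (h1 2)
  have h5 := h3.mul (((h1 0).pow 2).add ((h1 1).pow 2))
  have h6 := (h2 2).sub ((h1 3).mul (h2 0))
  have h7 := ((h2 2).mul (h2 3)).sub ((h1 3).mul ((h2 0).mul (h2 3)))
  have h8 := ((h2 3).pow 2).div_const 2
  refine ContDiffAt.prodMk (contDiffAt_pi.2 fun i => ?_) (contDiffAt_pi.2 fun i => ?_)
  · fin_cases i
    exacts [(h2 0).neg.sub (((h1 3).mul (h2 3)).mul hi), (h2 1).neg, (h2 3).mul hi,
      (h6.sub (h5.mul (h2 3))).mul hi]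
  · fin_cases i
    exacts [((h7.sub (h5.mul h8)).mul (hi.pow 2)).add (h3.mul ((h2 3).pow 2)),
      ((h3.mul (h1 1)).mul ((h2 3).pow 2)).mul hi,
      ((h4.mul (((h1 0).pow 2).add ((h1 1).pow 2))).mul h8).mul hi, ((h2 0).mul (h2 3)).mul hi]

/-- Nondegeneracy of the metric: a geodesic may be launched with any prescribed velocity. -/
theorem exists_wilsVelocity_eq (f : ℝ → ℝ) {x : Fin 4 → ℝ} (hx : x 0 ≠ 0) (w : Fin 4 → ℝ) :
    ∃ p, wilsVelocity f x p = w := by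
  refine ⟨![-w 0 - x 3 * w 2, -w 1, x 0 * w 3 + x 3 * (-w 0 - x 3 * w 2)
    + f (x 2) * (x 0 ^ 2 + x 1 ^ 2) * (w 2 * x 0), w 2 * x 0], ?_⟩
  ext i
  fin_cases i <;> simp [wilsVelocity] <;> field_simp <;> ring

theorem momentumPolynomial_add_sub {n : ℕ} (a : (Fin n → ℝ) → (Fin 2 → Fin n) → ℝ)
    (x p q : Fin n → ℝ) (t : ℝ) :
    momentumPolynomial a x (p + t • q) + momentumPolynomial a x (p - t • q)
      = 2 * momentumPolynomial a x p + 2 * t ^ 2 * momentumPolynomial a x q := by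
  simp only [momentumPolynomial_two, Finset.mul_sum, ← Finset.sum_add_distrib]
  refine Finset.sum_congr rfl fun j _ => Finset.sum_congr rfl fun k _ => ?_
  simp
  ring

open Filter Topology in
-- Parallelogram law: a quadratic form vanishing at p and p ± t q with t ≠ 0 vanishes at q.
theorem momentumPolynomial_eq_zero_of_eventually {n : ℕ} {a : (Fin n → ℝ) → (Fin 2 → Fin n) → ℝ}
    {x p : Fin n → ℝ} (h : ∀ᶠ q in 𝓝 p, momentumPolynomial a x q = 0) (q : Fin n → ℝ) :
    momentumPolynomial a x q = 0 := by
  have h1 : Tendsto (fun t : ℝ => p + t • q) (𝓝 0) (𝓝 p) := by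
    have : Continuous fun t : ℝ => p + t • q := by fun_prop
    simpa using this.tendsto 0
  have h2 : Tendsto (fun t : ℝ => p - t • q) (𝓝 0) (𝓝 p) := by
    have : Continuous fun t : ℝ => p - t • q := by fun_prop
    simpa using this.tendsto 0
  obtain ⟨t, ⟨ht1, ht2⟩, ht0⟩ := ((eventually_nhdsWithin_of_eventually_nhds
    ((h1.eventually h).and (h2.eventually h))).and (self_mem_nhdsWithin (s := {(0 : ℝ)}ᶜ))).exists
  have := momentumPolynomial_add_sub a x p q t
  rw [ht1, ht2, h.self_of_nhds] at this
  have ht : t ≠ 0 := ht0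
  have h3 : 2 * t ^ 2 ≠ 0 := by positivity
  exact (mul_eq_zero.1 (by linarith : 2 * t ^ 2 * momentumPolynomial a x q = 0)).resolve_left h3

open Filter Topology in
-- To first order β(t) is at distance (1 - t)·dist z x from z, and the error is o(t).
theorem eventually_mem_ball_of_hasDerivAt {E : Type*} [NormedAddCommGroup E] [NormedSpace ℝ E]
    {β : ℝ → E} {x z : E} (hxz : x ≠ z) (h0 : β 0 = x) (hβ : HasDerivAt β (z - x) 0) :
    ∀ᶠ t in 𝓝[>] (0 : ℝ), β t ∈ Metric.ball z (dist z x) := by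
  have hρ : 0 < dist z x := dist_pos.2 hxz.symm
  have h1 := (hasDerivAt_iff_isLittleO.1 hβ).def (half_pos hρ)
  filter_upwards [eventually_nhdsWithin_of_eventually_nhds h1, self_mem_nhdsWithin,
    eventually_nhdsWithin_of_eventually_nhds (Iio_mem_nhds (zero_lt_one (α := ℝ)))]
    with t ht h0t ht1
  replace h0t : 0 < t := h0t
  replace ht1 : t < 1 := ht1
  rw [h0, sub_zero, Real.norm_of_nonneg h0t.le] at ht
  rw [Metric.mem_ball, dist_eq_norm]
  have e : β t - z = (β t - x - t • (z - x)) + (1 - t) • (x - z) := by module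
  calc ‖β t - z‖ ≤ ‖β t - x - t • (z - x)‖ + ‖(1 - t) • (x - z)‖ := by rw [e]; exact norm_add_le _ _
    _ ≤ dist z x / 2 * t + (1 - t) * dist z x := by
        rw [norm_smul, Real.norm_of_nonneg (by linarith), ← dist_eq_norm x z, dist_comm x z]
        gcongr
    _ < dist z x := by nlinarith

open Filter Topology in
/-- A Killing 2-tensor of the Wils metric that vanishes near a point vanishes identically. -/
theorem IsKillingTensor.eq_zero_of_eventually {f : ℝ → ℝ} {U : Set (Fin 4 → ℝ)} {W : Set ℝ}
    (hU : IsOpen U) (hUc : IsPreconnected U) (hW : IsOpen W) (hUW : ∀ x ∈ U, x 2 ∈ W)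
    (hx : ∀ x ∈ U, x 0 ≠ 0) (hf : ContDiffOn ℝ ∞ f W) {a : (Fin 4 → ℝ) → (Fin 2 → Fin 4) → ℝ}
    (ha : IsKillingTensor (wilsMetric f) U 2 a) {x₀ : Fin 4 → ℝ} (hx₀ : x₀ ∈ U)
    (h₀ : ∀ᶠ x in 𝓝 x₀, ∀ p, momentumPolynomial a x p = 0) :
    ∀ x ∈ U, ∀ p, momentumPolynomial a x p = 0 := by
  set Z : Set (Fin 4 → ℝ) := interior {x | ∀ p, momentumPolynomial a x p = 0} with hZ
  have hZo : IsOpen Z := isOpen_interior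
  suffices h : U ⊆ Z from fun x hxU => interior_subset (h hxU)
  refine hUc.subset_of_closure_inter_subset hZo ⟨x₀, hx₀, mem_interior_iff_mem_nhds.2 h₀⟩ ?_
  rintro x ⟨hxc, hxU⟩
  by_contra hxZ
  obtain ⟨δ, hδ, hball⟩ := Metric.isOpen_iff.1 hU x hxU
  -- With z within δ/2 of x, a point of the complement of Z nearest to z is within δ of x, hence in
  -- U; the open ball about z through it lies in Z.
  obtain ⟨z, hzZ, hzx⟩ := Metric.mem_closure_iff.1 hxc (δ / 2) (half_pos hδ)
  obtain ⟨y, hyZ, hy⟩ := hZo.isClosed_compl.exists_infDist_eq_dist ⟨x, hxZ⟩ z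
  have hyx : dist z y ≤ dist z x := hy ▸ Metric.infDist_le_dist_of_mem hxZ
  have hyU : y ∈ U := hball (by
    rw [Metric.mem_ball]
    have := dist_triangle y z x
    rw [dist_comm y z] at this
    rw [dist_comm x z] at hzx
    linarith)
  have hsub : Metric.ball z (dist z y) ⊆ Z := fun w hw => by
    by_contra hwZ
    have h1 : Metric.infDist z Zᶜ ≤ dist z w := Metric.infDist_le_dist_of_mem hwZ
    rw [hy, dist_comm z w] at h1
    exact absurd hw (by simpa using h1)
  have hyz : y ≠ z := fun h => hyZ (h ▸ hzZ)
  -- The geodesic from y is aimed at the centre z, so it enters the ball on which the integral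
  -- vanishes.
  obtain ⟨p, hp⟩ := exists_wilsVelocity_eq f (hx y hyU) (z - y)
  have key := eventually_eq_zero_of_trajectory (v := wilsField f)
    (F := fun y => momentumPolynomial a y.1 y.2) (y₀ := (y, p))
    (contDiffAt_wilsField hW hf (hx y hyU) (hUW y hyU) p) (by
      filter_upwards [(hU.prod isOpen_univ).mem_nhds (⟨hyU, trivial⟩ : (y, p) ∈ U ×ˢ Set.univ)]
        with w hw
      have hd := differentiableAt_momentumPolynomial hU ha.1 hw.1 w.2
      refine ⟨hd, ?_⟩
      rw [← ha.2.2 w.1 hw.1 w.2, poissonBracket_eq_fderiv (hx _ hw.1) ((hf.contDiffAt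
        (hW.mem_nhds (hUW _ hw.1))).differentiableAt (by simp)) hd])
    (O := Prod.fst ⁻¹' Metric.ball z (dist z y)) (Metric.isOpen_ball.preimage continuous_fst)
    (fun w hw => interior_subset (hsub hw) w.2) (fun α h0 hα => by
      refine eventually_mem_ball_of_hasDerivAt (β := fun t => (α t).1) hyz (by rw [h0]) ?_
      rw [← hp]
      exact hα.fst)
  refine hyZ (mem_interior_iff_mem_nhds.2 ?_)
  -- The integral vanishes near (y, p) in the cotangent bundle. For each base point near y its
  -- momenta fill an open set, so the whole form is zero there and y is interior, a contradiction.
  rw [nhds_prod_eq] at key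
  filter_upwards [key.curry] with w hw
  exact momentumPolynomial_eq_zero_of_eventually hw

/-! ### Killing tensors built from H and from linear integrals -/

section Tensors

variable {U : Set (Fin 4 → ℝ)} {W : Set ℝ} {f : ℝ → ℝ}

theorem IsKillingTensor.mono {n d : ℕ} {g : (Fin n → ℝ) → Matrix (Fin n) (Fin n) ℝ}
    {U V : Set (Fin n → ℝ)} {a : (Fin n → ℝ) → (Fin d → Fin n) → ℝ} (ha : IsKillingTensor g U d a)
    (hVU : V ⊆ U) : IsKillingTensor g V d a :=
  ⟨ha.1.mono hVU, fun x hx => ha.2.1 x (hVU hx), fun x hx => ha.2.2 x (hVU hx)⟩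

theorem momentumPolynomial_linear {n d : ℕ} (a b : (Fin n → ℝ) → (Fin d → Fin n) → ℝ) (α β : ℝ)
    (x p : Fin n → ℝ) : momentumPolynomial (fun x s => α * a x s + β * b x s) x p
      = α * momentumPolynomial a x p + β * momentumPolynomial b x p := by
  simp [momentumPolynomial, Finset.mul_sum, ← Finset.sum_add_distrib, add_mul, mul_assoc]

theorem IsKillingTensor.linear (hU : IsOpen U) (hW : IsOpen W) (hUW : ∀ x ∈ U, x 2 ∈ W)
    (hx : ∀ x ∈ U, x 0 ≠ 0) (hf : ContDiffOn ℝ ∞ f W)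
    {a b : (Fin 4 → ℝ) → (Fin 2 → Fin 4) → ℝ} (ha : IsKillingTensor (wilsMetric f) U 2 a)
    (hb : IsKillingTensor (wilsMetric f) U 2 b) (α β : ℝ) :
    IsKillingTensor (wilsMetric f) U 2 (fun x s => α * a x s + β * b x s) := by
  refine ⟨contDiffOn_pi.2 fun s => (contDiffOn_const.mul (contDiffOn_pi.1 ha.1 s)).add
    (contDiffOn_const.mul (contDiffOn_pi.1 hb.1 s)), fun x hxU σ s => ?_,
    fun x hxU p => ?_⟩
  · simp only [ha.2.1 x hxU, hb.2.1 x hxU]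
  · have hfx := (hf.contDiffAt (hW.mem_nhds (hUW _ hxU))).differentiableAt (by simp)
    have h1 := differentiableAt_momentumPolynomial hU ha.1 hxU p
    have h2 := differentiableAt_momentumPolynomial hU hb.1 hxU p
    have e1 := ha.2.2 x hxU p
    have e2 := hb.2.2 x hxU p
    have e : momentumPolynomial (fun x s => α * a x s + β * b x s)
        = fun x p => α * momentumPolynomial a x p + β * momentumPolynomial b x p :=
      funext fun x => funext fun p => momentumPolynomial_linear a b α β x p
    rw [poissonBracket_eq_fderiv (hx x hxU) hfx h1] at e1
    rw [poissonBracket_eq_fderiv (hx x hxU) hfx h2] at e2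
    rw [e, poissonBracket_eq_fderiv (hx x hxU) hfx ((h1.const_mul α).add (h2.const_mul β)),
      fderiv_fun_add (h1.const_mul α) (h2.const_mul β), fderiv_const_mul h1, fderiv_const_mul h2]
    simp [e1, e2]

/-- The contravariant tensor `½ gⁱʲ` of the energy function. -/
def energyTensor {n : ℕ} (g : (Fin n → ℝ) → Matrix (Fin n) (Fin n) ℝ) (x : Fin n → ℝ)
    (s : Fin 2 → Fin n) : ℝ :=
  1 / 2 * (g x)⁻¹ (s 0) (s 1)

theorem momentumPolynomial_energyTensor {n : ℕ} (g : (Fin n → ℝ) → Matrix (Fin n) (Fin n) ℝ) :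
    momentumPolynomial (energyTensor g) = hamiltonian g := by
  ext x p
  rw [momentumPolynomial_two]
  simp only [energyTensor, hamiltonian, dotProduct, Matrix.mulVec, Finset.mul_sum]
  refine Finset.sum_congr rfl fun j _ => Finset.sum_congr rfl fun k _ => ?_
  simp
  ring

theorem poissonBracket_self {n : ℕ} (F : (Fin n → ℝ) → (Fin n → ℝ) → ℝ) (x p : Fin n → ℝ) :
    poissonBracket F F x p = 0 :=
  Finset.sum_eq_zero fun i _ => by ring

theorem comp_perm_two {n : ℕ} {M : Fin n → Fin n → ℝ} (hM : ∀ i j, M i j = M j i)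
    (σ : Equiv.Perm (Fin 2)) (s : Fin 2 → Fin n) :
    M ((s ∘ σ) 0) ((s ∘ σ) 1) = M (s 0) (s 1) := by
  rcases Fin.exists_fin_two.1 ⟨σ 0, rfl⟩ with h | h
  · have h1 : σ 1 = 1 := by
      have : σ 1 ≠ σ 0 := σ.injective.ne (by decide)
      omega
    rw [Function.comp_apply, Function.comp_apply, h, h1]
  · have h1 : σ 1 = 0 := by
      have : σ 1 ≠ σ 0 := σ.injective.ne (by decide)
      omega
    rw [Function.comp_apply, Function.comp_apply, h, h1, hM]

theorem isKillingTensor_energyTensor (hUW : ∀ x ∈ U, x 2 ∈ W) (hx : ∀ x ∈ U, x 0 ≠ 0)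
    (hf : ContDiffOn ℝ ∞ f W) :
    IsKillingTensor (wilsMetric f) U 2 (energyTensor (wilsMetric f)) := by
  refine ⟨contDiffOn_pi.2 fun s => ?_, fun x hxU σ s => ?_, fun x hxU p => ?_⟩
  · have hc : ∀ j, ContDiffOn ℝ ∞ (fun x : Fin 4 → ℝ => x j) U := fun j =>
      (contDiff_apply ℝ ℝ j).contDiffOn
    have hfc : ContDiffOn ℝ ∞ (fun x : Fin 4 → ℝ => f (x 2)) U := contDiffOn_comp_coord hUW hf
    refine (contDiffOn_const (c := (1 / 2 : ℝ))).mul ?_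
    have h1 := (hc 3).neg.div (hc 0) hx
    have h2 := (contDiffOn_const (c := (1 : ℝ))).div (hc 0) hx
    have h3 := (hfc.mul (((hc 0).pow 2).add ((hc 1).pow 2))).neg.div (hc 0) hx
    refine ContDiffOn.congr (f := fun x => (!![-1, 0, 0, -x 3 / x 0;
      0, -1, 0, 0;
      0, 0, 0, 1 / x 0;
      -x 3 / x 0, 0, 1 / x 0, -(f (x 2) * (x 0 ^ 2 + x 1 ^ 2)) / x 0] :
        Matrix (Fin 4) (Fin 4) ℝ) (s 0) (s 1)) ?_ fun x hxU => by rw [wilsMetric_inv f (hx x hxU)]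
    generalize s 0 = i
    generalize s 1 = j
    fin_cases i <;> fin_cases j <;> first
      | exact contDiffOn_const
      | exact h1
      | exact h2
      | exact h3
  · unfold energyTensor
    refine congrArg _ (comp_perm_two (M := fun i j => (wilsMetric f x)⁻¹ i j) (fun i j => ?_) σ s)
    rw [wilsMetric_inv f (hx x hxU)]
    fin_cases i <;> fin_cases j <;> rfl
  · rw [momentumPolynomial_energyTensor]
    exact poissonBracket_self _ x p

/-- The symmetric square of a vector field. -/
def squareTensor {n : ℕ} (X : (Fin n → ℝ) → (Fin n → ℝ)) (x : Fin n → ℝ) (s : Fin 2 → Fin n) : ℝ :=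
  X x (s 0) * X x (s 1)

theorem momentumPolynomial_squareTensor {n : ℕ} (X : (Fin n → ℝ) → (Fin n → ℝ)) :
    momentumPolynomial (squareTensor X) = fun x p => linearIntegral X x p ^ 2 := by
  ext x p
  rw [momentumPolynomial_two, linearIntegral, sq, Finset.sum_mul_sum]
  refine Finset.sum_congr rfl fun j _ => Finset.sum_congr rfl fun k _ => ?_
  simp [squareTensor]
  ring

theorem differentiableAt_linearIntegral {n : ℕ} {X : (Fin n → ℝ) → (Fin n → ℝ)} {x : Fin n → ℝ}
    (hX : DifferentiableAt ℝ X x) (p : Fin n → ℝ) :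
    DifferentiableAt ℝ (fun y : (Fin n → ℝ) × (Fin n → ℝ) => linearIntegral X y.1 y.2) (x, p) := by
  unfold linearIntegral
  refine DifferentiableAt.fun_sum fun i _ => ?_
  have h : DifferentiableAt ℝ (fun y : (Fin n → ℝ) × (Fin n → ℝ) => X y.1 i) (x, p) :=
    (differentiableAt_pi.1 hX i).comp (f := Prod.fst) (x, p) differentiableAt_fst
  exact h.mul (by fun_prop)

theorem isKillingTensor_squareTensor (hU : IsOpen U) (hW : IsOpen W) (hUW : ∀ x ∈ U, x 2 ∈ W)
    (hx : ∀ x ∈ U, x 0 ≠ 0) (hf : ContDiffOn ℝ ∞ f W) {X : (Fin 4 → ℝ) → (Fin 4 → ℝ)}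
    (hX : ContDiffOn ℝ ∞ X U)
    (hI : ∀ x ∈ U, ∀ p, poissonBracket (hamiltonian (wilsMetric f)) (linearIntegral X) x p = 0) :
    IsKillingTensor (wilsMetric f) U 2 (squareTensor X) := by
  refine ⟨contDiffOn_pi.2 fun s => ?_, fun x hxU σ s => ?_, fun x hxU p => ?_⟩
  · exact (contDiffOn_pi.1 hX (s 0)).mul (contDiffOn_pi.1 hX (s 1))
  · exact comp_perm_two (M := fun i j => X x i * X x j) (fun i j => mul_comm _ _) σ s
  · have hfx := (hf.contDiffAt (hW.mem_nhds (hUW _ hxU))).differentiableAt (by simp)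
    have h1 := differentiableAt_linearIntegral
      ((hX.contDiffAt (hU.mem_nhds hxU)).differentiableAt (by simp)) p
    have e1 := hI x hxU p
    rw [poissonBracket_eq_fderiv (hx x hxU) hfx h1] at e1
    rw [momentumPolynomial_squareTensor, poissonBracket_eq_fderiv (hx x hxU) hfx (h1.pow 2),
      fderiv_fun_pow 2 h1]
    simp [e1]

theorem momentumPolynomial_one {n : ℕ} (X : (Fin n → ℝ) → (Fin n → ℝ)) :
    momentumPolynomial (d := 1) (fun x s => X x (s 0)) = linearIntegral X := by
  ext x p
  unfold momentumPolynomial linearIntegral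
  rw [← (Equiv.funUnique (Fin 1) (Fin n)).symm.sum_comp]
  simp

theorem isPolynomialIntegral_linearIntegral {n : ℕ}
    {g : (Fin n → ℝ) → Matrix (Fin n) (Fin n) ℝ} {U : Set (Fin n → ℝ)}
    {X : (Fin n → ℝ) → (Fin n → ℝ)} (hX : ContDiffOn ℝ ∞ X U)
    (hI : ∀ x ∈ U, ∀ p, poissonBracket (hamiltonian g) (linearIntegral X) x p = 0) :
    IsPolynomialIntegral g U 1 (linearIntegral X) :=
  ⟨fun x s => X x (s 0), ⟨contDiffOn_pi.2 fun s => contDiffOn_pi.1 hX (s 0),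
    fun x _ σ s => by simp [Subsingleton.elim (σ 0) 0], by rwa [momentumPolynomial_one]⟩,
    fun x _ p => by rw [momentumPolynomial_one]⟩

/-- On the (p₀, p₁)-plane H is -(p₀² + p₁²)/2, of rank two, so k = 0; then every component of X
squares to zero. -/
theorem eq_zero_of_linearIntegral_sq {x : Fin 4 → ℝ} (hx : x 0 ≠ 0)
    {X : (Fin 4 → ℝ) → (Fin 4 → ℝ)} {k : ℝ}
    (h : ∀ p, linearIntegral X x p ^ 2 = k * hamiltonian (wilsMetric f) x p) : X x = 0 := by
  simp only [linearIntegral, hamiltonian_wilsMetric f hx, Fin.sum_univ_four] at h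
  have h2 : X x 2 = 0 := by simpa using h ![0, 0, 1, 0]
  have h0 := h ![1, 0, 0, 0]
  have h1 := h ![0, 1, 0, 0]
  have h01 := h ![1, 1, 0, 0]
  have h3 := h ![0, 0, 0, 1]
  simp at h0 h1 h01 h3
  have hk : k = 0 := by
    have h5 : X x 0 * X x 1 = 0 := by linear_combination (h01 - h0 - h1) / 2
    have h6 : k ^ 2 = 0 := by
      linear_combination 4 * X x 0 * X x 1 * h5 - 4 * X x 0 ^ 2 * h1 + 2 * k * h0
    simpa using h6
  subst hk
  simp at h0 h1 h3
  ext i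
  fin_cases i <;> assumption

end Tensors

/-! ### Killing vectors and linear integrals -/

section Vectors

variable {U : Set (Fin 4 → ℝ)} {f : ℝ → ℝ}

theorem partialDeriv_const {n : ℕ} (i : Fin n) (c : ℝ) (x : Fin n → ℝ) :
    partialDeriv i (fun _ => c) x = 0 := by
  simp [partialDeriv]

theorem _root_.HasFDerivAt.partialDeriv {n : ℕ} {F : (Fin n → ℝ) → ℝ} {x : Fin n → ℝ}
    {L : (Fin n → ℝ) →L[ℝ] ℝ} (h : HasFDerivAt F L x) (i : Fin n) :
    partialDeriv i F x = L (Pi.single i 1) := by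
  rw [KillingWils.partialDeriv, h.fderiv]

/-- The derivative of the matrix of the Wils metric in the direction of the `k`-th coordinate. -/
def wilsMetricDeriv (f : ℝ → ℝ) (x : Fin 4 → ℝ) (k : Fin 4) : Matrix (Fin 4) (Fin 4) ℝ :=
  !![0, 0, -(if k = 3 then 1 else 0), 0;
     0, 0, 0, 0;
     -(if k = 3 then 1 else 0), 0, ![f (x 2) * (3 * x 0 ^ 2 + x 1 ^ 2), 2 * f (x 2) * x 0 * x 1,
        deriv f (x 2) * x 0 * (x 0 ^ 2 + x 1 ^ 2), -2 * x 3] k, (if k = 0 then 1 else 0);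
     0, 0, (if k = 0 then 1 else 0), 0]

theorem partialDeriv_wilsMetric {x : Fin 4 → ℝ} (hf : DifferentiableAt ℝ f (x 2))
    (k i j : Fin 4) :
    partialDeriv k (fun y => wilsMetric f y i j) x = wilsMetricDeriv f x k i j := by
  have hc := fun j => hasFDerivAt_coord j x
  have h3 : partialDeriv k (fun y => -y 3) x = -(if k = 3 then 1 else 0) := by
    rw [← partialDeriv_coord k 3 x]
    simp [partialDeriv]
  have h22 : partialDeriv k (fun y => f (y 2) * y 0 * (y 0 ^ 2 + y 1 ^ 2) - y 3 ^ 2) x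
      = wilsMetricDeriv f x k 2 2 := by
    have hfx : HasFDerivAt (fun y : Fin 4 → ℝ => f (y 2)) _ x :=
      hf.hasDerivAt.comp_hasFDerivAt x (hc 2)
    have h := ((hfx.mul (hc 0)).mul (((hc 0).pow 2).add ((hc 1).pow 2))).sub ((hc 3).pow 2)
    refine (h.partialDeriv k).trans ?_
    fin_cases k <;> simp [wilsMetricDeriv] <;> ring
  fin_cases i <;> fin_cases j <;> first
    | exact partialDeriv_const k _ x
    | exact h3
    | exact h22
    | exact partialDeriv_coord k 0 x

theorem wilsMetric_symm (f : ℝ → ℝ) (x : Fin 4 → ℝ) (i j : Fin 4) :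
    wilsMetric f x i j = wilsMetric f x j i := by
  fin_cases i <;> fin_cases j <;> rfl

theorem sum_wilsMetric_mul_wilsVelocity {x : Fin 4 → ℝ} (hx : x 0 ≠ 0) (p : Fin 4 → ℝ)
    (k : Fin 4) : ∑ j, wilsMetric f x k j * wilsVelocity f x p j = p k := by
  fin_cases k <;> simp [wilsMetric, wilsVelocity, Fin.sum_univ_four] <;> field_simp <;> ring

theorem sum_wilsMetricDeriv_mul_wilsVelocity {x : Fin 4 → ℝ} (hx : x 0 ≠ 0) (p : Fin 4 → ℝ)
    (k : Fin 4) : ∑ i, ∑ j, wilsVelocity f x p i * wilsVelocity f x p j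
      * wilsMetricDeriv f x k i j = 2 * wilsForce f x p k := by
  fin_cases k <;> simp [wilsMetricDeriv, wilsVelocity, wilsForce, Fin.sum_univ_four] <;>
    field_simp <;> ring

theorem partialDeriv_linearIntegral_momentum {n : ℕ} (X : (Fin n → ℝ) → (Fin n → ℝ))
    (x p : Fin n → ℝ) (i : Fin n) :
    partialDeriv i (fun q => linearIntegral X x q) p = X x i := by
  have h : HasFDerivAt (fun q : Fin n → ℝ => ∑ j, X x j * q j) _ p :=
    HasFDerivAt.fun_sum fun j _ => (hasFDerivAt_coord j p).const_mul (X x j)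
  unfold partialDeriv linearIntegral
  rw [h.fderiv]
  simp [Pi.single_apply]

theorem partialDeriv_linearIntegral_position {n : ℕ} {X : (Fin n → ℝ) → (Fin n → ℝ)}
    {x : Fin n → ℝ} (hX : DifferentiableAt ℝ X x) (p : Fin n → ℝ) (i : Fin n) :
    partialDeriv i (fun y => linearIntegral X y p) x
      = ∑ k, partialDeriv i (fun y => X y k) x * p k := by
  have h : HasFDerivAt (fun y : Fin n → ℝ => ∑ j, X y j * p j) _ x :=
    HasFDerivAt.fun_sum fun j _ => (differentiableAt_pi.1 hX j).hasFDerivAt.mul_const (p j)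
  unfold partialDeriv linearIntegral
  rw [h.fderiv]
  simp [mul_comm]

/-- The Killing equation is contracted twice with the velocity v = ∂H/∂p. As g v = p and vⁱvʲ ∂ₖgᵢⱼ
= -2 ∂H/∂xᵏ, the result is twice the bracket. -/
theorem IsKillingVector.poissonBracket_eq_zero {W : Set ℝ} (hU : IsOpen U) (hW : IsOpen W)
    (hUW : ∀ x ∈ U, x 2 ∈ W) (hx : ∀ x ∈ U, x 0 ≠ 0) (hf : ContDiffOn ℝ ∞ f W)
    {X : (Fin 4 → ℝ) → (Fin 4 → ℝ)} (hX : IsKillingVector (wilsMetric f) U X)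
    {x : Fin 4 → ℝ} (hxU : x ∈ U) (p : Fin 4 → ℝ) :
    poissonBracket (hamiltonian (wilsMetric f)) (linearIntegral X) x p = 0 := by
  have hfx : DifferentiableAt ℝ f (x 2) :=
    (hf.contDiffAt (hW.mem_nhds (hUW _ hxU))).differentiableAt (by simp)
  rw [poissonBracket_hamiltonian (hx x hxU) hfx]
  simp only [partialDeriv_linearIntegral_momentum, partialDeriv_linearIntegral_position
    ((hX.1.contDiffAt (hU.mem_nhds hxU)).differentiableAt (by simp))]
  have h := hX.2 x hxU
  simp only [partialDeriv_wilsMetric hfx] at h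
  have hp := sum_wilsMetric_mul_wilsVelocity (f := f) (hx x hxU) p
  have hF := sum_wilsMetricDeriv_mul_wilsVelocity (f := f) (hx x hxU) p
  have hs := wilsMetric_symm f x
  set v := wilsVelocity f x p
  set F := wilsForce f x p
  set d : Fin 4 → Fin 4 → ℝ := fun i k => partialDeriv i (fun y => X y k) x
  generalize wilsMetric f x = g at *
  generalize wilsMetricDeriv f x = g' at *
  change ∀ i j, ∑ k, (X x k * g' k i j + g k j * d i k + g i k * d j k) = 0 at h
  change ∑ i, (v i * ∑ k, d i k * p k + F i * X x i) = 0
  have e : ∑ i, ∑ j, v i * v j * ∑ k, (X x k * g' k i j + g k j * d i k + g i k * d j k) = 0 := by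
    simp [h]
  have e1 : ∑ i, ∑ j, v i * v j * ∑ k, X x k * g' k i j = 2 * ∑ k, F k * X x k := by
    simp only [Finset.mul_sum]
    rw [Finset.sum_congr rfl fun i _ => Finset.sum_comm, Finset.sum_comm]
    refine Finset.sum_congr rfl fun k _ => ?_
    rw [← mul_assoc, ← hF, Finset.sum_mul]
    refine Finset.sum_congr rfl fun i _ => ?_
    rw [Finset.sum_mul]
    exact Finset.sum_congr rfl fun j _ => by ring
  have e2 : ∑ i, ∑ j, v i * v j * ∑ k, g k j * d i k = ∑ i, v i * ∑ k, d i k * p k := by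
    refine Finset.sum_congr rfl fun i _ => ?_
    simp only [Finset.mul_sum]
    rw [Finset.sum_comm]
    refine Finset.sum_congr rfl fun k _ => ?_
    rw [← hp, Finset.mul_sum, Finset.mul_sum]
    exact Finset.sum_congr rfl fun j _ => by ring
  have e3 : ∑ i, ∑ j, v i * v j * ∑ k, g i k * d j k = ∑ i, v i * ∑ k, d i k * p k := by
    rw [← e2, Finset.sum_comm]
    refine Finset.sum_congr rfl fun i _ => Finset.sum_congr rfl fun j _ => ?_
    simp only [hs j]
    ring
  simp only [Finset.sum_add_distrib, mul_add] at e
  rw [e1, e2, e3] at e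
  rw [Finset.sum_add_distrib]
  linarith

theorem contDiff_wilsVector (c₀ c₁ c₂ : ℝ) : ContDiff ℝ ∞ (wilsVector c₀ c₁ c₂) := by
  have h : ∀ j, ContDiff ℝ ∞ (fun x : Fin 4 → ℝ => x j) := fun j => contDiff_apply ℝ ℝ j
  refine contDiff_pi.2 fun i => ?_
  have h0 := h 0
  have h2 := h 2
  have h3 := h 3
  fin_cases i
  · exact contDiff_const
  · exact contDiff_const
  · exact (contDiff_const.add (contDiff_const.mul h2)).add (contDiff_const.mul (h2.pow 2))
  · exact (((contDiff_const.mul h0).add (contDiff_const.mul h3)).add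
      ((contDiff_const.mul h2).mul h3)).neg

theorem partialDeriv_wilsVector (c₀ c₁ c₂ : ℝ) (x : Fin 4 → ℝ) (i k : Fin 4) :
    partialDeriv i (fun y => wilsVector c₀ c₁ c₂ y k) x =
      (!![0, 0, 0, -2 * c₂;
          0, 0, 0, 0;
          0, 0, c₁ + 2 * c₂ * x 2, -2 * c₂ * x 3;
          0, 0, 0, -(c₁ + 2 * c₂ * x 2)] : Matrix (Fin 4) (Fin 4) ℝ) i k := by
  have hc := fun j => hasFDerivAt_coord j x
  have h2 := (((hc 2).const_mul c₁).const_add c₀).add (((hc 2).pow 2).const_mul c₂)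
  have h3 := ((((hc 0).const_mul (2 * c₂)).add ((hc 3).const_mul c₁)).add
    (((hc 2).const_mul (2 * c₂)).mul (hc 3))).neg
  fin_cases k
  · fin_cases i <;> exact partialDeriv_const _ 0 x
  · fin_cases i <;> exact partialDeriv_const _ 0 x
  · refine (h2.partialDeriv i).trans ?_
    fin_cases i <;> simp
    ring
  · refine (h3.partialDeriv i).trans ?_
    fin_cases i <;> simp
    ring

theorem isKillingVector_wilsVector {W : Set ℝ} (hW : IsOpen W)
    (hUW : ∀ x ∈ U, x 2 ∈ W) {ε c₀ c₁ c₂ : ℝ} (hf : DifferentiableOn ℝ f W)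
    (h : HasWilsForm f W ε c₀ c₁ c₂) :
    IsKillingVector (wilsMetric f) U (wilsVector c₀ c₁ c₂) := by
  refine ⟨(contDiff_wilsVector c₀ c₁ c₂).contDiffOn, fun x hxU i j => ?_⟩
  have hn := hW.mem_nhds (hUW x hxU)
  have hfx := hf.differentiableAt hn
  obtain ⟨hQ, hfQ⟩ := h.2 _ (hUW x hxU)
  -- The derivative of f Q² = ε, divided by Q; only the (du)² component of the Killing equation
  -- needs it.
  have hd : deriv f (x 2) * (c₀ + c₁ * x 2 + c₂ * x 2 ^ 2)
      + 2 * f (x 2) * (c₁ + 2 * c₂ * x 2) = 0 := by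
    have hq : HasDerivAt (fun u => c₀ + c₁ * u + c₂ * u ^ 2) (c₁ + 2 * c₂ * x 2) (x 2) := by
      have := (((hasDerivAt_id (x 2)).const_mul c₁).const_add c₀).add
        ((hasDerivAt_pow 2 (x 2)).const_mul c₂)
      convert! this using 1
      simp
      ring
    have h1 := hfx.hasDerivAt.mul (hq.pow 2)
    have h2 : HasDerivAt (fun u => f u * (c₀ + c₁ * u + c₂ * u ^ 2) ^ 2) 0 (x 2) :=
      (hasDerivAt_const (x 2) ε).congr_of_eventuallyEq (by
        filter_upwards [hn] with u hu
        rw [(h.2 u hu).2, div_mul_cancel₀ _ (pow_ne_zero 2 (h.2 u hu).1)])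
    have h3 := h1.unique h2
    refine mul_left_cancel₀ hQ ?_
    rw [mul_zero, ← h3]
    simp
    ring
  simp only [partialDeriv_wilsMetric hfx, partialDeriv_wilsVector]
  fin_cases i <;> fin_cases j <;>
    simp [wilsMetricDeriv, wilsMetric, wilsVector, Fin.sum_univ_four] <;> try ring1
  linear_combination x 0 * (x 0 ^ 2 + x 1 ^ 2) * hd

theorem linearIntegral_wilsVector (c₀ c₁ c₂ : ℝ) (x p : Fin 4 → ℝ) :
    linearIntegral (wilsVector c₀ c₁ c₂) x p = (c₀ + c₁ * x 2 + c₂ * x 2 ^ 2) * p 2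
      - ((c₁ + 2 * c₂ * x 2) * x 3 + 2 * c₂ * x 0) * p 3 := by
  simp [linearIntegral, wilsVector, Fin.sum_univ_four]
  ring

end Vectors

theorem exists_quadratic_of_deriv_three_eq_zero {s : Set ℝ} (hs : IsOpen s) (hsc : IsPreconnected s)
    {P : ℝ → ℝ} (hP : ContDiffOn ℝ ∞ P s) (h : ∀ u ∈ s, deriv (deriv (deriv P)) u = 0) :
    ∃ c₀ c₁ c₂ : ℝ, ∀ u ∈ s, P u = c₀ + c₁ * u + c₂ * u ^ 2 := by
  have hP1 := hP.deriv_of_isOpen (m := ∞) hs le_rfl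
  have hP2 := hP1.deriv_of_isOpen (m := ∞) hs le_rfl
  have hd : ∀ {F : ℝ → ℝ}, ContDiffOn ℝ ∞ F s → ∀ u ∈ s, HasDerivAt F (deriv F u) u :=
    fun hF u hu => ((hF.contDiffAt (hs.mem_nhds hu)).differentiableAt (by simp)).hasDerivAt
  have hconst : ∀ {F : ℝ → ℝ}, (∀ u ∈ s, HasDerivAt F 0 u) → ∃ c, ∀ u ∈ s, F u = c := fun hF =>
    hs.exists_is_const_of_deriv_eq_zero hsc
      (fun u hu => (hF u hu).differentiableAt.differentiableWithinAt) fun u hu => (hF u hu).deriv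
  obtain ⟨c, hc⟩ := hconst fun u hu => h u hu ▸ hd hP2 u hu
  obtain ⟨b, hb⟩ := hconst (F := fun u => deriv P u - c * u) fun u hu => by
    have := (hd hP1 u hu).sub ((hasDerivAt_id u).const_mul c)
    rwa [hc u hu, mul_one, sub_self] at this
  obtain ⟨a, ha⟩ := hconst (F := fun u => P u - (b * u + c / 2 * u ^ 2)) fun u hu => by
    have := (hd hP u hu).sub (((hasDerivAt_id u).const_mul b).add
      ((hasDerivAt_pow 2 u).const_mul (c / 2)))
    convert! this using 1
    have := hb u hu
    simp
    linarith
  exact ⟨a, b, c / 2, fun u hu => by linarith [ha u hu]⟩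

open Filter Topology in
-- Both sides are polynomials in t, and a neighbourhood is infinite.
theorem eq_quadratic_of_eventually {α β a₀ a₁ a₂ b₀ b₁ b₂ : ℝ} {u : ℝ}
    (h : ∀ᶠ t in 𝓝 u, α * (a₀ + a₁ * t + a₂ * t ^ 2) ^ 2 = β * (b₀ + b₁ * t + b₂ * t ^ 2) ^ 2)
    (t : ℝ) : α * (a₀ + a₁ * t + a₂ * t ^ 2) ^ 2 = β * (b₀ + b₁ * t + b₂ * t ^ 2) ^ 2 := by
  open Polynomial in
  have key : (C α * (C a₀ + C a₁ * X + C a₂ * X ^ 2) ^ 2 : ℝ[X])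
      = C β * (C b₀ + C b₁ * X + C b₂ * X ^ 2) ^ 2 := by
    refine Polynomial.eq_of_infinite_eval_eq _ _ ((infinite_of_mem_nhds u h).mono fun t ht => ?_)
    simpa using ht
  simpa using congrArg (Polynomial.eval t) key

/-! ### Local form of f, its continuation, and the quadratic integrals -/

section Main

variable {U : Set (Fin 4 → ℝ)} {W : Set ℝ} {f : ℝ → ℝ}

open Filter Topology in
/-- A nontrivial Killing 2-tensor forces `f` to be the inverse square of a quadratic polynomial
near every point where it does not vanish. -/
theorem exists_local_form (hU : IsOpen U) (hUc : IsPreconnected U) (hW : IsOpen W)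
    (hUW : ∀ x ∈ U, x 2 ∈ W) (hx : ∀ x ∈ U, x 0 ≠ 0) (hf : ContDiffOn ℝ ∞ f W)
    {a : (Fin 4 → ℝ) → (Fin 2 → Fin 4) → ℝ} (ha : IsKillingTensor (wilsMetric f) U 2 a)
    (hna : ¬ ∃ k : ℝ, ∀ x ∈ U, ∀ p, momentumPolynomial a x p = k * hamiltonian (wilsMetric f) x p)
    {x : Fin 4 → ℝ} (hxU : x ∈ U) (hfx : f (x 2) ≠ 0) :
    ∃ ε c₀ c₁ c₂ : ℝ, (ε = 1 ∨ ε = -1) ∧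
      ∀ᶠ t in 𝓝 (x 2), f t * (c₀ + c₁ * t + c₂ * t ^ 2) ^ 2 = ε := by
  obtain ⟨ε, hε, hεf⟩ : ∃ ε : ℝ, (ε = 1 ∨ ε = -1) ∧ 0 < ε * f (x 2) := by
    rcases hfx.lt_or_gt with h | h
    · exact ⟨-1, Or.inr rfl, by linarith⟩
    · exact ⟨1, Or.inl rfl, by linarith⟩
  have hεε : ε * ε = 1 := by rcases hε with rfl | rfl <;> norm_num
  have hW' : ∀ᶠ t in 𝓝 (x 2), t ∈ W ∧ 0 < ε * f t :=
    Filter.Eventually.and (hW.mem_nhds (hUW x hxU)) ((continuousAt_const.mul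
      (hf.continuousOn.continuousAt (hW.mem_nhds (hUW x hxU)))).eventually (lt_mem_nhds hεf))
  obtain ⟨δ, hδ, hWδ⟩ := Metric.eventually_nhds_iff_ball.1 hW'
  obtain ⟨δ', hδ', hUδ⟩ := Metric.isOpen_iff.1 hU x hxU
  set W' := Metric.ball (x 2) (min δ δ')
  have hW'' : ∀ t ∈ W', t ∈ W ∧ 0 < ε * f t := fun t ht =>
    hWδ t (Metric.ball_subset_ball (min_le_left _ _) ht)
  set V := Metric.ball x (min δ δ') with hV
  have hVU : V ⊆ U := (Metric.ball_subset_ball (min_le_right _ _)).trans hUδ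
  have hf' : ContDiffOn ℝ ∞ f W' := hf.mono fun t ht => (hW'' t ht).1
  set P : ℝ → ℝ := fun t => (√(ε * f t))⁻¹
  have hP : ContDiffOn ℝ ∞ P W' :=
    ((contDiffOn_const.mul hf').sqrt fun t ht => (hW'' t ht).2.ne').inv fun t ht =>
      (Real.sqrt_pos.2 (hW'' t ht).2).ne'
  have hfP : ∀ t ∈ W', f t * P t ^ 2 = ε := fun t ht => by
    have h := (hW'' t ht).2
    simp only [P]
    rw [inv_pow, Real.sq_sqrt h.le, ← div_eq_mul_inv, div_eq_iff h.ne']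
    linear_combination -hεε * f t
  have hVW : ∀ y ∈ V, y 2 ∈ W' := fun y hy =>
    (dist_le_pi_dist y x 2).trans_lt hy
  obtain ⟨k, l, hk, hkl⟩ := momentumPolynomial_eq_of_root Metric.isOpen_ball
    (convex_ball x _).isPreconnected Metric.isOpen_ball hVW (fun y hy => hx y (hVU hy)) hf' hP hεε
    hfP (ha.mono hVU)
  -- If k = 0, the tensor agrees with a multiple of H on the ball, hence on all of U by unique
  -- continuation.
  have hk0 : k ≠ 0 := fun hk0 => hna ⟨l, fun y hy p => by
    have h := (ha.linear hU hW hUW hx hf (isKillingTensor_energyTensor hUW hx hf) 1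
      (-l)).eq_zero_of_eventually hU hUc hW hUW hx hf hxU (by
        filter_upwards [Metric.ball_mem_nhds x (lt_min hδ hδ')] with z hz p
        rw [momentumPolynomial_linear, momentumPolynomial_energyTensor, hkl z hz, hk0]
        ring) y hy p
    rw [momentumPolynomial_linear, momentumPolynomial_energyTensor] at h
    linarith⟩
  obtain ⟨c₀, c₁, c₂, hc⟩ := exists_quadratic_of_deriv_three_eq_zero Metric.isOpen_ball
    (convex_ball (x 2) _).isPreconnected hP fun t ht => by
      -- In the sup metric every t in the interval is the third coordinate of a point of the ball,
      -- so P''' = 0 on the whole interval.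
      have h : Function.update x 2 t ∈ V := by
        rw [hV, Metric.mem_ball, dist_pi_lt_iff (lt_min hδ hδ')]
        intro i
        by_cases hi : i = 2
        · subst hi; simpa using ht
        · simpa [hi] using lt_min hδ hδ'
      simpa [hk0] using hk _ h
  refine ⟨ε, c₀, c₁, c₂, hε, ?_⟩
  filter_upwards [Metric.ball_mem_nhds (x 2) (lt_min hδ hδ')] with t ht
  rw [← hc t ht, hfP t ht]

open Filter Topology in
theorem exists_hasWilsForm (hU : IsOpen U) (hUc : IsConnected U) (hx : ∀ x ∈ U, x 0 ≠ 0)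
    (hW : IsOpen ((fun x : Fin 4 → ℝ => x 2) '' U))
    (hf : ContDiffOn ℝ ∞ f ((fun x : Fin 4 → ℝ => x 2) '' U)) (hf0 : ∃ x ∈ U, f (x 2) ≠ 0)
    {a : (Fin 4 → ℝ) → (Fin 2 → Fin 4) → ℝ} (ha : IsKillingTensor (wilsMetric f) U 2 a)
    (hna : ¬ ∃ k : ℝ, ∀ x ∈ U, ∀ p, momentumPolynomial a x p = k * hamiltonian (wilsMetric f) x p) :
    ∃ ε c₀ c₁ c₂ : ℝ, HasWilsForm f ((fun x : Fin 4 → ℝ => x 2) '' U) ε c₀ c₁ c₂ := by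
  have hUW : ∀ x ∈ U, x 2 ∈ (fun x : Fin 4 → ℝ => x 2) '' U := fun x hxU => ⟨x, hxU, rfl⟩
  obtain ⟨x₀, hx₀, hfx₀⟩ := hf0
  obtain ⟨ε, c₀, c₁, c₂, hε, h₀⟩ :=
    exists_local_form hU hUc.isPreconnected hW hUW hx hf ha hna hx₀ hfx₀
  have hne : ∀ {e : ℝ}, e = 1 ∨ e = -1 → e ≠ 0 := by rintro e (rfl | rfl) <;> norm_num
  have hWc : IsPreconnected ((fun x : Fin 4 → ℝ => x 2) '' U) :=
    hUc.isPreconnected.image _ (continuous_apply 2).continuousOn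
  set S : Set ℝ := interior {t | f t * (c₀ + c₁ * t + c₂ * t ^ 2) ^ 2 = ε}
  have hSmem : ∀ t ∈ S, f t * (c₀ + c₁ * t + c₂ * t ^ 2) ^ 2 = ε := fun t ht =>
    interior_subset (s := {t | f t * (c₀ + c₁ * t + c₂ * t ^ 2) ^ 2 = ε}) ht
  have hsub : (fun x : Fin 4 → ℝ => x 2) '' U ⊆ S := by
    refine hWc.subset_of_closure_inter_subset isOpen_interior
      ⟨x₀ 2, hUW x₀ hx₀, mem_interior_iff_mem_nhds.2 h₀⟩ ?_
    rintro u ⟨huS, x, hxU, rfl⟩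
    have hS : ∃ᶠ t in 𝓝 (x 2), t ∈ S := mem_closure_iff_frequently.1 huS
    -- The identity passes to the limit by continuity; it forces f ≠ 0 at the limit point, which
    -- makes the local form available there.
    have hval : f (x 2) * (c₀ + c₁ * x 2 + c₂ * x 2 ^ 2) ^ 2 = ε := by
      by_contra hcon
      have hcont : ContinuousAt (fun t => f t * (c₀ + c₁ * t + c₂ * t ^ 2) ^ 2) (x 2) :=
        (hf.continuousOn.continuousAt (hW.mem_nhds (hUW x hxU))).mul (by fun_prop)
      exact hS ((hcont.eventually_ne hcon).mono fun t ht htS => ht (hSmem t htS))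
    have hfx : f (x 2) ≠ 0 := fun h => hne hε (by rw [← hval, h, zero_mul])
    obtain ⟨ε', b₀, b₁, b₂, hε', h'⟩ :=
      exists_local_form hU hUc.isPreconnected hW hUW hx hf ha hna hxU hfx
    obtain ⟨s, hs, hs'⟩ := (hS.and_eventually h'.eventually_nhds).exists
    -- Near s both f c² = ε and f b² = ε' hold for the two quadratics, so ε b² = f b² c² = ε' c²;
    -- this polynomial identity then carries the old form across the limit point.
    have hpoly := eq_quadratic_of_eventually (α := ε) (β := ε') (a₀ := b₀) (a₁ := b₁) (a₂ := b₂)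
      (b₀ := c₀) (b₁ := c₁) (b₂ := c₂) (u := s) (by
        filter_upwards [mem_interior_iff_mem_nhds.1 hs, hs'] with t ht ht'
        rw [← show _ = ε from ht, ← ht']
        ring)
    refine mem_interior_iff_mem_nhds.2 ?_
    filter_upwards [h'] with t ht
    refine mul_left_cancel₀ (hne hε') ?_
    linear_combination (-f t) * hpoly t + ε * ht
  refine ⟨ε, c₀, c₁, c₂, hε, fun u hu => ?_⟩
  have h : f u * (c₀ + c₁ * u + c₂ * u ^ 2) ^ 2 = ε := hSmem u (hsub hu)
  have hQ : c₀ + c₁ * u + c₂ * u ^ 2 ≠ 0 := fun h0 => hne hε (by rw [← h, h0]; ring)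
  exact ⟨hQ, by rw [eq_div_iff (pow_ne_zero 2 hQ), h]⟩

theorem exists_killingTensor_of_killingVector (hU : IsOpen U) (hW : IsOpen W)
    (hUW : ∀ x ∈ U, x 2 ∈ W) (hx : ∀ x ∈ U, x 0 ≠ 0) (hf : ContDiffOn ℝ ∞ f W)
    {X : (Fin 4 → ℝ) → (Fin 4 → ℝ)} (hX : IsKillingVector (wilsMetric f) U X)
    (hX0 : ∃ x ∈ U, X x ≠ 0) :
    ∃ a : (Fin 4 → ℝ) → (Fin 2 → Fin 4) → ℝ, IsKillingTensor (wilsMetric f) U 2 a ∧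
      ¬ ∃ k : ℝ, ∀ x ∈ U, ∀ p, momentumPolynomial a x p = k * hamiltonian (wilsMetric f) x p := by
  obtain ⟨x, hxU, hXx⟩ := hX0
  refine ⟨squareTensor X, isKillingTensor_squareTensor hU hW hUW hx hf hX.1
    (fun y hy p => hX.poissonBracket_eq_zero hU hW hUW hx hf hy p), fun ⟨k, hk⟩ => hXx ?_⟩
  refine eq_zero_of_linearIntegral_sq (f := f) (hx x hxU) (k := k) fun p => ?_
  rw [← hk x hxU p, momentumPolynomial_squareTensor]

/-- Here f = ε/Q² has no zero and Q itself serves as the root P on all of U, so the local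
classification is already global. -/
theorem isPolynomialIntegral_two_iff (hU : IsOpen U) (hUc : IsPreconnected U) (hW : IsOpen W)
    (hUW : ∀ x ∈ U, x 2 ∈ W) (hx : ∀ x ∈ U, x 0 ≠ 0) (hf : ContDiffOn ℝ ∞ f W) {ε c₀ c₁ c₂ : ℝ}
    (h : HasWilsForm f W ε c₀ c₁ c₂) (I : (Fin 4 → ℝ) → (Fin 4 → ℝ) → ℝ) :
    IsPolynomialIntegral (wilsMetric f) U 2 I ↔ ∃ k₁ k₂ : ℝ, ∀ x ∈ U, ∀ p, I x p =
      k₁ * (linearIntegral (wilsVector c₀ c₁ c₂) x p) ^ 2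
        + k₂ * hamiltonian (wilsMetric f) x p := by
  constructor
  · rintro ⟨a, ha, hI⟩
    have hq : ∀ u, HasDerivAt (fun u => c₀ + c₁ * u + c₂ * u ^ 2) (c₁ + 2 * c₂ * u) u := fun u => by
      have := (((hasDerivAt_id u).const_mul c₁).const_add c₀).add
        ((hasDerivAt_pow 2 u).const_mul c₂)
      convert! this using 1
      simp
      ring
    have hq' : ∀ u, HasDerivAt (fun u => c₁ + 2 * c₂ * u) (2 * c₂) u := fun u => by
      simpa using ((hasDerivAt_id u).const_mul (2 * c₂)).const_add c₁
    have e1 : deriv (fun u => c₀ + c₁ * u + c₂ * u ^ 2) = fun u => c₁ + 2 * c₂ * u :=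
      funext fun u => (hq u).deriv
    have e2 : deriv (fun u => c₁ + 2 * c₂ * u) = fun _ => 2 * c₂ := funext fun u => (hq' u).deriv
    obtain ⟨k, l, -, hkl⟩ := momentumPolynomial_eq_of_root hU hUc hW hUW hx hf
      (P := fun u => c₀ + c₁ * u + c₂ * u ^ 2) (ε := ε) (ContDiff.contDiffOn (by fun_prop))
      (by rcases h.1 with rfl | rfl <;> norm_num)
      (fun u hu => by rw [(h.2 u hu).2, div_mul_cancel₀ _ (pow_ne_zero 2 (h.2 u hu).1)]) ha
    refine ⟨k, l, fun x hxU p => ?_⟩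
    rw [hI x hxU, hkl x hxU, linearIntegral_wilsVector, e1, e2]
  · rintro ⟨k₁, k₂, hI⟩
    have hX := isKillingVector_wilsVector hW hUW (hf.differentiableOn (by simp)) h
    refine ⟨_, (isKillingTensor_squareTensor hU hW hUW hx hf hX.1 (fun y hy p =>
      hX.poissonBracket_eq_zero hU hW hUW hx hf hy p)).linear hU hW hUW hx hf
        (isKillingTensor_energyTensor hUW hx hf) k₁ k₂, fun x hxU p => ?_⟩
    rw [hI x hxU, momentumPolynomial_linear, momentumPolynomial_squareTensor,
      momentumPolynomial_energyTensor]

end Main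

end KillingWils

end
-- The theorem
theorem mainTheorem6 (f : ℝ → ℝ) (U : Set (Fin 4 → ℝ)) (hU : IsOpen U) (hUc : IsConnected U)
    (hx : ∀ x ∈ U, x 0 ≠ 0)
    (hf : ContDiffOn ℝ ∞ f ((fun x : Fin 4 → ℝ => x 2) '' U))
    (hf0 : ∃ x ∈ U, f (x 2) ≠ 0) :
    ((∃ a : (Fin 4 → ℝ) → (Fin 2 → Fin 4) → ℝ,
        KillingWils.IsKillingTensor (KillingWils.wilsMetric f) U 2 a ∧
        ¬ ∃ k : ℝ, ∀ x ∈ U, ∀ p, KillingWils.momentumPolynomial a x p =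
          k * KillingWils.hamiltonian (KillingWils.wilsMetric f) x p) ↔
      ∃ X : (Fin 4 → ℝ) → (Fin 4 → ℝ),
        KillingWils.IsKillingVector (KillingWils.wilsMetric f) U X ∧ ∃ x ∈ U, X x ≠ 0) ∧
    ((∃ X : (Fin 4 → ℝ) → (Fin 4 → ℝ),
        KillingWils.IsKillingVector (KillingWils.wilsMetric f) U X ∧ ∃ x ∈ U, X x ≠ 0) ↔
      ∃ ε c₀ c₁ c₂ : ℝ,
        KillingWils.HasWilsForm f ((fun x : Fin 4 → ℝ => x 2) '' U) ε c₀ c₁ c₂) ∧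
    (∀ ε c₀ c₁ c₂ : ℝ,
      KillingWils.HasWilsForm f ((fun x : Fin 4 → ℝ => x 2) '' U) ε c₀ c₁ c₂ →
      KillingWils.IsKillingVector (KillingWils.wilsMetric f) U
        (KillingWils.wilsVector c₀ c₁ c₂) ∧
      KillingWils.IsPolynomialIntegral (KillingWils.wilsMetric f) U 1
        (KillingWils.linearIntegral (KillingWils.wilsVector c₀ c₁ c₂)) ∧
      ∀ I : (Fin 4 → ℝ) → (Fin 4 → ℝ) → ℝ,
        KillingWils.IsPolynomialIntegral (KillingWils.wilsMetric f) U 2 I ↔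
        ∃ k₁ k₂ : ℝ, ∀ x ∈ U, ∀ p, I x p =
          k₁ * (KillingWils.linearIntegral (KillingWils.wilsVector c₀ c₁ c₂) x p) ^ 2
            + k₂ * KillingWils.hamiltonian (KillingWils.wilsMetric f) x p) := by
  have hW : IsOpen ((fun x : Fin 4 → ℝ => x 2) '' U) := isOpenMap_eval 2 U hU
  have hUW : ∀ x ∈ U, x 2 ∈ (fun x : Fin 4 → ℝ => x 2) '' U := fun x hxU => ⟨x, hxU, rfl⟩
  have tensor_form := fun a ha hna =>
    KillingWils.exists_hasWilsForm (a := a) hU hUc hx hW hf hf0 ha hna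
  have vector_tensor := fun X hX hX0 =>
    KillingWils.exists_killingTensor_of_killingVector (X := X) hU hW hUW hx hf hX hX0
  have form_vector := fun ε c₀ c₁ c₂ h =>
    KillingWils.isKillingVector_wilsVector (U := U) (ε := ε) (c₀ := c₀) (c₁ := c₁) (c₂ := c₂) hW hUW
      (hf.differentiableOn (by simp)) h
  have form_vector' : (∃ ε c₀ c₁ c₂ : ℝ,
      KillingWils.HasWilsForm f ((fun x : Fin 4 → ℝ => x 2) '' U) ε c₀ c₁ c₂) →
      ∃ X : (Fin 4 → ℝ) → (Fin 4 → ℝ),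
        KillingWils.IsKillingVector (KillingWils.wilsMetric f) U X ∧ ∃ x ∈ U, X x ≠ 0 := by
    rintro ⟨ε, c₀, c₁, c₂, h⟩
    obtain ⟨x, hxU⟩ := hUc.nonempty
    -- The u-component of the vector field is Q, which has no zero.
    exact ⟨_, form_vector ε c₀ c₁ c₂ h, x, hxU, fun h0 => (h.2 _ (hUW x hxU)).1 (congrFun h0 2)⟩
  refine ⟨⟨fun ⟨a, ha, hna⟩ => form_vector' (tensor_form a ha hna),
    fun ⟨X, hX, hX0⟩ => vector_tensor X hX hX0⟩, ⟨fun ⟨X, hX, hX0⟩ => ?_, form_vector'⟩,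
    fun ε c₀ c₁ c₂ h => ?_⟩
  · obtain ⟨a, ha, hna⟩ := vector_tensor X hX hX0
    exact tensor_form a ha hna
  · have hX := form_vector ε c₀ c₁ c₂ h
    exact ⟨hX, KillingWils.isPolynomialIntegral_linearIntegral hX.1 fun x hxU p =>
        hX.poissonBracket_eq_zero hU hW hUW hx hf hxU p,
      KillingWils.isPolynomialIntegral_two_iff hU hUc.isPreconnected hW hUW hx hf h⟩
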